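/- Let $(M,g)$ be a space-time, i.e. a connected smooth $4$-manifold $M$ with a smooth Lorentz metric $g$ of signature $(-,+,+,+)$, with Levi-Civita connection $\nabla$, Ricci tensor $R_{ab}$ and Ricci scalar $R=R^a{}_a$. Suppose that at every point the Ricci tensor has Segré type $\{(1,11)1\}$: there are a pseudo-orthonormal basis $u,v_1,v_2,v_3$ of the tangent space ($u$ timelike, the $v_\alpha$ spacelike) and real numbers $\rho\neq\sigma$ with $R^a{}_b u^b=\rho u^a$, $R^a{}_b v_1^b=\rho v_1^a$, $R^a{}_b v_2^b=\rho v_2^a$ and $R^a{}_b v_3^b=\sigma v_3^a$. Then $(M,g)$ is a Yang Pure Space, that is, $$\nabla_a R_{bc}-\nabla_b R_{ac}=0 \quad\text{on } M,$$ if and only if the Ricci scalar $R$ is constant on $M$ and there is a constant $k\in\mathbb{R}$ such that every point of $M$ has a neighbourhood with smooth local coordinates $(t,x,y,z)$ in which the line element is $$ds^2=dz^2+\frac{A(z)^2}{\left(1+\frac{k}{4}(x^2+y^2-t^2)\right)^2}\,(dx^2+dy^2-dt^2)$$ for some smooth positive function $A$ of the coordinate $z$ (which may depend on the neighbourhood),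 with $1+\frac{k}{4}(x^2+y^2-t^2)\neq 0$ there. -/

import Mathlib

open scoped Manifold ContDiff Matrix

noncomputable section

namespace Yang

/-- The coordinate space `ℝ⁴`. Coordinates are ordered `(t, x, y, z)`. -/
abbrev E4 : Type := EuclideanSpace ℝ (Fin 4)

/-- The signature `(-, +, +, +)`. -/
def eta : Matrix (Fin 4) (Fin 4) ℝ := Matrix.diagonal ![-1, 1, 1, 1]

/-! ### Classical tensor calculus in one coordinate system

`G y` is the matrix `g_{ij}(y)` of a metric at the coordinate point `y`. -/

/-- The partial derivative `∂_i f` at `y`. -/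
def pd (i : Fin 4) (f : E4 → ℝ) (y : E4) : ℝ :=
  fderiv ℝ f y (EuclideanSpace.single i 1)

/-- The Christoffel symbol
`Γ^k_{ij} = (1/2) g^{kl} (∂_i g_{jl} + ∂_j g_{il} - ∂_l g_{ij})`. -/
def christoffel (G : E4 → Matrix (Fin 4) (Fin 4) ℝ) (k i j : Fin 4) (y : E4) : ℝ :=
  (1 / 2) * ∑ l, (G y)⁻¹ k l *
    (pd i (fun q => G q j l) y + pd j (fun q => G q i l) y - pd l (fun q => G q i j) y)

/-- The Ricci tensor
`R_{ij} = ∂_k Γ^k_{ij} - ∂_j Γ^k_{ik} + Γ^k_{kl} Γ^l_{ij} - Γ^k_{jl} Γ^l_{ik}`. -/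
def ricci (G : E4 → Matrix (Fin 4) (Fin 4) ℝ) (y : E4) : Matrix (Fin 4) (Fin 4) ℝ :=
  Matrix.of fun i j =>
    ∑ k, (pd k (christoffel G k i j) y - pd j (christoffel G k i k) y)
      + ∑ k, ∑ l, (christoffel G k k l y * christoffel G l i j y
          - christoffel G k j l y * christoffel G l i k y)

/-- The Ricci tensor with one index raised, `R^i_j = g^{ik} R_{kj}`. -/
def ricciMixed (G : E4 → Matrix (Fin 4) (Fin 4) ℝ) (y : E4) : Matrix (Fin 4) (Fin 4) ℝ :=
  (G y)⁻¹ * ricci G y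

/-- The Ricci scalar `R = R^i_i`. -/
def ricciScalar (G : E4 → Matrix (Fin 4) (Fin 4) ℝ) (y : E4) : ℝ :=
  (ricciMixed G y).trace

/-- The covariant derivative
`∇_a R_{bc} = ∂_a R_{bc} - Γ^d_{ab} R_{dc} - Γ^d_{ac} R_{bd}` of the Ricci tensor. -/
def covRicci (G : E4 → Matrix (Fin 4) (Fin 4) ℝ) (a b c : Fin 4) (y : E4) : ℝ :=
  pd a (fun q => ricci G q b c) y
    - ∑ d, christoffel G d a b y * ricci G y d c
    - ∑ d, christoffel G d a c y * ricci G y b d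

/-- Segré type `{(1,11)1}` at the point `y`: there is a pseudo-orthonormal tetrad
`v 0` (timelike), `v 1`, `v 2`, `v 3` (spacelike) of eigenvectors of `R^a_b`, the
eigenvalues of `v 0`, `v 1`, `v 2` being equal and that of `v 3` being different. -/
def SegreAt (G : E4 → Matrix (Fin 4) (Fin 4) ℝ) (y : E4) : Prop :=
  ∃ v : Fin 4 → Fin 4 → ℝ, (∀ a b, v a ⬝ᵥ (G y *ᵥ v b) = eta a b) ∧
    ∃ ρ σ : ℝ, ρ ≠ σ ∧
      ricciMixed G y *ᵥ v 0 = ρ • v 0 ∧ ricciMixed G y *ᵥ v 1 = ρ • v 1 ∧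
      ricciMixed G y *ᵥ v 2 = ρ • v 2 ∧ ricciMixed G y *ᵥ v 3 = σ • v 3

/-- The matrix, in the coordinates `(t, x, y, z) = (q 0, q 1, q 2, q 3)`, of the line element
`dz² + A(z)² (1 + (k/4)(x² + y² - t²))⁻² (dx² + dy² - dt²)`. -/
def lineElement (k : ℝ) (A : ℝ → ℝ) (q : E4) : Matrix (Fin 4) (Fin 4) ℝ :=
  let f : ℝ := A (q 3) ^ 2 / (1 + k / 4 * (q 1 ^ 2 + q 2 ^ 2 - q 0 ^ 2)) ^ 2
  Matrix.diagonal ![-f, f, f, 1]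

/-! ### Lorentz metrics on a 4-manifold -/

section

variable {M : Type*} [TopologicalSpace M] [ChartedSpace E4 M]

/-- The matrix of components `g_{ij} = g(∂_i, ∂_j)`, in the local coordinate system `e`, of a
field `g` of bilinear forms on the tangent spaces; meaningful at points of `e.target`. -/
def components
    (g : ∀ p : M, TangentSpace (𝓡 4) p →L[ℝ] TangentSpace (𝓡 4) p →L[ℝ] ℝ)
    (e : OpenPartialHomeomorph M E4) (y : E4) : Matrix (Fin 4) (Fin 4) ℝ :=
  Matrix.of fun i j =>
    g (e.symm y)
      (mfderiv (𝓡 4) (𝓡 4) e.symm y (EuclideanSpace.single i (1 : ℝ) : E4))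
      (mfderiv (𝓡 4) (𝓡 4) e.symm y (EuclideanSpace.single j (1 : ℝ) : E4))

end

/-- A smooth Lorentz metric, of signature `(-, +, +, +)`, on a 4-manifold. -/
structure LorentzMetric (M : Type*) [TopologicalSpace M] [ChartedSpace E4 M] where
  /-- The bilinear form on each tangent space. -/
  val : ∀ p : M, TangentSpace (𝓡 4) p →L[ℝ] TangentSpace (𝓡 4) p →L[ℝ] ℝ
  symm : ∀ (p : M) (v w : TangentSpace (𝓡 4) p), val p v w = val p w v
  /-- Each tangent space has a pseudo-orthonormal basis. -/
  lorentz : ∀ p : M, ∃ b : Module.Basis (Fin 4) ℝ (TangentSpace (𝓡 4) p),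
    ∀ i j, val p (b i) (b j) = eta i j
  /-- The components in every smooth local coordinate system are smooth. -/
  smooth : ∀ e ∈ IsManifold.maximalAtlas (𝓡 4) ∞ M, ∀ i j,
    ContDiffOn ℝ ∞ (fun y => components val e y i j) e.target

namespace LorentzMetric

section

variable {M : Type*} [TopologicalSpace M] [ChartedSpace E4 M] (g : LorentzMetric M)

/-- The Ricci tensor has Segré type `{(1,11)1}` at every point. -/
def HasSegreType : Prop :=
  ∀ e ∈ IsManifold.maximalAtlas (𝓡 4) ∞ M, ∀ y ∈ e.target, SegreAt (components g.val e) y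

/-- Yang pure space: `∇_a R_{bc} - ∇_b R_{ac} = 0` everywhere. -/
def IsYangPureSpace : Prop :=
  ∀ e ∈ IsManifold.maximalAtlas (𝓡 4) ∞ M, ∀ y ∈ e.target, ∀ a b c,
    covRicci (components g.val e) a b c y - covRicci (components g.val e) b a c y = 0

/-- The Ricci scalar is constant on the whole manifold. -/
def HasConstantRicciScalar : Prop :=
  ∃ R₀ : ℝ, ∀ e ∈ IsManifold.maximalAtlas (𝓡 4) ∞ M, ∀ y ∈ e.target,
    ricciScalar (components g.val e) y = R₀

/-- With one constant `k` for the whole manifold, every point has a coordinate neighbourhood in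
which the metric is `dz² + A(z)² (1 + (k/4)(x² + y² - t²))⁻² (dx² + dy² - dt²)`, for a smooth
positive function `A` on the set of values of the coordinate `z`. -/
def HasLineElement : Prop :=
  ∃ k : ℝ, ∀ p : M, ∃ e ∈ IsManifold.maximalAtlas (𝓡 4) ∞ M, p ∈ e.source ∧
    ∃ A : ℝ → ℝ,
      ContDiffOn ℝ ∞ A ((fun q : E4 => q 3) '' e.target) ∧
      ∀ q ∈ e.target, 0 < A (q 3) ∧
        1 + k / 4 * (q 1 ^ 2 + q 2 ^ 2 - q 0 ^ 2) ≠ 0 ∧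
        components g.val e q = lineElement k A q

end

end LorentzMetric

end Yang

end

set_option linter.unusedSectionVars false

noncomputable section

namespace Yang


/-! ### Tensor calculus over a commutative ring with commuting derivations -/

section DifferentialRing

open Matrix Finset

variable {ι : Type*} [Fintype ι] [DecidableEq ι] {R : Type*} [CommRing R] [Algebra ℝ R]

/-! Write Ric = ρ g + μ n⊗n, where n is a unit covector for the simple eigenvalue and μ = σ - ρ
never vanishes.

Suppose Ric is a Codazzi tensor. The twice contracted second Bianchi identity then gives div Ric =
0, while the Codazzi equation identifies div Ric with dR; so R = 4ρ + μ is locally constant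
(`derivation_scalar_eq_zero`). Putting Ric = ρ g + μ n⊗n and dμ = -4 dρ into the Codazzi equation
and contracting in the possible ways gives dρ = τ n and ∇n = H (g - n⊗n) with H = τ/μ
(`codazzi_isUmbilic`). Hence n is closed, locally n = dz, and the leaves z = const are totally
umbilic. The Ricci identity for n fixes every curvature component with a normal index. The other
components form a three-dimensional curvature tensor, which is determined by its Ricci tensor
(`weyl_eq_zero`), so each leaf has isotropic curvature, with intrinsic value ψ. The function A =
|μ|^(-1/4) satisfies dA = H A n, and A²ψ has zero differential. Since A²ψ can be written with scalar
invariants of g alone (`leafCurvature`), it is the same function in all charts, and on a connected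
manifold it is a single constant k.

The coordinates come from an overdetermined linear system. Functions f that are constant along the
normal and restrict to the leaves as linear coordinates on a quadric satisfy Hess f = -k f for the
rescaled leaf metric. These equations are the parallel sections of the connection `prolong`, whose
flatness is equivalent to the curvature statements above (`prolong_flat` proves the direction
needed). A Frobenius theorem for linear systems (`exists_parallel`) yields three solutions with
orthonormal initial differentials, and first integrals keep their Gram matrix under control.
Stereographic projection of these functions, together with z, has exactly the Gram matrix of the
inverse line element (`stereographic_gram`), and the inverse function theorem makes them a chart.

Conversely, for the line element Ric = ρ g + μ n⊗n with n = dz umbilic, ρ and μ are functions of z,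
and R = 6 (κ - H' - 2H²), with κ = k/A² and H = A'/A. Constancy of R is the one ordinary
differential equation that makes Ric Codazzi (`WarpedData.cov_ric_comm`). Tensoriality carries the
equation to every chart.

The tensor identities are proved over a commutative ℝ-algebra with commuting derivations, then
applied to the ring `SmoothFn U`; evaluation at points returns to the classical formulas. -/

theorem map_mul_derivation {l m n : Type*} [Fintype m] (d : Derivation ℝ R R)
    (X : Matrix l m R) (Y : Matrix m n R) :
    (X * Y).map d = X.map d * Y + X * Y.map d := by
  ext i j
  simp only [Matrix.map_apply, Matrix.mul_apply, map_sum, Derivation.leibniz, smul_eq_mul,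
    Matrix.add_apply, ← Finset.sum_add_distrib]
  exact Finset.sum_congr rfl fun k _ => by ring

theorem map_one_derivation (d : Derivation ℝ R R) : (1 : Matrix ι ι R).map d = 0 := by
  ext i j
  by_cases h : i = j <;> simp [h]

theorem map_add_derivation {l m : Type*} (d : Derivation ℝ R R) (X Y : Matrix l m R) :
    (X + Y).map d = X.map d + Y.map d := by
  ext; simp

theorem map_sub_derivation {l m : Type*} (d : Derivation ℝ R R) (X Y : Matrix l m R) :
    (X - Y).map d = X.map d - Y.map d := by
  ext; simp

theorem map_inv_derivation (d : Derivation ℝ R R) {X Y : Matrix ι ι R} (h : X * Y = 1) :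
    Y.map d = -(Y * X.map d * Y) := by
  have h' : Y * X = 1 := mul_eq_one_comm.mp h
  have := map_mul_derivation d X Y
  rw [h, map_one_derivation] at this
  have h2 : X * Y.map d = -(X.map d * Y) := by
    rw [eq_neg_iff_add_eq_zero, add_comm]; exact this.symm
  calc Y.map d = (Y * X) * Y.map d := by rw [h', one_mul]
    _ = Y * (X * Y.map d) := by rw [Matrix.mul_assoc]
    _ = _ := by rw [h2]; simp [Matrix.mul_assoc]

/-- The Christoffel symbols `Γ_i = (Γ^k_{ij})_{kj}` of the metric `G` with inverse `Gi`. -/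
def chr (D : ι → Derivation ℝ R R) (G Gi : Matrix ι ι R) (i : ι) : Matrix ι ι R :=
  Matrix.of fun k j => (1 / 2 : ℝ) • ∑ l, Gi k l * (D i (G j l) + D j (G i l) - D l (G i j))

/-- The curvature `∂_i Γ_j - ∂_j Γ_i + [Γ_i, Γ_j]`. -/
def curv (D : ι → Derivation ℝ R R) (Γ : ι → Matrix ι ι R) (i j : ι) : Matrix ι ι R :=
  (Γ j).map (D i) - (Γ i).map (D j) + Γ i * Γ j - Γ j * Γ i

/-- The Ricci tensor of a connection. -/
def ric (D : ι → Derivation ℝ R R) (Γ : ι → Matrix ι ι R) : Matrix ι ι R :=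
  Matrix.of fun i j => ∑ k, curv D Γ k j k i

/-- The covariant derivative of a tensor with two lower indices. -/
def cov (D : ι → Derivation ℝ R R) (Γ : ι → Matrix ι ι R) (a : ι) (X : Matrix ι ι R) :
    Matrix ι ι R :=
  X.map (D a) - (Γ a)ᵀ * X - X * Γ a

/-- `Γ` is the torsion-free metric connection of the symmetric matrix `G`. -/
structure IsLeviCivita (D : ι → Derivation ℝ R R) (G : Matrix ι ι R)
    (Γ : ι → Matrix ι ι R) : Prop where
  comm : ∀ i j f, D i (D j f) = D j (D i f)
  symm : Gᵀ = G
  torsion : ∀ i j k, Γ i k j = Γ j k i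
  compat : ∀ i, G.map (D i) = (Γ i)ᵀ * G + G * Γ i

variable {D : ι → Derivation ℝ R R} {G Gi : Matrix ι ι R} {Γ : ι → Matrix ι ι R}

/-- The ring is neither a field nor a domain; its ℝ-algebra structure is what permits halving, and
this is how factors of 2 are cancelled. -/
theorem half_smul_add_self (x : R) : (1 / 2 : ℝ) • (x + x) = x := by
  rw [← two_smul ℝ x, smul_smul]; norm_num

theorem mul_chr (hG : G * Gi = 1) (i j l : ι) :
    (G * chr D G Gi i) l j = (1 / 2 : ℝ) • (D i (G j l) + D j (G i l) - D l (G i j)) := by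
  have h1 : chr D G Gi i = (1 / 2 : ℝ) •
      (Gi * Matrix.of fun l j => D i (G j l) + D j (G i l) - D l (G i j)) := by
    ext k j; simp [chr, Matrix.mul_apply]
  rw [h1, Matrix.mul_smul, ← Matrix.mul_assoc, hG, one_mul]
  simp

theorem isLeviCivita_chr (hD : ∀ i j f, D i (D j f) = D j (D i f)) (hs : Gᵀ = G)
    (hG : G * Gi = 1) : IsLeviCivita D G (chr D G Gi) := by
  have hsym : ∀ a b, G a b = G b a := fun a b => by
    conv_lhs => rw [← hs]
    rfl
  refine ⟨hD, hs, fun i j k => ?_, fun i => ?_⟩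
  · simp only [chr, Matrix.of_apply]
    congr 1
    refine Finset.sum_congr rfl fun l _ => ?_
    rw [hsym i j]; ring
  · have h1 : (chr D G Gi i)ᵀ * G = (G * chr D G Gi i)ᵀ := by
      rw [Matrix.transpose_mul, hs]
    ext a b
    rw [h1, Matrix.add_apply, Matrix.transpose_apply, mul_chr hG, mul_chr hG, ← smul_add,
      Matrix.map_apply]
    rw [hsym b a, hsym i b, hsym i a]
    conv_lhs => rw [← half_smul_add_self (D i (G a b))]
    congr 1
    ring

namespace IsLeviCivita

theorem apply_comm (h : IsLeviCivita D G Γ) (a b : ι) : G a b = G b a := by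
  conv_lhs => rw [← h.symm]
  rfl

/-- Koszul's argument: compatibility and vanishing torsion determine G Γ. Uniqueness lets a
connection found by other means, by a change of coordinates or from an explicit table, be identified
with the Christoffel symbols without computing an inverse metric. -/
theorem eq_chr (h : IsLeviCivita D G Γ) (hG : G * Gi = 1) : Γ = chr D G Gi := by
  have hGi : Gi * G = 1 := mul_eq_one_comm.mp hG
  have hc : ∀ i a b, D i (G a b) = (G * Γ i) b a + (G * Γ i) a b := fun i a b => by
    have := congrFun (congrFun (h.compat i) a) b
    rw [Matrix.map_apply, Matrix.add_apply] at this
    rw [this]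
    congr 1
    rw [← Matrix.transpose_apply (G * Γ i), Matrix.transpose_mul, h.symm]
  have ht : ∀ i j l, (G * Γ i) l j = (G * Γ j) l i := fun i j l => by
    simp only [Matrix.mul_apply]
    exact Finset.sum_congr rfl fun k _ => by rw [h.torsion]
  funext i
  have key : G * Γ i = G * chr D G Gi i := by
    ext l j
    rw [mul_chr hG, hc, hc, hc, ht i l j, ht j l i, ht j i l]
    conv_lhs => rw [← half_smul_add_self ((G * Γ i) l j)]
    congr 1
    ring
  calc Γ i = Gi * (G * Γ i) := by rw [← Matrix.mul_assoc, hGi, one_mul]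
    _ = _ := by rw [key, ← Matrix.mul_assoc, hGi, one_mul]

theorem curv_swap (i j : ι) : curv D Γ j i = -curv D Γ i j := by
  simp only [curv]; noncomm_ring

/-- Two derivatives of G commute; expanding both orders by compatibility leaves exactly the
symmetric part of the lowered curvature. -/
theorem transpose_curv_mul (h : IsLeviCivita D G Γ) (i j : ι) :
    (curv D Γ i j)ᵀ * G = -(G * curv D Γ i j) := by
  have e : (G.map (D j)).map (D i) = (G.map (D i)).map (D j) := by
    ext a b; simp [h.comm i j]
  rw [h.compat, h.compat] at e
  simp only [map_add_derivation, map_mul_derivation, h.compat, transpose_map] at e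
  have e2 := sub_eq_zero.mpr e
  rw [← add_eq_zero_iff_eq_neg, ← e2]
  simp only [curv, transpose_add, transpose_sub, transpose_mul]
  noncomm_ring

theorem bianchi_first (h : IsLeviCivita D G Γ) (i j l k : ι) :
    curv D Γ i j k l + curv D Γ j l k i + curv D Γ l i k j = 0 := by
  have ht : ∀ a b c, (Γ a * Γ b) k c = (Γ a * Γ c) k b := fun a b c => by
    simp only [Matrix.mul_apply]
    exact Finset.sum_congr rfl fun m _ => by rw [h.torsion b c]
  simp only [curv, Matrix.sub_apply, Matrix.add_apply, Matrix.map_apply]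
  rw [h.torsion j l k, h.torsion i l k, h.torsion j i k, ht i j l, ht j i l, ht l j i]
  ring

/-- This is the Jacobi identity for the operators D i + Γ i, so neither a metric nor vanishing
torsion is involved. -/
theorem bianchi_second (hD : ∀ i j f, D i (D j f) = D j (D i f)) (k i j : ι) :
    ((curv D Γ i j).map (D k) + Γ k * curv D Γ i j - curv D Γ i j * Γ k)
    + ((curv D Γ j k).map (D i) + Γ i * curv D Γ j k - curv D Γ j k * Γ i)
    + ((curv D Γ k i).map (D j) + Γ j * curv D Γ k i - curv D Γ k i * Γ j) = 0 := by
  have e : ∀ (X : Matrix ι ι R) (a b : ι), (X.map (D a)).map (D b) = (X.map (D b)).map (D a) :=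
    fun X a b => by ext; simp [hD a b]
  simp only [curv, map_add_derivation, map_sub_derivation, map_mul_derivation]
  rw [e (Γ j) i k, e (Γ k) j i, e (Γ i) k j]
  noncomm_ring

/-- Conjugation by G sends the curvature matrix to minus its transpose, so its trace is its own
negative. -/
theorem trace_curv (h : IsLeviCivita D G Γ) (hG : G * Gi = 1) (i j : ι) :
    (curv D Γ i j).trace = 0 := by
  have hGi : Gi * G = 1 := mul_eq_one_comm.mp hG
  have e : (curv D Γ i j)ᵀ = -(G * curv D Γ i j * Gi) := by
    rw [← Matrix.neg_mul, ← h.transpose_curv_mul, Matrix.mul_assoc, hG, Matrix.mul_one]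
  have e2 := congrArg Matrix.trace e
  rw [Matrix.trace_transpose, Matrix.trace_neg, Matrix.mul_assoc, Matrix.trace_mul_comm,
    Matrix.mul_assoc, hGi, Matrix.mul_one] at e2
  rw [← half_smul_add_self (curv D Γ i j).trace]
  nth_rewrite 2 [e2]
  simp

theorem ric_apply_comm (h : IsLeviCivita D G Γ) (hG : G * Gi = 1) (i j : ι) :
    ric D Γ i j = ric D Γ j i := by
  have e : ∑ k, (curv D Γ k j k i + curv D Γ j i k k + curv D Γ i k k j) = 0 :=
    Finset.sum_eq_zero fun k _ => h.bianchi_first k j i k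
  rw [Finset.sum_add_distrib, Finset.sum_add_distrib] at e
  have e2 : ∑ k, curv D Γ j i k k = 0 := h.trace_curv hG j i
  have e3 : ∑ k, curv D Γ i k k j = -∑ k, curv D Γ k i k j := by
    rw [← Finset.sum_neg_distrib]
    exact Finset.sum_congr rfl fun k _ => by rw [curv_swap k i]; rfl
  rw [e2, e3] at e
  simp only [ric, Matrix.of_apply]
  linear_combination e

end IsLeviCivita

theorem sum_symm_mul_skew {A B : ι → ι → R} (hA : ∀ i j, A i j = A j i)
    (hB : ∀ i j, B i j = -B j i) : ∑ i, ∑ j, A i j * B i j = 0 := by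
  have e : ∑ i, ∑ j, A i j * B i j = -∑ i, ∑ j, A i j * B i j := by
    conv_lhs => rw [Finset.sum_comm]
    simp only [← Finset.sum_neg_distrib]
    exact Finset.sum_congr rfl fun i _ => Finset.sum_congr rfl fun j _ => by
      rw [hA j i, hB j i]; ring
  rw [← half_smul_add_self (∑ i, ∑ j, A i j * B i j)]
  nth_rewrite 2 [e]
  simp

theorem inv_transpose (hs : Gᵀ = G) (hG : G * Gi = 1) : Giᵀ = Gi := by
  have hGi : Gi * G = 1 := mul_eq_one_comm.mp hG
  have : Giᵀ * G = 1 := by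
    conv_lhs => rw [← hs, ← Matrix.transpose_mul, hG, Matrix.transpose_one]
  calc Giᵀ = Giᵀ * (G * Gi) := by rw [hG, Matrix.mul_one]
    _ = Gi := by rw [← Matrix.mul_assoc, this, Matrix.one_mul]

namespace IsLeviCivita

theorem compat_inv (h : IsLeviCivita D G Γ) (hG : G * Gi = 1) (i : ι) :
    Gi.map (D i) = -(Γ i * Gi) - Gi * (Γ i)ᵀ := by
  have hGi : Gi * G = 1 := mul_eq_one_comm.mp hG
  rw [map_inv_derivation _ hG, h.compat, Matrix.mul_add, Matrix.add_mul, ← Matrix.mul_assoc Gi G,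
    hGi, Matrix.one_mul, Matrix.mul_assoc Gi, Matrix.mul_assoc _ G, hG, Matrix.mul_one]
  abel

theorem curv_mul_inv_transpose (h : IsLeviCivita D G Γ) (hG : G * Gi = 1) (i j : ι) :
    (curv D Γ i j * Gi)ᵀ = -(curv D Γ i j * Gi) := by
  have hGi : Gi * G = 1 := mul_eq_one_comm.mp hG
  have e : (curv D Γ i j)ᵀ = -(G * curv D Γ i j * Gi) := by
    rw [← Matrix.neg_mul, ← h.transpose_curv_mul, Matrix.mul_assoc, hG, Matrix.mul_one]
  rw [Matrix.transpose_mul, inv_transpose h.symm hG, e, Matrix.mul_neg, ← Matrix.mul_assoc,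
    ← Matrix.mul_assoc, hGi, Matrix.one_mul]

theorem curv_mul_inv_skew (h : IsLeviCivita D G Γ) (hG : G * Gi = 1) (i j k m : ι) :
    (curv D Γ i j * Gi) k m = -(curv D Γ i j * Gi) m k :=
  congrFun (congrFun (h.curv_mul_inv_transpose hG i j) m) k

/-- Skew symmetry in both index pairs makes the two signs cancel when the contracted indices are
exchanged, so this contraction is again the Ricci tensor. -/
theorem sum_curv_mul_inv (h : IsLeviCivita D G Γ) (hG : G * Gi = 1) (i k : ι) :
    ∑ j, (curv D Γ i j * Gi) k j = (Gi * ric D Γ) k i := by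
  have hsym : ∀ a b, Gi a b = Gi b a := fun a b => by
    conv_lhs => rw [← inv_transpose h.symm hG]
    rfl
  have e : ∀ j, (curv D Γ i j * Gi) k j = (curv D Γ j i * Gi) j k := fun j => by
    rw [h.curv_mul_inv_skew hG, curv_swap j i]; simp
  simp only [e, Matrix.mul_apply, ric, Matrix.of_apply, Finset.mul_sum]
  rw [Finset.sum_comm]
  exact Finset.sum_congr rfl fun l _ => Finset.sum_congr rfl fun j _ => by
    rw [hsym k l]; ring

theorem map_inv_mul (h : IsLeviCivita D G Γ) (hG : G * Gi = 1) (i : ι) (X : Matrix ι ι R) :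
    (Gi * X).map (D i) = Gi * cov D Γ i X - Γ i * (Gi * X) + Gi * X * Γ i := by
  rw [map_mul_derivation, h.compat_inv hG, cov]
  noncomm_ring

theorem cov_apply_comm {X : Matrix ι ι R} (hX : ∀ i j, X i j = X j i)
    (a b c : ι) : cov D Γ a X b c = cov D Γ a X c b := by
  simp only [cov, Matrix.sub_apply, Matrix.map_apply, Matrix.mul_apply, Matrix.transpose_apply]
  rw [hX b c]
  have e1 : ∀ b c, ∑ j, Γ a j b * X j c = ∑ j, X c j * Γ a j b := fun b c =>
    Finset.sum_congr rfl fun j _ => by rw [hX j c]; ring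
  rw [e1 b c, e1 c b]
  ring

/-- The derivative of a matrix valued function, covariant under gauge transformations. -/
def gaugeDeriv (D : ι → Derivation ℝ R R) (Γ : ι → Matrix ι ι R) (i : ι) (X : Matrix ι ι R) :
    Matrix ι ι R :=
  X.map (D i) + Γ i * X - X * Γ i

theorem gaugeDeriv_neg (i : ι) (X : Matrix ι ι R) :
    gaugeDeriv D Γ i (-X) = -gaugeDeriv D Γ i X := by
  have : (-X).map (D i) = -X.map (D i) := by ext; simp
  rw [gaugeDeriv, gaugeDeriv, this]
  noncomm_ring

theorem gaugeDeriv_mul_inv (h : IsLeviCivita D G Γ) (hG : G * Gi = 1) (i : ι)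
    (X : Matrix ι ι R) :
    gaugeDeriv D Γ i X * Gi = (X * Gi).map (D i) + Γ i * (X * Gi) + X * Gi * (Γ i)ᵀ := by
  rw [gaugeDeriv, map_mul_derivation, h.compat_inv hG]
  noncomm_ring

/-- The twice contracted second Bianchi identity for a Ricci tensor of Codazzi type:
its divergence vanishes. -/
theorem divergence_ric_eq_zero (h : IsLeviCivita D G Γ) (hG : G * Gi = 1)
    (hY : ∀ a b c, cov D Γ a (ric D Γ) b c = cov D Γ b (ric D Γ) a c) (i : ι) :
    ∑ k, (Gi * cov D Γ k (ric D Γ)) k i = 0 := by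
  set F := curv D Γ with hF
  set S := Gi * ric D Γ with hS
  -- One contraction of the second Bianchi identity. The two ∇Ric terms cancel by the Codazzi
  -- equation. What stays on the right is non-tensorial, because `gaugeDeriv` does not correct the
  -- two form indices.
  have once : ∀ j l, ∑ k, gaugeDeriv D Γ k (F i j) k l
      = ∑ k, ((Γ i * F k j) k l - (Γ j * F k i) k l) := by
    intro j l
    have t : ∀ i j, ∑ k, gaugeDeriv D Γ i (F k j) k l
        = cov D Γ i (ric D Γ) l j + (ric D Γ * Γ i) l j + ∑ k, (Γ i * F k j) k l := by
      intro i j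
      have t1 : ∑ k, (F k j * Γ i) k l = ((Γ i)ᵀ * ric D Γ) l j := by
        simp only [Matrix.mul_apply, ric, Matrix.of_apply, Finset.mul_sum, Matrix.transpose_apply]
        rw [Finset.sum_comm]
        exact Finset.sum_congr rfl fun l _ => Finset.sum_congr rfl fun j _ => by ring
      have t2 : ∑ k, (F k j).map (D i) k l = (ric D Γ).map (D i) l j := by
        simp [ric, ← hF]
      simp only [gaugeDeriv, Matrix.sub_apply, Matrix.add_apply, Finset.sum_add_distrib,
        Finset.sum_sub_distrib, t1, t2, cov]
      ring
    have b : ∀ k, gaugeDeriv D Γ k (F i j) k l =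
        gaugeDeriv D Γ i (F k j) k l - gaugeDeriv D Γ j (F k i) k l := by
      intro k
      have b1 : gaugeDeriv D Γ k (F i j) + gaugeDeriv D Γ i (F j k) + gaugeDeriv D Γ j (F k i)
        = 0 := bianchi_second h.comm k i j
      have b2 : F j k = -F k j := curv_swap k j
      rw [b2, gaugeDeriv_neg] at b1
      have b3 := congrFun (congrFun b1 k) l
      simp only [Matrix.add_apply, Matrix.neg_apply, Matrix.zero_apply] at b3
      linear_combination b3
    have b4 : (ric D Γ * Γ i) l j = (ric D Γ * Γ j) l i := by
      simp only [Matrix.mul_apply]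
      exact Finset.sum_congr rfl fun m _ => by rw [h.torsion]
    have b5 : cov D Γ i (ric D Γ) l j = cov D Γ j (ric D Γ) l i := by
      rw [cov_apply_comm (h.ric_apply_comm hG), hY, cov_apply_comm (h.ric_apply_comm hG)]
    rw [Finset.sum_congr rfl fun k _ => b k, Finset.sum_sub_distrib, t, t, b4, b5,
      Finset.sum_sub_distrib]
    ring
  -- The second contraction, with the inverse metric. The remaining terms containing Γ either pair a
  -- symmetric array with a skew one or assemble the covariant derivative of the mixed Ricci tensor.
  have twice : ∑ j, ∑ k, (gaugeDeriv D Γ k (F i j) * Gi) k j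
      = ∑ j, ∑ k, ((Γ i * (F k j * Gi)) k j - (Γ j * (F k i * Gi)) k j) := by
    refine Finset.sum_congr rfl fun j _ => ?_
    have e : ∀ X : ι → Matrix ι ι R, ∑ k, (X k * Gi) k j = ∑ l, (∑ k, X k k l) * Gi l j := by
      intro X
      simp only [Matrix.mul_apply, Finset.sum_mul]
      rw [Finset.sum_comm]
    have e' := e fun k => Γ i * F k j - Γ j * F k i
    simp only [Matrix.sub_mul, Matrix.sub_apply, Matrix.mul_assoc] at e'
    rw [e, e']
    exact Finset.sum_congr rfl fun l _ => by rw [once]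
  have hsk : ∀ i j k m, (F i j * Gi) k m = -(F i j * Gi) m k := h.curv_mul_inv_skew hG
  have hS' : ∀ k m, ∑ j, (F k j * Gi) m j = S m k := fun k m => h.sum_curv_mul_inv hG k m
  have l1 : ∑ j, ∑ k, ((F i j * Gi).map (D k)) k j = ∑ k, D k (S k i) := by
    rw [Finset.sum_comm]
    exact Finset.sum_congr rfl fun k _ => by simp only [Matrix.map_apply, ← map_sum, hS']
  have l2 : ∑ j, ∑ k, (Γ k * (F i j * Gi)) k j = ∑ k, (Γ k * S) k i := by
    rw [Finset.sum_comm]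
    refine Finset.sum_congr rfl fun k _ => ?_
    simp only [Matrix.mul_apply (M := Γ k)]
    rw [Finset.sum_comm]
    exact Finset.sum_congr rfl fun m _ => by rw [← Finset.mul_sum, hS']
  have l3 : ∑ j, ∑ k, (F i j * Gi * (Γ k)ᵀ) k j = 0 := by
    refine Finset.sum_eq_zero fun j _ => ?_
    simp only [Matrix.mul_apply (M := _ * Gi), Matrix.transpose_apply]
    rw [← sum_symm_mul_skew (fun a b => h.torsion a b j) (hsk i j)]
    exact Finset.sum_congr rfl fun k _ => Finset.sum_congr rfl fun m _ => mul_comm _ _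
  have r1 : ∑ j, ∑ k, (Γ i * (F k j * Gi)) k j = ∑ k, (S * Γ k) k i := by
    rw [Finset.sum_comm]
    simp only [Matrix.mul_apply (M := Γ i), Matrix.mul_apply (M := S)]
    calc _ = ∑ k, ∑ m, Γ i k m * S m k := by
          refine Finset.sum_congr rfl fun k _ => ?_
          rw [Finset.sum_comm]
          exact Finset.sum_congr rfl fun m _ => by rw [← Finset.mul_sum, hS']
      _ = _ := by
          rw [Finset.sum_comm]
          exact Finset.sum_congr rfl fun k _ => Finset.sum_congr rfl fun m _ => by
            rw [h.torsion i k m, mul_comm]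
  have r2 : ∑ j, ∑ k, (Γ j * (F k i * Gi)) k j = 0 := by
    rw [Finset.sum_comm]
    refine Finset.sum_eq_zero fun k _ => ?_
    simp only [Matrix.mul_apply (M := Γ _)]
    rw [← sum_symm_mul_skew (fun a b => h.torsion a b k) fun a b => hsk k i b a]
  simp only [h.gaugeDeriv_mul_inv hG, Matrix.add_apply, Finset.sum_add_distrib,
    Finset.sum_sub_distrib, l1, l2, l3, r1, r2] at twice
  have fin : ∀ k, (Gi * cov D Γ k (ric D Γ)) k i
      = D k (S k i) + (Γ k * S) k i - (S * Γ k) k i := by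
    intro k
    have := congrFun (congrFun (h.map_inv_mul hG k (ric D Γ)) k) i
    simp only [← hS, Matrix.add_apply, Matrix.sub_apply, Matrix.map_apply] at this
    rw [this]; ring
  rw [Finset.sum_congr rfl fun k _ => fin k, Finset.sum_sub_distrib, Finset.sum_add_distrib]
  linear_combination twice

/-- If the Ricci tensor is a Codazzi tensor, the Ricci scalar is constant. -/
theorem derivation_scalar_eq_zero (h : IsLeviCivita D G Γ) (hG : G * Gi = 1)
    (hY : ∀ a b c, cov D Γ a (ric D Γ) b c = cov D Γ b (ric D Γ) a c) (i : ι) :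
    D i (Gi * ric D Γ).trace = 0 := by
  have e1 : D i (Gi * ric D Γ).trace = (Gi * cov D Γ i (ric D Γ)).trace := by
    have := congrArg Matrix.trace (h.map_inv_mul hG i (ric D Γ))
    rw [Matrix.trace_add, Matrix.trace_sub, Matrix.trace_mul_comm (Γ i)] at this
    rw [sub_add_cancel] at this
    rw [← this]
    simp [Matrix.trace]
  -- By the Codazzi symmetry, differentiating the trace and taking the divergence are the same
  -- contraction of ∇Ric.
  rw [e1, ← h.divergence_ric_eq_zero hG hY i]
  simp only [Matrix.trace, Matrix.diag_apply, Matrix.mul_apply]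
  exact Finset.sum_congr rfl fun k _ => Finset.sum_congr rfl fun l _ => by
    rw [cov_apply_comm (h.ric_apply_comm hG) i, hY,
      cov_apply_comm (h.ric_apply_comm hG) k]

end IsLeviCivita

end DifferentialRing


/-! ### Covectors, Codazzi tensors and umbilic normals. -/

section DifferentialRing

open Matrix Finset

variable {ι : Type*} [Fintype ι] [DecidableEq ι] {R : Type*} [CommRing R] [Algebra ℝ R]

/-- The covariant derivative of a covector in a fixed direction. -/
def covVec (D : ι → Derivation ℝ R R) (Γ : ι → Matrix ι ι R) (a : ι) (w : ι → R) : ι → R :=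
  (fun b => D a (w b)) - (Γ a)ᵀ *ᵥ w

variable {D : ι → Derivation ℝ R R} {G Gi : Matrix ι ι R} {Γ : ι → Matrix ι ι R}

theorem derivation_dotProduct (d : Derivation ℝ R R) (v w : ι → R) :
    d (v ⬝ᵥ w) = (fun b => d (v b)) ⬝ᵥ w + v ⬝ᵥ (fun b => d (w b)) := by
  simp only [dotProduct, map_sum, Derivation.leibniz, smul_eq_mul, ← Finset.sum_add_distrib]
  exact Finset.sum_congr rfl fun k _ => by ring

theorem derivation_mulVec (d : Derivation ℝ R R) (M : Matrix ι ι R) (w : ι → R) :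
    (fun b => d ((M *ᵥ w) b)) = (M.map d) *ᵥ w + M *ᵥ (fun b => d (w b)) := by
  ext b
  exact derivation_dotProduct d (M b) w

theorem covVec_apply (a : ι) (w : ι → R) (b : ι) :
    covVec D Γ a w b = D a (w b) - ∑ d, Γ a d b * w d := rfl

theorem covVec_add (a : ι) (v w : ι → R) :
    covVec D Γ a (v + w) = covVec D Γ a v + covVec D Γ a w := by
  ext b
  simp only [covVec_apply, Pi.add_apply, map_add, mul_add, Finset.sum_add_distrib]
  ring

theorem covVec_sub (a : ι) (v w : ι → R) :
    covVec D Γ a (v - w) = covVec D Γ a v - covVec D Γ a w := by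
  ext b
  simp only [covVec_apply, Pi.sub_apply, map_sub, mul_sub, Finset.sum_sub_distrib]
  ring

theorem covVec_smul (a : ι) (r : R) (w : ι → R) :
    covVec D Γ a (r • w) = D a r • w + r • covVec D Γ a w := by
  ext b
  simp only [covVec_apply, Pi.add_apply, Pi.smul_apply, smul_eq_mul, Derivation.leibniz, mul_sub,
    Finset.mul_sum]
  rw [Finset.sum_congr rfl fun d _ => mul_left_comm (Γ a d b) r (w d)]
  ring

/-- The Ricci identity. `covVec` leaves the direction index uncorrected, so no torsion term appears.
-/
theorem covVec_comm_sub (hD : ∀ i j f, D i (D j f) = D j (D i f)) (a b : ι) (w : ι → R) :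
    covVec D Γ a (covVec D Γ b w) - covVec D Γ b (covVec D Γ a w) = -((curv D Γ a b)ᵀ *ᵥ w) := by
  have e : ∀ a b, covVec D Γ a (covVec D Γ b w) = (fun c => D a (D b (w c)))
      - ((Γ b).map (D a))ᵀ *ᵥ w - (Γ b)ᵀ *ᵥ (fun c => D a (w c))
      - (Γ a)ᵀ *ᵥ (fun c => D b (w c)) + ((Γ a)ᵀ * (Γ b)ᵀ) *ᵥ w := by
    intro a b
    have h1 := derivation_mulVec (D a) (Γ b)ᵀ w
    have h2 : (fun c => D a (covVec D Γ b w c))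
        = (fun c => D a (D b (w c))) - fun c => D a (((Γ b)ᵀ *ᵥ w) c) := by
      ext c; simp [covVec]
    conv_lhs => rw [covVec, h2, h1]
    rw [covVec, Matrix.mulVec_sub, Matrix.mulVec_mulVec, Matrix.transpose_map]
    abel
  rw [e, e]
  have e3 : (fun c => D a (D b (w c))) = fun c => D b (D a (w c)) := by
    ext c; exact hD _ _ _
  rw [e3]
  simp only [curv, transpose_add, transpose_sub, transpose_mul, Matrix.add_mulVec,
    Matrix.sub_mulVec]
  abel

namespace IsLeviCivita

theorem derivation_inner (h : IsLeviCivita D G Γ) (hG : G * Gi = 1) (a : ι) (v w : ι → R) :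
    D a (v ⬝ᵥ Gi *ᵥ w) = covVec D Γ a v ⬝ᵥ Gi *ᵥ w + v ⬝ᵥ Gi *ᵥ covVec D Γ a w := by
  rw [derivation_dotProduct, derivation_mulVec, h.compat_inv hG, covVec, covVec, sub_dotProduct,
    Matrix.mulVec_sub, dotProduct_sub, Matrix.sub_mulVec, Matrix.neg_mulVec,
    ← Matrix.mulVec_mulVec, ← Matrix.mulVec_mulVec, dotProduct_add, dotProduct_sub, dotProduct_neg,
    Matrix.mulVec_transpose (Γ a) v, ← Matrix.dotProduct_mulVec v]
  ring

theorem inner_comm (h : IsLeviCivita D G Γ) (hG : G * Gi = 1) (v w : ι → R) :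
    v ⬝ᵥ Gi *ᵥ w = w ⬝ᵥ Gi *ᵥ v := by
  rw [Matrix.dotProduct_mulVec, dotProduct_comm, ← Matrix.mulVec_transpose,
    inv_transpose h.symm hG]

theorem inner_row (hG : G * Gi = 1) (v : ι → R) (a : ι) :
    G a ⬝ᵥ Gi *ᵥ v = v a := by
  have : (G *ᵥ (Gi *ᵥ v)) a = v a := by rw [Matrix.mulVec_mulVec, hG, Matrix.one_mulVec]
  exact this

theorem covVec_row (h : IsLeviCivita D G Γ) (a b : ι) :
    covVec D Γ a (G b) = fun c => ∑ d, Γ a d b * G d c := by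
  ext c
  have := congrFun (congrFun (h.compat a) b) c
  simp only [Matrix.map_apply, Matrix.add_apply, Matrix.mul_apply, Matrix.transpose_apply] at this
  rw [covVec_apply, this, Finset.sum_congr rfl fun d _ => mul_comm (G b d) (Γ a d c)]
  ring

/-- The row G b is the coordinate field ∂_b with its index lowered, and coordinate fields commute.
-/
theorem covVec_row_comm (h : IsLeviCivita D G Γ) (a b : ι) :
    covVec D Γ a (G b) = covVec D Γ b (G a) := by
  rw [h.covVec_row, h.covVec_row]
  ext c
  exact Finset.sum_congr rfl fun d _ => by rw [h.torsion]

theorem cov_add (a : ι) (X Y : Matrix ι ι R) :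
    cov D Γ a (X + Y) = cov D Γ a X + cov D Γ a Y := by
  rw [cov, cov, cov, map_add_derivation]; noncomm_ring

theorem cov_smul (a : ι) (r : R) (X : Matrix ι ι R) :
    cov D Γ a (r • X) = D a r • X + r • cov D Γ a X := by
  have : (r • X).map (D a) = D a r • X + r • X.map (D a) := by
    ext i j
    simp only [Matrix.map_apply, Matrix.smul_apply, Matrix.add_apply, Derivation.leibniz,
      smul_eq_mul]
    ring
  rw [cov, cov, this, Matrix.mul_smul, Matrix.smul_mul, smul_sub, smul_sub]
  abel

theorem cov_metric (h : IsLeviCivita D G Γ) (a : ι) : cov D Γ a G = 0 := by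
  rw [cov, h.compat]; noncomm_ring

theorem cov_vecMulVec (a : ι) (n : ι → R) :
    cov D Γ a (vecMulVec n n) = vecMulVec (covVec D Γ a n) n + vecMulVec n (covVec D Γ a n) := by
  ext b c
  simp only [cov, Matrix.sub_apply, Matrix.add_apply, Matrix.map_apply, vecMulVec_apply,
    covVec_apply, Derivation.leibniz, smul_eq_mul, Matrix.mul_apply, Matrix.transpose_apply,
    sub_mul, mul_sub, Finset.sum_mul, Finset.mul_sum]
  have e1 : ∑ x, n b * n x * Γ a x c = ∑ x, n b * (Γ a x c * n x) :=
    Finset.sum_congr rfl fun _ _ => by ring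
  have e2 : ∑ x, Γ a x b * (n x * n c) = ∑ x, Γ a x b * n x * n c :=
    Finset.sum_congr rfl fun _ _ => by ring
  rw [e1, e2]
  ring

theorem cov_smul_add_vecMulVec (h : IsLeviCivita D G Γ) (ρ μ : R) (n : ι → R) (a b : ι) :
    cov D Γ a (ρ • G + μ • vecMulVec n n) b = D a ρ • G b + (D a μ * n b) • n
      + (μ * covVec D Γ a n b) • n + (μ * n b) • covVec D Γ a n := by
  rw [cov_add, cov_smul, cov_smul, h.cov_metric, cov_vecMulVec]
  ext c
  simp [vecMulVec_apply]
  ring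

end IsLeviCivita

/-- `n` is a unit covector whose orthogonal distribution is totally umbilic with mean curvature
`H`, and `dn = 0`, `n` is geodesic. -/
structure IsUmbilic (D : ι → Derivation ℝ R R) (G Gi : Matrix ι ι R) (Γ : ι → Matrix ι ι R)
    (n : ι → R) (H : R) : Prop where
  unit : n ⬝ᵥ Gi *ᵥ n = 1
  cov : ∀ a, covVec D Γ a n = H • (G a - n a • n)

/-- The converse of `codazzi_isUmbilic`. -/
theorem cov_ric_comm_of_umbilic (h : IsLeviCivita D G Γ) {n : ι → R} {ρ μ ρ' H : R}
    (hcov : ∀ a, covVec D Γ a n = H • (G a - n a • n))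
    (hric : ric D Γ = ρ • G + μ • vecMulVec n n) (hρ : ∀ a, D a ρ = ρ' * n a)
    (hR : ∀ a, D a μ = -4 * D a ρ) (hH : ρ' = μ * H) (a b c : ι) :
    Yang.cov D Γ a (ric D Γ) b c = Yang.cov D Γ b (ric D Γ) a c := by
  rw [hric, h.cov_smul_add_vecMulVec, h.cov_smul_add_vecMulVec, hcov, hcov]
  simp only [Pi.add_apply, Pi.sub_apply, Pi.smul_apply, smul_eq_mul, hR, hρ, hH, h.apply_comm b a]
  ring

/-- A Codazzi tensor `ρ g + μ n ⊗ n` of constant trace which is the Ricci tensor of a metric has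
an umbilic and geodesic eigenvector `n`. -/
theorem codazzi_isUmbilic (h : IsLeviCivita D G Γ) (hG : G * Gi = 1) (hcard : Fintype.card ι = 4)
    {n : ι → R} {ρ μ μi : R} (hn : n ⬝ᵥ Gi *ᵥ n = 1) (hμ : μ * μi = 1)
    (hric : ric D Γ = ρ • G + μ • vecMulVec n n)
    (hY : ∀ a b c, Yang.cov D Γ a (ric D Γ) b c = Yang.cov D Γ b (ric D Γ) a c)
    (hR : ∀ a, D a μ = -4 * D a ρ) :
    ∃ τ, (∀ a, D a ρ = τ * n a) ∧ IsUmbilic D G Gi Γ n (τ * μi) := by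
  have hGi : Gi * G = 1 := mul_eq_one_comm.mp hG
  have hrow := fun (v : ι → R) a => IsLeviCivita.inner_row (G := G) hG v a
  set N : ι → ι → R := fun a => covVec D Γ a n with hN
  set ν := Gi *ᵥ n with hν
  have hrowν : ∀ a, G a ⬝ᵥ ν = n a := hrow n
  have hNν : ∀ a, N a ⬝ᵥ ν = 0 := fun a => by
    have e := h.derivation_inner hG a n n
    rw [hn, Derivation.map_one_eq_zero, h.inner_comm hG n] at e
    rw [← half_smul_add_self (N a ⬝ᵥ ν)]
    exact (congrArg _ e.symm).trans (smul_zero _)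
  have hcov : ∀ a b, Yang.cov D Γ a (ric D Γ) b
      = D a ρ • G b + (D a μ * n b) • n + (μ * N a b) • n + (μ * n b) • N a := by
    intro a b
    rw [hric, h.cov_smul_add_vecMulVec]
  have main : ∀ a b, D a ρ • G b + (D a μ * n b) • n + (μ * N a b) • n + (μ * n b) • N a
      = D b ρ • G a + (D b μ * n a) • n + (μ * N b a) • n + (μ * n a) • N b := fun a b => by
    rw [← hcov, ← hcov]
    exact funext (hY a b)
  set τ := ∑ b, ν b * D b ρ with hτ
  set B : ι → R := fun a => ∑ b, ν b * N b a with hB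
  have hnν : ∑ b, ν b * n b = 1 := by
    rw [← hn, dotProduct_comm]; rfl
  have hGν : ∀ c, ∑ b, ν b * G b c = n c := fun c => by
    rw [← hrow n c, dotProduct_comm]
    exact Finset.sum_congr rfl fun b _ => by rw [h.apply_comm b c]
  have hNν' : ∀ a, ∑ b, ν b * N a b = 0 := fun a => by
    rw [← hNν a, dotProduct_comm]; rfl
  -- Contract the last index with ν. As n has constant length, N a is orthogonal to ν, and dμ = -4
  -- dρ produces the coefficient -3.
  have eq1 : ∀ a b, -3 * D a ρ * n b + μ * N a b = -3 * D b ρ * n a + μ * N b a := by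
    intro a b
    have e := congrArg (fun v => v ⬝ᵥ ν) (main a b)
    simp only [add_dotProduct, smul_dotProduct, hNν, hrowν, hn, smul_eq_mul, hR] at e
    linear_combination e
  -- Contract the index b with ν as well; B is the acceleration ∇_ν n.
  have eqB : ∀ a, -3 * D a ρ = -3 * τ * n a + μ * B a := by
    intro a
    have e := Finset.sum_congr rfl fun b (_ : b ∈ Finset.univ) => congrArg (ν b * ·) (eq1 a b)
    have l : ∑ b, ν b * (-3 * D a ρ * n b + μ * N a b) = -3 * D a ρ := by
      calc _ = -3 * D a ρ * ∑ b, ν b * n b + μ * ∑ b, ν b * N a b := by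
            rw [Finset.mul_sum, Finset.mul_sum, ← Finset.sum_add_distrib]
            exact Finset.sum_congr rfl fun b _ => by ring
        _ = _ := by rw [hnν, hNν']; ring
    have r : ∑ b, ν b * (-3 * D b ρ * n a + μ * N b a) = -3 * τ * n a + μ * B a := by
      rw [hτ, hB, Finset.mul_sum, Finset.sum_mul, Finset.mul_sum, ← Finset.sum_add_distrib]
      exact Finset.sum_congr rfl fun b _ => by ring
    rw [← l, ← r]
    exact e
  -- Contract only the index b of the Codazzi equation with ν. Apart from the acceleration, ∇n is
  -- already pure trace.
  have eqA : ∀ a c, μ * N a c = τ * (G a c - n a * n c) + μ * n a * B c := by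
    intro a c
    have e := Finset.sum_congr rfl fun b (_ : b ∈ Finset.univ) =>
      congrArg (ν b * ·) (congrFun (main a b) c)
    simp only [Pi.add_apply, Pi.smul_apply, smul_eq_mul, hR] at e
    have l : ∑ b, ν b * (D a ρ * G b c + -4 * D a ρ * n b * n c + μ * N a b * n c
        + μ * n b * N a c) = -3 * D a ρ * n c + μ * N a c := by
      calc _ = D a ρ * ∑ b, ν b * G b c + -4 * D a ρ * n c * ∑ b, ν b * n b
            + μ * n c * ∑ b, ν b * N a b + μ * N a c * ∑ b, ν b * n b := by
            simp only [Finset.mul_sum, ← Finset.sum_add_distrib]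
            exact Finset.sum_congr rfl fun b _ => by ring
        _ = _ := by rw [hnν, hNν', hGν]; ring
    have r : ∑ b, ν b * (D b ρ * G a c + -4 * D b ρ * n a * n c + μ * N b a * n c
        + μ * n a * N b c) = τ * G a c - 4 * τ * n a * n c + μ * B a * n c + μ * n a * B c := by
      calc _ = (∑ b, ν b * D b ρ) * G a c - 4 * (∑ b, ν b * D b ρ) * n a * n c
            + μ * (∑ b, ν b * N b a) * n c + μ * n a * (∑ b, ν b * N b c) := by
            simp only [Finset.mul_sum, Finset.sum_mul, ← Finset.sum_add_distrib,
              ← Finset.sum_sub_distrib]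
            exact Finset.sum_congr rfl fun b _ => by ring
        _ = _ := rfl
    rw [l, r] at e
    linear_combination e - n c * eqB a
  have hBν : ∑ b, B b * ν b = 0 := by
    calc _ = ∑ b, ν b * ∑ c, ν c * N b c := by
          simp only [hB, Finset.sum_mul, Finset.mul_sum]
          rw [Finset.sum_comm]
          exact Finset.sum_congr rfl fun b _ => Finset.sum_congr rfl fun c _ => by ring
      _ = 0 := by simp [hNν']
  -- The full trace over b and c, after eliminating ∇n with `eqA`, is where dimension four enters.
  -- It is a second relation between dρ, τ n and μ B, independent of `eqB`.
  have tr : ∀ a, -D a ρ + τ * n a - μ * B a = 0 := by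
    intro a
    have hδ : ∀ b c, Gi b ⬝ᵥ G c = (1 : Matrix ι ι R) b c := fun b c => by
      rw [← hGi]
      exact Finset.sum_congr rfl fun d _ => by rw [h.apply_comm c d]
    have hν' : ∀ b, Gi b ⬝ᵥ n = ν b := fun b => rfl
    have red : ∀ b, D a ρ • G b + (-4 * D a ρ * n b + 4 * D b ρ * n a) • n
        + (μ * (n a * B b - n b * B a)) • n + (τ * n b) • G a
        = D b ρ • G a + (τ * n a) • G b := by
      intro b
      ext c
      have e := congrFun (main a b) c
      simp only [Pi.add_apply, Pi.smul_apply, smul_eq_mul, hR] at e ⊢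
      have e1 := eqA a b
      have e2 := eqA b a
      have e3 := eqA a c
      have e4 := eqA b c
      rw [h.apply_comm b a] at e2
      linear_combination e - n c * e1 + n c * e2 - n b * e3 + n a * e4
    have e := Finset.sum_congr rfl fun b (_ : b ∈ Finset.univ) =>
      congrArg (fun v => Gi b ⬝ᵥ v) (red b)
    simp only [dotProduct_add, dotProduct_smul, hδ, hν', smul_eq_mul, Matrix.one_apply_eq] at e
    have l : ∑ b, (D a ρ * 1 + (-4 * D a ρ * n b + 4 * D b ρ * n a) * ν b
        + μ * (n a * B b - n b * B a) * ν b + τ * n b * (1 : Matrix ι ι R) b a)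
        = 4 * D a ρ - 4 * D a ρ + 4 * τ * n a - μ * B a + τ * n a := by
      calc _ = (∑ b : ι, D a ρ) - 4 * D a ρ * ∑ b, ν b * n b + 4 * n a * ∑ b, ν b * D b ρ
            + μ * n a * (∑ b, B b * ν b) - μ * B a * (∑ b, ν b * n b)
            + ∑ b, τ * n b * (1 : Matrix ι ι R) b a := by
            simp only [Finset.mul_sum, ← Finset.sum_add_distrib, ← Finset.sum_sub_distrib]
            exact Finset.sum_congr rfl fun b _ => by ring
        _ = _ := by
            rw [hnν, hBν, ← hτ]
            simp [Matrix.one_apply, hcard]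
            ring
    have r : ∑ b, (D b ρ * (1 : Matrix ι ι R) b a + τ * n a * 1) = D a ρ + 4 * τ * n a := by
      rw [Finset.sum_add_distrib]
      simp [Matrix.one_apply, hcard]
      ring
    rw [l, r] at e
    linear_combination e
  -- The two relations are combined to eliminate B. Returning to `eqB` then gives μ B = 0, hence B =
  -- 0 because μ is invertible.
  have fin : ∀ a, D a ρ = τ * n a := by
    intro a
    rw [← half_smul_add_self (D a ρ), ← half_smul_add_self (τ * n a)]
    congr 1
    linear_combination tr a - eqB a
  refine ⟨τ, fin, hn, fun a => ?_⟩
  have hB0 : μ * B a = 0 := by linear_combination -eqB a - 3 * fin a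
  have hB1 : ∀ c, μ * B c = 0 := fun c => by linear_combination -eqB c - 3 * fin c
  ext c
  simp only [Pi.smul_apply, Pi.sub_apply, smul_eq_mul]
  calc N a c = (μ * N a c) * μi := by linear_combination -(N a c) * hμ
    _ = _ := by
      rw [eqA a c]
      linear_combination n a * μi * hB1 c

namespace IsUmbilic

variable {n : ι → R} {H : R}

/-- The right-hand side H (g - n⊗n) is symmetric, so a torsion-free connection makes n closed; this
is what provides the coordinate z. -/
theorem derivation_apply_comm (hU : IsUmbilic D G Gi Γ n H) (h : IsLeviCivita D G Γ) (a b : ι) :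
    D a (n b) = D b (n a) := by
  have e1 := congrFun (hU.cov a) b
  have e2 := congrFun (hU.cov b) a
  simp only [covVec_apply, Pi.smul_apply, Pi.sub_apply, smul_eq_mul] at e1 e2
  have e3 : ∑ d, Γ a d b * n d = ∑ d, Γ b d a * n d :=
    Finset.sum_congr rfl fun d _ => by rw [h.torsion]
  rw [h.apply_comm b a] at e2
  linear_combination e1 - e2 + e3

/-- Since n is closed, 0 = d(τ n) = dτ ∧ n; contracting with the unit normal makes dτ a multiple of
n. This stands in for the statement that τ is a function of z. -/
theorem exists_derivation_eq (hU : IsUmbilic D G Gi Γ n H) (h : IsLeviCivita D G Γ)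
    {ρ τ : R} (hρ : ∀ a, D a ρ = τ * n a) : ∃ τ', ∀ a, D a τ = τ' * n a := by
  refine ⟨∑ b, (Gi *ᵥ n) b * D b τ, fun a => ?_⟩
  have e : ∀ b, D a τ * n b = D b τ * n a := fun b => by
    have := h.comm a b ρ
    simp only [hρ, Derivation.leibniz, smul_eq_mul, hU.derivation_apply_comm h a b] at this
    linear_combination this
  have hn : ∑ b, (Gi *ᵥ n) b * n b = 1 := by
    rw [← hU.unit, dotProduct_comm]; rfl
  calc D a τ = D a τ * ∑ b, (Gi *ᵥ n) b * n b := by rw [hn, mul_one]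
    _ = ∑ b, (Gi *ᵥ n) b * (D a τ * n b) := by
        rw [Finset.mul_sum]
        exact Finset.sum_congr rfl fun b _ => by ring
    _ = _ := by
        rw [Finset.sum_mul]
        exact Finset.sum_congr rfl fun b _ => by rw [e]; ring

/-- The Ricci identity applied to n determines all curvature components with a normal index: planes
containing the normal have sectional curvature -(H' + H²). -/
theorem curv_transpose_mulVec (hU : IsUmbilic D G Gi Γ n H) (h : IsLeviCivita D G Γ) {H' : R}
    (hH : ∀ a, D a H = H' * n a) (a b : ι) :
    (curv D Γ a b)ᵀ *ᵥ n = -(H' + H * H) • (n a • G b - n b • G a) := by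
  have e := covVec_comm_sub (Γ := Γ) h.comm a b n
  rw [hU.cov, hU.cov] at e
  simp only [covVec_smul, covVec_sub, hU.cov, hH, h.covVec_row_comm a b,
    hU.derivation_apply_comm h a b] at e
  rw [← neg_eq_iff_eq_neg.mpr e]
  module

theorem ric_normal (hU : IsUmbilic D G Gi Γ n H) (h : IsLeviCivita D G Γ) (hG : G * Gi = 1)
    (hcard : Fintype.card ι = 4) {H' : R} (hH : ∀ a, D a H = H' * n a) (a : ι) :
    ∑ d, n d * (Gi * ric D Γ) d a = -3 * (H' + H * H) * n a := by
  have hGi : Gi * G = 1 := mul_eq_one_comm.mp hG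
  have hδ : ∀ b c, Gi b ⬝ᵥ G c = (1 : Matrix ι ι R) b c := fun b c => by
    rw [← hGi]
    exact Finset.sum_congr rfl fun d _ => by rw [h.apply_comm c d]
  have hν' : ∀ b, Gi b ⬝ᵥ n = (Gi *ᵥ n) b := fun b => rfl
  have hn : ∑ b, (Gi *ᵥ n) b * n b = 1 := by
    rw [← hU.unit, dotProduct_comm]; rfl
  have hGi' : ∀ b c, Gi b c = Gi c b := fun b c => by
    conv_lhs => rw [← inv_transpose h.symm hG]
    rfl
  calc _ = ∑ b, Gi b ⬝ᵥ ((curv D Γ a b)ᵀ *ᵥ n) := by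
        simp only [← h.sum_curv_mul_inv hG, Finset.mul_sum, dotProduct, Matrix.mulVec,
          Matrix.mul_apply, Matrix.transpose_apply]
        rw [Finset.sum_comm]
        refine Finset.sum_congr rfl fun b _ => ?_
        rw [Finset.sum_comm]
        refine Finset.sum_congr rfl fun c _ => Finset.sum_congr rfl fun d _ => ?_
        rw [hGi' c b]; ring
    _ = ∑ b, (-(H' + H * H) * n a + (H' + H * H) * n b * (1 : Matrix ι ι R) b a) := by
        refine Finset.sum_congr rfl fun b _ => ?_
        rw [hU.curv_transpose_mulVec h hH, dotProduct_smul, dotProduct_sub, dotProduct_smul,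
          dotProduct_smul, hδ, hδ, Matrix.one_apply_eq]
        simp only [smul_eq_mul]; ring
    _ = _ := by
        rw [Finset.sum_add_distrib]
        simp [Matrix.one_apply, hcard]
        ring

/-- The Ricci curvature of the normal is computed twice: as the sum of three equal sectional
curvatures and as the simple eigenvalue. -/
theorem three_mul_eq (hU : IsUmbilic D G Gi Γ n H) (h : IsLeviCivita D G Γ) (hG : G * Gi = 1)
    (hcard : Fintype.card ι = 4) {ρ μ H' : R} (hric : ric D Γ = ρ • G + μ • vecMulVec n n)
    (hH : ∀ a, D a H = H' * n a) : -3 * (H' + H * H) = ρ + μ := by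
  have hGi : Gi * G = 1 := mul_eq_one_comm.mp hG
  have hn : ∑ b, (Gi *ᵥ n) b * n b = 1 := by
    rw [← hU.unit, dotProduct_comm]; rfl
  have e : ∀ a, (ρ + μ) * n a = -3 * (H' + H * H) * n a := fun a => by
    rw [← hU.ric_normal h hG hcard hH, hric, Matrix.mul_add, Matrix.mul_smul, Matrix.mul_smul, hGi,
      Matrix.mul_vecMulVec]
    simp only [Matrix.add_apply, Matrix.smul_apply, vecMulVec_apply, smul_eq_mul, mul_add,
      Finset.sum_add_distrib]
    have e1 : ∑ d, n d * (ρ * (1 : Matrix ι ι R) d a) = ρ * n a := by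
      simp [Matrix.one_apply]; ring
    have e2 : ∑ d, n d * (μ * ((Gi *ᵥ n) d * n a)) = μ * n a := by
      calc _ = (∑ d, (Gi *ᵥ n) d * n d) * (μ * n a) := by
            rw [Finset.sum_mul]
            exact Finset.sum_congr rfl fun _ _ => by ring
        _ = _ := by rw [hn, one_mul]
    rw [e1, e2]; ring
  have := Finset.sum_congr rfl fun b (_ : b ∈ Finset.univ) => congrArg ((Gi *ᵥ n) b * ·) (e b)
  simp only [mul_left_comm _ (ρ + μ), mul_left_comm _ (-3 * (H' + H * H)), ← Finset.mul_sum,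
    hn, mul_one] at this
  exact this.symm

end IsUmbilic

end DifferentialRing


/-! ### The flat connection whose parallel sections linearize the leaves. -/

section DifferentialRing

open Matrix Finset

variable {ι : Type*} [Fintype ι] [DecidableEq ι] {R : Type*} [CommRing R] [Algebra ℝ R]

/-- The matrix of the linear connection whose parallel sections `(f, w)` with `n ⬝ w = 0` satisfy
`df = w` and, for the metric induced on the leaves orthogonal to `n` rescaled to constant
curvature, `Hess f = - k f`. -/
def prolong (G Gi : Matrix ι ι R) (Γ : ι → Matrix ι ι R) (n : ι → R) (H ψ : R) (a : ι) :
    Matrix (Option ι) (Option ι) R :=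
  Matrix.of fun x y => match x, y with
    | none, none => 0
    | none, some d => (1 : Matrix ι ι R) a d - n a * (Gi *ᵥ n) d
    | some b, none => -ψ * (G a b - n a * n b)
    | some b, some d => Γ a d b - H * (n a * (1 : Matrix ι ι R) b d + (1 : Matrix ι ι R) a d * n b
        - (Gi *ᵥ n) d * (n a * n b) - (Gi *ᵥ n) d * G a b)

/-- The section `(f, w)` of the trivial bundle acted on by `prolong`. -/
def optionElim (f : R) (w : ι → R) : Option ι → R := fun x => x.elim f w

variable {D : ι → Derivation ℝ R R} {G Gi : Matrix ι ι R} {Γ : ι → Matrix ι ι R} {n : ι → R}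
  {H ψ : R}

theorem prolong_mulVec_none (a : ι) (f : R) (w : ι → R) :
    (prolong G Gi Γ n H ψ a *ᵥ optionElim f w) none = w a - (w ⬝ᵥ Gi *ᵥ n) * n a := by
  simp only [Matrix.mulVec, dotProduct, Fintype.sum_option, prolong, Matrix.of_apply, optionElim,
    Option.elim, sub_mul, Finset.sum_sub_distrib, Finset.sum_mul, zero_mul, zero_add]
  congr 1
  · simp [Matrix.one_apply]
  · exact Finset.sum_congr rfl fun d _ => by ring

theorem prolong_mulVec_some (a b : ι) (f : R) (w : ι → R) :
    (prolong G Gi Γ n H ψ a *ᵥ optionElim f w) (some b) = ∑ d, Γ a d b * w d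
      - H * (n a * w b + w a * n b - (w ⬝ᵥ Gi *ᵥ n) * (n a * n b + G a b))
      - ψ * f * (G a b - n a * n b) := by
  have e : (prolong G Gi Γ n H ψ a *ᵥ optionElim f w) (some b)
      = -ψ * (G a b - n a * n b) * f + ∑ d, (Γ a d b - H * (n a * (1 : Matrix ι ι R) b d
        + (1 : Matrix ι ι R) a d * n b
        - (Gi *ᵥ n) d * (n a * n b) - (Gi *ᵥ n) d * G a b)) * w d := by
    simp only [Matrix.mulVec, dotProduct, Fintype.sum_option, prolong, Matrix.of_apply, optionElim,
      Option.elim]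
  have e1 : ∑ d, (1 : Matrix ι ι R) b d * w d = w b := by simp [Matrix.one_apply]
  have e2 : ∑ d, (1 : Matrix ι ι R) a d * w d = w a := by simp [Matrix.one_apply]
  have e3 : w ⬝ᵥ Gi *ᵥ n = ∑ d, (Gi *ᵥ n) d * w d := by rw [dotProduct_comm]; rfl
  have e4 : ∑ d, (Γ a d b - H * (n a * (1 : Matrix ι ι R) b d + (1 : Matrix ι ι R) a d * n b
        - (Gi *ᵥ n) d * (n a * n b) - (Gi *ᵥ n) d * G a b)) * w d
      = ∑ d, Γ a d b * w d - H * n a * ∑ d, (1 : Matrix ι ι R) b d * w d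
        - H * n b * ∑ d, (1 : Matrix ι ι R) a d * w d
        + H * (n a * n b + G a b) * ∑ d, (Gi *ᵥ n) d * w d := by
    simp only [Finset.mul_sum, ← Finset.sum_add_distrib, ← Finset.sum_sub_distrib]
    exact Finset.sum_congr rfl fun d _ => by ring
  rw [e, e4, e1, e2, ← e3]
  ring

/-- The curvature of a warped product with a one dimensional base and leaves of constant
curvature: `ψ` is the intrinsic sectional curvature of the leaves, `H` their mean curvature and
`- (H' + H²)` the sectional curvature of the planes containing the normal. -/
def IsWarpedCurvature (D : ι → Derivation ℝ R R) (G Gi : Matrix ι ι R) (Γ : ι → Matrix ι ι R)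
    (n : ι → R) (H H' ψ : R) : Prop :=
  ∀ a b w k, ((curv D Γ a b)ᵀ *ᵥ w) k = (ψ - H * H) * (w a * G b k - G a k * w b)
    + (-(H' + H * H) - (ψ - H * H)) * (n a * (w ⬝ᵥ Gi *ᵥ n) * G b k + w a * n b * n k
      - n a * n k * w b - G a k * n b * (w ⬝ᵥ Gi *ᵥ n))

namespace IsUmbilic

/-- The two components of the covariant derivative associated with `prolong`. -/
theorem prolong_symm (hU : IsUmbilic D G Gi Γ n H) (h : IsLeviCivita D G Γ) (hG : G * Gi = 1)
    {H' : R} (hH : ∀ a, D a H = H' * n a) (hψ : ∀ a, D a ψ = -2 * H * ψ * n a)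
    (hcurv : IsWarpedCurvature D G Gi Γ n H H' ψ) (f : R) (w : ι → R)
    (E : ι → R → (ι → R) → R × (ι → R))
    (hE : E = fun a f w => (D a f - w a + (w ⬝ᵥ Gi *ᵥ n) * n a,
      covVec D Γ a w + H • (n a • w + w a • n - (w ⬝ᵥ Gi *ᵥ n) • (n a • n + G a))
        + (ψ * f) • (G a - n a • n))) (a b : ι) :
    E a (E b f w).1 (E b f w).2 = E b (E a f w).1 (E a f w).2 := by
  set c := w ⬝ᵥ Gi *ᵥ n with hc
  have hGn : ∀ a, G a ⬝ᵥ Gi *ᵥ n = n a := IsLeviCivita.inner_row hG n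
  have hwG : ∀ a, w ⬝ᵥ Gi *ᵥ G a = w a := fun a => by
    rw [h.inner_comm hG, IsLeviCivita.inner_row hG]
  have hDc : ∀ a, D a c = covVec D Γ a w ⬝ᵥ Gi *ᵥ n + H * (w a - c * n a) := fun a => by
    rw [hc, h.derivation_inner hG, hU.cov, Matrix.mulVec_smul, Matrix.mulVec_sub,
      Matrix.mulVec_smul, dotProduct_smul, dotProduct_sub, dotProduct_smul, hwG]
    simp only [smul_eq_mul]; ring
  -- The correction terms are arranged so that the normal component of w is differentiated as a
  -- plain function; this removes it from the commutator computed next.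
  have hE2 : ∀ b, (E b f w).2 ⬝ᵥ Gi *ᵥ n = D b c := fun b => by
    rw [hDc, hE]
    simp only [add_dotProduct, smul_dotProduct, sub_dotProduct, hGn, hU.unit, ← hc, smul_eq_mul]
    ring
  have hDw : ∀ a b, D a (w b) = covVec D Γ a w b + ∑ d, Γ a d b * w d := fun a b => by
    rw [covVec_apply]; ring
  have hΓ : ∑ d, Γ a d b * w d = ∑ d, Γ b d a * w d :=
    Finset.sum_congr rfl fun d _ => by rw [h.torsion]
  have hDn := hU.derivation_apply_comm h a b
  have hGab := h.apply_comm a b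
  have hrow := h.covVec_row_comm a b
  ext k
  · have e : ∀ a b, (E a (E b f w).1 (E b f w).2).1 = D a (E b f w).1 - (E b f w).2 a
        + D b c * n a := fun a b => by
      rw [← hE2 b]; simp only [hE]
    rw [e, e]
    simp only [hE, map_add, map_sub, Derivation.leibniz, smul_eq_mul, Pi.add_apply, Pi.smul_apply,
      Pi.sub_apply, ← hc, hDw]
    linear_combination h.comm a b f + c * hDn - hΓ + (-H * c + ψ * f) * hGab
  · have e : ∀ a b, (E a (E b f w).1 (E b f w).2).2 = covVec D Γ a (E b f w).2
        + H • (n a • (E b f w).2 + (E b f w).2 a • n - D b c • (n a • n + G a))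
        + (ψ * (E b f w).1) • (G a - n a • n) := fun a b => by
      rw [← hE2 b]; simp only [hE]
    have e2 : ∀ a b, covVec D Γ a (E b f w).2 k = covVec D Γ a (covVec D Γ b w) k
        + (D a H * (n b * w k + w b * n k - c * (n b * n k + G b k))
          + H * (D a (n b) * w k + n b * covVec D Γ a w k + D a (w b) * n k
            + w b * covVec D Γ a n k - D a c * (n b * n k + G b k)
            - c * (D a (n b) * n k + n b * covVec D Γ a n k + covVec D Γ a (G b) k)))
        + ((D a ψ * f + ψ * D a f) * (G b k - n b * n k)
          + ψ * f * (covVec D Γ a (G b) k - D a (n b) * n k - n b * covVec D Γ a n k)) := by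
      intro a b
      simp only [hE, ← hc, covVec_add, covVec_sub, covVec_smul, Pi.add_apply, Pi.sub_apply,
        Pi.smul_apply, smul_eq_mul, Derivation.leibniz]
      ring
    have e3 := congrFun (covVec_comm_sub (Γ := Γ) h.comm a b w) k
    rw [Pi.sub_apply, Pi.neg_apply, hcurv, ← hc] at e3
    rw [e, e]
    simp only [Pi.add_apply, Pi.sub_apply, Pi.smul_apply, smul_eq_mul, e2, hU.cov, hH, hψ, hDw]
    simp only [hE, ← hc, Pi.add_apply, Pi.sub_apply, Pi.smul_apply, smul_eq_mul]
    linear_combination e3 + (H * w k - H * c * n k - ψ * f * n k) * hDn + H * n k * hΓ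
      + (ψ * f - H * c) * congrFun hrow k - H * n k * (-H * c + ψ * f) * hGab

/-- The connection `prolong` is flat. -/
theorem prolong_flat (hU : IsUmbilic D G Gi Γ n H) (h : IsLeviCivita D G Γ) (hG : G * Gi = 1)
    {H' : R} (hH : ∀ a, D a H = H' * n a) (hψ : ∀ a, D a ψ = -2 * H * ψ * n a)
    (hcurv : IsWarpedCurvature D G Gi Γ n H H' ψ) (a b : ι) :
    (prolong G Gi Γ n H ψ b).map (D a) + prolong G Gi Γ n H ψ b * prolong G Gi Γ n H ψ a
      = (prolong G Gi Γ n H ψ a).map (D b) + prolong G Gi Γ n H ψ a * prolong G Gi Γ n H ψ b := by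
  set B := prolong G Gi Γ n H ψ
  set E : ι → R → (ι → R) → R × (ι → R) := fun a f w => (D a f - w a + (w ⬝ᵥ Gi *ᵥ n) * n a,
      covVec D Γ a w + H • (n a • w + w a • n - (w ⬝ᵥ Gi *ᵥ n) • (n a • n + G a))
        + (ψ * f) • (G a - n a • n)) with hE
  have hE' : ∀ a f w, optionElim (E a f w).1 (E a f w).2
      = (fun x => D a (optionElim f w x)) - B a *ᵥ optionElim f w := by
    intro a f w
    ext (_ | b)
    · rw [Pi.sub_apply, prolong_mulVec_none]
      simp only [hE, optionElim, Option.elim]; ring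
    · rw [Pi.sub_apply, prolong_mulVec_some]
      simp only [hE, optionElim, Option.elim, Pi.add_apply, Pi.sub_apply, Pi.smul_apply,
        smul_eq_mul, covVec_apply]; ring
  -- On sections with constant components the iterated derivative reduces to a matrix, so the
  -- commutator tested on basis vectors is the curvature matrix.
  have key : ∀ a b Y, (∀ c x, D c (Y x) = 0) →
      (fun x => D a (((fun x => D b (Y x)) - B b *ᵥ Y) x)) - B a *ᵥ ((fun x => D b (Y x)) - B b *ᵥ Y)
      = (-(B b).map (D a) + B a * B b) *ᵥ Y := by
    intro a b Y hY
    have h1 : (fun x => D b (Y x)) = 0 := funext fun x => hY b x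
    have h2 : (fun x => D a (Y x)) = 0 := funext fun x => hY a x
    have h3 := derivation_mulVec (D a) (B b) Y
    rw [h2, Matrix.mulVec_zero, add_zero] at h3
    have h4 : (fun x => D a ((0 - B b *ᵥ Y) x)) = -fun x => D a ((B b *ᵥ Y) x) := by
      ext x; simp
    rw [h1, h4, h3, zero_sub, Matrix.mulVec_neg, Matrix.add_mulVec, Matrix.neg_mulVec,
      Matrix.mulVec_mulVec]
    abel
  have fl' : ∀ f w, (∀ c x, D c (optionElim f w x) = 0) →
      (-(B b).map (D a) + B a * B b) *ᵥ optionElim f w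
        = (-(B a).map (D b) + B b * B a) *ᵥ optionElim f w := by
    intro f w hc
    rw [← key a b _ hc, ← key b a _ hc, ← hE' b, ← hE' a, ← hE', ← hE']
    exact congrArg (fun p => optionElim p.1 p.2) (prolong_symm hU h hG hH hψ hcurv f w E hE a b)
  have fl : ∀ y, (-(B b).map (D a) + B a * B b) *ᵥ Pi.single y 1
      = (-(B a).map (D b) + B b * B a) *ᵥ Pi.single y 1 := by
    intro y
    have hc : ∀ c x, D c ((Pi.single y 1 : Option ι → R) x) = 0 := by
      intro c x
      by_cases hx : x = y
      · subst hx; simp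
      · simp [Pi.single_eq_of_ne hx]
    have hY : (Pi.single y 1 : Option ι → R)
        = optionElim ((Pi.single y 1 : Option ι → R) none)
          fun d => (Pi.single y 1 : Option ι → R) (some d) := by
      ext (_ | d) <;> rfl
    rw [hY] at hc ⊢
    exact fl' _ _ hc
  ext x y
  have := congrFun (fl y) x
  simp only [Matrix.mulVec_single_one, Matrix.col_apply, Matrix.add_apply, Matrix.neg_apply] at this
  simp only [Matrix.add_apply]
  linear_combination -this

/-- Parallel sections of the connection `prolong`. -/
def IsParallel (D : ι → Derivation ℝ R R) (G Gi : Matrix ι ι R) (Γ : ι → Matrix ι ι R) (n : ι → R)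
    (H ψ : R) (f : R) (w : ι → R) : Prop :=
  ∀ a x, D a (optionElim f w x) = (prolong G Gi Γ n H ψ a *ᵥ optionElim f w) x

theorem IsParallel.derivation {f : R} {w : ι → R}
    (hp : IsParallel D G Gi Γ n H ψ f w) (a : ι) :
    D a f = w a - (w ⬝ᵥ Gi *ᵥ n) * n a := by
  rw [← prolong_mulVec_none (G := G) (Γ := Γ) (H := H) (ψ := ψ) a f w]
  exact hp a none

theorem IsParallel.covVec {f : R} {w : ι → R}
    (hp : IsParallel D G Gi Γ n H ψ f w) (a : ι) :
    Yang.covVec D Γ a w = -(H • (n a • w + w a • n - (w ⬝ᵥ Gi *ᵥ n) • (n a • n + G a)))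
      - (ψ * f) • (G a - n a • n) := by
  ext b
  have := hp a (some b)
  rw [prolong_mulVec_some] at this
  rw [covVec_apply]
  simp only [optionElim, Option.elim] at this
  simp only [Pi.add_apply, Pi.sub_apply, Pi.neg_apply, Pi.smul_apply, smul_eq_mul, this]
  ring

/-- The normal component of w is a first integral: if it vanishes at one point it vanishes nearby on
a connected set, and then w is exactly df. -/
theorem derivation_inner_normal (hU : IsUmbilic D G Gi Γ n H) (h : IsLeviCivita D G Γ)
    (hG : G * Gi = 1) {f : R} {w : ι → R} (hp : IsParallel D G Gi Γ n H ψ f w) (a : ι) :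
    D a (w ⬝ᵥ Gi *ᵥ n) = 0 := by
  have hGn : ∀ a, G a ⬝ᵥ Gi *ᵥ n = n a := IsLeviCivita.inner_row hG n
  have hwG : ∀ a, w ⬝ᵥ Gi *ᵥ G a = w a := fun a => by
    rw [h.inner_comm hG, IsLeviCivita.inner_row hG]
  rw [h.derivation_inner hG, hU.cov, hp.covVec, Matrix.mulVec_smul, Matrix.mulVec_sub,
    Matrix.mulVec_smul]
  simp only [dotProduct_smul, dotProduct_sub, hwG, sub_dotProduct, neg_dotProduct, smul_dotProduct,
    add_dotProduct, hGn, hU.unit, smul_eq_mul]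
  ring

/-- First integrals: the inner product of the space of constant curvature models. -/
theorem derivation_inner_add (h : IsLeviCivita D G Γ)
    (hG : G * Gi = 1) {A : R} (hA : ∀ a, D a A = H * A * n a)
    (hψ : ∀ a, D a ψ = -2 * H * ψ * n a) {f f' : R} {w w' : ι → R}
    (hp : IsParallel D G Gi Γ n H ψ f w) (hp' : IsParallel D G Gi Γ n H ψ f' w')
    (hw : w ⬝ᵥ Gi *ᵥ n = 0) (hw' : w' ⬝ᵥ Gi *ᵥ n = 0) (a : ι) :
    D a (A * A * (w ⬝ᵥ Gi *ᵥ w') + A * A * ψ * (f * f')) = 0 := by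
  have hGn : ∀ v a, G a ⬝ᵥ Gi *ᵥ v = v a := fun v => IsLeviCivita.inner_row hG v
  have hwG : ∀ v a, v ⬝ᵥ Gi *ᵥ G a = v a := fun v a => by
    rw [h.inner_comm hG, IsLeviCivita.inner_row hG]
  have hnw' : n ⬝ᵥ Gi *ᵥ w' = 0 := by rw [h.inner_comm hG, hw']
  have e1 := h.derivation_inner hG a w w'
  rw [hp.covVec, hp'.covVec, hw, hw'] at e1
  simp only [zero_smul, sub_zero, Matrix.mulVec_smul, Matrix.mulVec_sub, Matrix.mulVec_add,
    Matrix.mulVec_neg, dotProduct_smul, dotProduct_sub, dotProduct_add, dotProduct_neg, hwG, hGn,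
    sub_dotProduct, neg_dotProduct, smul_dotProduct, add_dotProduct, hw, hnw', smul_eq_mul] at e1
  simp only [map_add, Derivation.leibniz, smul_eq_mul, e1, hA, hψ, hp.derivation, hp'.derivation,
    hw, hw']
  ring

end IsUmbilic

end DifferentialRing


/-! ### The ring of smooth functions on an open subset of the coordinate space -/

section SmoothFunctions

open TopologicalSpace Matrix Topology Filter

open Classical in
/-- Extension by zero. -/
def extendZero {U : Opens E4} (f : U → ℝ) (y : E4) : ℝ := if h : y ∈ U then f ⟨y, h⟩ else 0

theorem extendZero_apply {U : Opens E4} (f : U → ℝ) (y : U) : extendZero f y = f y := by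
  simp [extendZero]

theorem extendZero_of_mem {U : Opens E4} (f : U → ℝ) {y : E4} (hy : y ∈ U) :
    extendZero f y = f ⟨y, hy⟩ := by
  simp [extendZero, hy]

/-- The algebra of smooth functions on `U`, as a subalgebra of all functions. -/
def smoothSubalgebra (U : Opens E4) : Subalgebra ℝ (U → ℝ) where
  carrier := {f | ContDiffOn ℝ ∞ (extendZero f) U}
  mul_mem' {f g} hf hg := (hf.mul hg).congr fun y hy => by simp [extendZero_of_mem _ hy]
  add_mem' {f g} hf hg := (hf.add hg).congr fun y hy => by simp [extendZero_of_mem _ hy]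
  algebraMap_mem' r := contDiffOn_const.congr (f := fun _ => r) fun y hy => by
    simp [extendZero_of_mem _ hy]

/-- The algebra of smooth functions on `U`. -/
def SmoothFn (U : Opens E4) : Type := smoothSubalgebra U

instance (U : Opens E4) : CommRing (SmoothFn U) := inferInstanceAs (CommRing (smoothSubalgebra U))

instance (U : Opens E4) : Algebra ℝ (SmoothFn U) :=
  inferInstanceAs (Algebra ℝ (smoothSubalgebra U))

namespace SmoothFn

variable {U V : Opens E4}

/-- The smooth function on `U` given by a function on the whole space. -/
def mk (F : E4 → ℝ) (hF : ContDiffOn ℝ ∞ F U) : SmoothFn U :=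
  ⟨fun y => F y, hF.congr fun _ hy => extendZero_of_mem _ hy⟩

/-- Evaluation at a point. -/
def eval (y : U) : SmoothFn U →ₐ[ℝ] ℝ := 
  (Pi.evalAlgHom ℝ (fun _ : U => ℝ) y).comp (smoothSubalgebra U).val

/-- The underlying function, extended by zero. -/
def toFun (f : SmoothFn U) : E4 → ℝ := extendZero f.1

theorem toFun_apply (f : SmoothFn U) (y : U) : f.toFun y = eval y f := extendZero_apply _ y

theorem toFun_of_mem (f : SmoothFn U) {y : E4} (hy : y ∈ U) : f.toFun y = eval ⟨y, hy⟩ f :=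
  extendZero_of_mem _ hy

theorem contDiffOn (f : SmoothFn U) : ContDiffOn ℝ ∞ f.toFun U := f.2

theorem contDiffAt (f : SmoothFn U) (y : U) : ContDiffAt ℝ ∞ f.toFun y :=
  f.contDiffOn.contDiffAt (U.isOpen.mem_nhds y.2)

theorem differentiableAt (f : SmoothFn U) (y : U) : DifferentiableAt ℝ f.toFun y :=
  (f.contDiffAt y).differentiableAt (by simp)

@[simp] theorem eval_mk (F : E4 → ℝ) (hF : ContDiffOn ℝ ∞ F U) (y : U) : eval y (mk F hF) = F y :=
  rfl

@[ext] theorem ext {f g : SmoothFn U} (h : ∀ y, eval y f = eval y g) : f = g :=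
  Subtype.ext (funext h)

theorem contDiffOn_pd {F : E4 → ℝ} (hF : ContDiffOn ℝ ∞ F U) (i : Fin 4) :
    ContDiffOn ℝ ∞ (pd i F) U :=
  (hF.fderiv_of_isOpen U.isOpen (m := ∞) (by simp)).clm_apply contDiffOn_const

theorem pd_congr {F K : E4 → ℝ} (h : ∀ y ∈ U, F y = K y) (i : Fin 4) (y : U) :
    pd i F y = pd i K y := by
  have : F =ᶠ[𝓝 (y : E4)] K := by
    filter_upwards [U.isOpen.mem_nhds y.2] with x hx using h x hx
  rw [pd, pd, this.fderiv_eq]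

/-- The partial derivative as a derivation. -/
def partialD (i : Fin 4) : Derivation ℝ (SmoothFn U) (SmoothFn U) where
  toFun f := mk (pd i f.toFun) (contDiffOn_pd f.contDiffOn i)
  map_add' f g := by
    ext y
    rw [map_add, eval_mk, eval_mk, eval_mk,
      pd_congr (K := fun x => f.toFun x + g.toFun x) fun x hx => by
        simp [toFun_of_mem _ hx]]
    simp only [pd, fderiv_fun_add (f.differentiableAt y) (g.differentiableAt y)]
    simp
  map_smul' r f := by
    ext y
    rw [map_smul, eval_mk, eval_mk, pd_congr (K := fun x => r * f.toFun x) fun x hx => by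
        simp [toFun_of_mem _ hx]]
    simp only [pd, fderiv_const_mul (f.differentiableAt y)]
    simp
  map_one_eq_zero' := by
    ext y
    change pd i (toFun 1) y = 0
    rw [pd_congr (K := fun _ => 1) fun x hx => by simp [toFun_of_mem _ hx]]
    simp [pd]
  leibniz' f g := by
    ext y
    change pd i (toFun (f * g)) y = _
    rw [pd_congr (K := fun x => f.toFun x * g.toFun x) fun x hx => by simp [toFun_of_mem _ hx]]
    simp only [pd, fderiv_fun_mul (f.differentiableAt y) (g.differentiableAt y), smul_eq_mul,
      map_add, map_mul, toFun_apply, _root_.add_apply, _root_.smul_apply]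
    rfl

theorem eval_partialD (i : Fin 4) (f : SmoothFn U) (y : U) :
    eval y (partialD i f) = pd i f.toFun y := rfl

theorem eval_partialD_eq {f : SmoothFn U} {F : E4 → ℝ} (h : ∀ y, eval y f = F y) (i : Fin 4)
    (y : U) : eval y (partialD i f) = pd i F y :=
  pd_congr (fun x hx => (toFun_of_mem f hx).trans (h ⟨x, hx⟩)) i y

theorem partialD_mk (i : Fin 4) (F : E4 → ℝ) (hF : ContDiffOn ℝ ∞ F U) :
    partialD i (mk F hF) = mk (pd i F) (contDiffOn_pd hF i) := by
  ext y
  exact eval_partialD_eq (fun y => rfl) i y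

theorem partialD_comm (i j : Fin 4) (f : SmoothFn U) :
    partialD i (partialD j f) = partialD j (partialD i f) := by
  ext y
  have hs : IsSymmSndFDerivAt ℝ f.toFun (y : E4) :=
    (f.contDiffAt y).isSymmSndFDerivAt (by
      rw [minSmoothness_of_isRCLikeNormedField]; exact WithTop.coe_le_coe.mpr le_top)
  have hd : DifferentiableAt ℝ (fderiv ℝ f.toFun) (y : E4) :=
    ((f.contDiffAt y).fderiv_right (m := ∞) (by simp)).differentiableAt (by simp)
  have e : ∀ i j, eval y (partialD i (partialD j f))
      = fderiv ℝ (fderiv ℝ f.toFun) y (EuclideanSpace.single i 1) (EuclideanSpace.single j 1) := by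
    intro i j
    rw [eval_partialD_eq (F := pd j f.toFun) fun y => rfl]
    change fderiv ℝ (fun x => fderiv ℝ f.toFun x (EuclideanSpace.single j 1)) y _ = _
    rw [fderiv_clm_apply hd (differentiableAt_const _)]
    simp
  rw [e, e]
  exact hs _ _

/-- Pointwise reciprocals are smooth. Thus metrics, Jacobians and μ become invertible inside the
ring, as the algebraic lemmas require. -/
theorem isUnit_of_forall_ne_zero {f : SmoothFn U} (h : ∀ y, eval y f ≠ 0) : IsUnit f := by
  refine IsUnit.of_mul_eq_one (mk (fun y => (f.toFun y)⁻¹) (f.contDiffOn.inv fun y hy => ?_)) ?_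
  · rw [toFun_of_mem f hy]; exact h _
  · ext y
    rw [map_mul, eval_mk, toFun_apply, map_one, mul_inv_cancel₀ (h y)]

/-- The coordinate functions. -/
def coord (i : Fin 4) : SmoothFn U := mk (fun y => y i) (by fun_prop)

theorem partialD_coord (i j : Fin 4) :
    partialD i (coord j : SmoothFn U) = if i = j then 1 else 0 := by
  ext y
  rw [eval_partialD_eq (F := fun y => y j) fun y => rfl]
  have : fderiv ℝ (fun y : E4 => y j) y = EuclideanSpace.proj j :=
    (EuclideanSpace.proj (𝕜 := ℝ) j).fderiv
  rw [pd, this]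
  by_cases hij : i = j <;> simp [hij, eq_comm]

/-- Composition with a smooth map. -/
def pullback (φ : E4 → E4) (hφ : ContDiffOn ℝ ∞ φ U) (hm : Set.MapsTo φ U V) :
    SmoothFn V →ₐ[ℝ] SmoothFn U where
  toFun f := mk (fun y => f.toFun (φ y)) (f.contDiffOn.comp hφ hm)
  map_one' := by ext y; simp [toFun_of_mem _ (hm y.2)]
  map_mul' f g := by ext y; simp [toFun_of_mem _ (hm y.2)]
  map_zero' := by ext y; simp [toFun_of_mem _ (hm y.2)]
  map_add' f g := by ext y; simp [toFun_of_mem _ (hm y.2)]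
  commutes' r := by ext y; simp [toFun_of_mem _ (hm y.2)]

theorem eval_pullback {φ : E4 → E4} (hφ : ContDiffOn ℝ ∞ φ U) (hm : Set.MapsTo φ U V)
    (f : SmoothFn V) (y : U) : eval y (pullback φ hφ hm f) = eval ⟨φ y, hm y.2⟩ f :=
  toFun_of_mem f (hm y.2)

/-- The Jacobian matrix of a smooth map. -/
def jacobian (φ : E4 → E4) (hφ : ContDiffOn ℝ ∞ φ U) : Matrix (Fin 4) (Fin 4) (SmoothFn U) :=
  Matrix.of fun a i => partialD i (mk (fun y => φ y a) (contDiffOn_euclidean.mp hφ a))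

theorem eval_jacobian {φ : E4 → E4} (hφ : ContDiffOn ℝ ∞ φ U) (a i : Fin 4) (y : U) :
    eval y (jacobian φ hφ a i) = fderiv ℝ φ y (EuclideanSpace.single i 1) a := by
  rw [jacobian, Matrix.of_apply, eval_partialD_eq (F := fun y => φ y a) fun y => rfl, pd]
  have hd : DifferentiableAt ℝ φ y :=
    (hφ.contDiffAt (U.isOpen.mem_nhds y.2)).differentiableAt (by simp)
  have := ((EuclideanSpace.proj (𝕜 := ℝ) a).hasFDerivAt.comp (y : E4) hd.hasFDerivAt).fderiv
  exact congrArg (fun L : E4 →L[ℝ] ℝ => L (EuclideanSpace.single i 1)) this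

theorem partialD_jacobian {φ : E4 → E4} (hφ : ContDiffOn ℝ ∞ φ U) (a i j : Fin 4) :
    partialD j (jacobian φ hφ a i) = partialD i (jacobian φ hφ a j) := by
  rw [jacobian, Matrix.of_apply, partialD_comm]; rfl

theorem partialD_pullback {φ : E4 → E4} (hφ : ContDiffOn ℝ ∞ φ U) (hm : Set.MapsTo φ U V)
    (f : SmoothFn V) (i : Fin 4) :
    partialD i (pullback φ hφ hm f)
      = ∑ a, jacobian φ hφ a i * pullback φ hφ hm (partialD a f) := by
  ext y
  rw [eval_partialD_eq (F := f.toFun ∘ φ) fun y => rfl, pd]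
  have hd : DifferentiableAt ℝ φ y :=
    (hφ.contDiffAt (U.isOpen.mem_nhds y.2)).differentiableAt (by simp)
  rw [fderiv_comp (y : E4) (f.differentiableAt ⟨φ y, hm y.2⟩) hd]
  simp only [map_sum, map_mul, eval_jacobian, eval_pullback, eval_partialD, pd,
    ContinuousLinearMap.comp_apply]
  set v := fderiv ℝ φ y (EuclideanSpace.single i 1)
  conv_lhs => rw [← (EuclideanSpace.basisFun (Fin 4) ℝ).sum_repr v]
  simp

end SmoothFn

end SmoothFunctions


/-! ### Behaviour of connection, curvature and ∇Ric under changes of coordinates. -/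

section CoordinateChange

open Matrix Finset

variable {ι : Type*} [Fintype ι] [DecidableEq ι] {R R' : Type*} [CommRing R] [Algebra ℝ R]
  [CommRing R'] [Algebra ℝ R']

/-- A ring homomorphism `p` (composition with a change of coordinates), with Jacobian matrix `J`
and inverse Jacobian matrix `K`. -/
structure IsCoordChange (D : ι → Derivation ℝ R R) (D' : ι → Derivation ℝ R' R')
    (p : R' →ₐ[ℝ] R) (J K : Matrix ι ι R) : Prop where
  mul_inv : J * K = 1
  chain : ∀ i f, D i (p f) = ∑ a, J a i * p (D' a f)
  closed : ∀ a i j, D j (J a i) = D i (J a j)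

namespace IsCoordChange

variable {D : ι → Derivation ℝ R R} {D' : ι → Derivation ℝ R' R'} {p : R' →ₐ[ℝ] R}
  {J K : Matrix ι ι R} {G' : Matrix ι ι R'} {Γ' : ι → Matrix ι ι R'}

theorem map_map (hc : IsCoordChange D D' p J K) (i : ι) (X : Matrix ι ι R') :
    (X.map p).map (D i) = ∑ a, J a i • (X.map (D' a)).map p := by
  ext j k
  simp [hc.chain, Matrix.sum_apply]

/-- The connection matrix in the direction of the `i`-th new coordinate, in the old frame. -/
def pulled (p : R' →ₐ[ℝ] R) (J : Matrix ι ι R) (Γ' : ι → Matrix ι ι R') (i : ι) : Matrix ι ι R :=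
  ∑ a, J a i • (Γ' a).map p

/-- The connection in the new coordinates. -/
def transform (D : ι → Derivation ℝ R R) (p : R' →ₐ[ℝ] R) (J K : Matrix ι ι R)
    (Γ' : ι → Matrix ι ι R') (i : ι) : Matrix ι ι R :=
  K * (pulled p J Γ' i * J + J.map (D i))

theorem mul_transform (hc : IsCoordChange D D' p J K) (i : ι) :
    J * transform D p J K Γ' i = pulled p J Γ' i * J + J.map (D i) := by
  rw [transform, ← Matrix.mul_assoc, hc.mul_inv, Matrix.one_mul]

/-- The inhomogeneous term of the transformed connection is symmetric because J is a Jacobian matrix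
(`closed`), so torsion stays zero; compatibility is the product rule. -/
theorem isLeviCivita (hc : IsCoordChange D D' p J K) (hD : ∀ i j f, D i (D j f) = D j (D i f))
    (h : IsLeviCivita D' G' Γ') :
    IsLeviCivita D (Jᵀ * G'.map p * J) (transform D p J K Γ') := by
  have hp : (G'.map p)ᵀ = G'.map p := by rw [← transpose_map, h.symm]
  refine ⟨hD, ?_, fun i j k => ?_, fun i => ?_⟩
  · rw [transpose_mul, transpose_mul, transpose_transpose, hp, Matrix.mul_assoc]
  · simp only [transform]
    rw [Matrix.mul_apply, Matrix.mul_apply]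
    refine Finset.sum_congr rfl fun c _ => ?_
    congr 1
    rw [Matrix.add_apply, Matrix.add_apply, Matrix.map_apply, Matrix.map_apply, hc.closed c i j]
    congr 1
    simp only [pulled, Matrix.mul_apply, Matrix.sum_apply, Matrix.smul_apply, Matrix.map_apply,
      smul_eq_mul, Finset.sum_mul]
    rw [Finset.sum_comm]
    exact Finset.sum_congr rfl fun a _ => Finset.sum_congr rfl fun b _ => by
      rw [h.torsion]; ring
  · have e : (G'.map p).map (D i)
        = (pulled p J Γ' i)ᵀ * G'.map p + G'.map p * pulled p J Γ' i := by
      rw [hc.map_map, pulled, transpose_sum, Finset.sum_mul, Finset.mul_sum,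
        ← Finset.sum_add_distrib]
      refine Finset.sum_congr rfl fun a _ => ?_
      rw [h.compat, Matrix.map_add _ (map_add p), Matrix.map_mul, Matrix.map_mul, transpose_smul,
        smul_add, Matrix.smul_mul, Matrix.mul_smul, transpose_map]
    have e2 : (transform D p J K Γ' i)ᵀ * Jᵀ = (pulled p J Γ' i * J + J.map (D i))ᵀ := by
      rw [← transpose_mul, hc.mul_transform]
    rw [Matrix.mul_assoc _ J, hc.mul_transform, ← Matrix.mul_assoc, ← Matrix.mul_assoc, e2,
      map_mul_derivation, map_mul_derivation, e, transpose_add, transpose_mul, transpose_map]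
    noncomm_ring

/-- The derivative terms of J cancel: second derivatives commute, and closedness of J removes the
terms where a derivative hits a coefficient of the pulled-back connection. What is left is
tensorial. -/
theorem curv_transform (hc : IsCoordChange D D' p J K)
    (hD : ∀ i j f, D i (D j f) = D j (D i f)) (i j : ι) :
    curv D (transform D p J K Γ') i j
      = K * (∑ a, ∑ b, (J a i * J b j) • (curv D' Γ' a b).map p) * J := by
  have hJJ : (J.map (D j)).map (D i) = (J.map (D i)).map (D j) := by ext; simp [hD i j]
  have hKJ : ∀ X : Matrix ι ι R, J * (K * X) = X := fun X => by
    rw [← Matrix.mul_assoc, hc.mul_inv, Matrix.one_mul]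
  set Q := pulled p J Γ' with hQ
  have half : ∀ i j, (transform D p J K Γ' j).map (D i)
      + transform D p J K Γ' i * transform D p J K Γ' j
      = K * ((Q j).map (D i) * J + Q j * J.map (D i) + (J.map (D j)).map (D i)
        + Q i * Q j * J + Q i * J.map (D j)) := by
    intro i j
    simp only [transform, ← hQ]
    rw [map_mul_derivation, map_inv_derivation _ hc.mul_inv, map_add_derivation,
      map_mul_derivation]
    have e : K * (Q i * J + J.map (D i)) * (K * (Q j * J + J.map (D j)))
        = K * (Q i * (J * (K * (Q j * J + J.map (D j)))))
          + K * J.map (D i) * K * (Q j * J + J.map (D j)) := by noncomm_ring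
    rw [e, hKJ]
    noncomm_ring
  have hQD : ∀ i j, (Q j).map (D i) = ∑ b, D i (J b j) • (Γ' b).map p
      + ∑ a, ∑ b, (J a i * J b j) • ((Γ' b).map (D' a)).map p := by
    intro i j
    have e : (Q j).map (D i) = ∑ b, (J b j • (Γ' b).map p).map (D i) := by
      ext k l; simp [hQ, pulled, Matrix.sum_apply]
    have e2 : ∀ b, (J b j • (Γ' b).map p).map (D i) = D i (J b j) • (Γ' b).map p
        + ∑ a, (J a i * J b j) • ((Γ' b).map (D' a)).map p := by
      intro b
      have := hc.map_map i (Γ' b)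
      ext k l
      have e3 := congrFun (congrFun this k) l
      simp only [Matrix.map_apply, Matrix.sum_apply, Matrix.smul_apply, Matrix.add_apply,
        Derivation.leibniz, smul_eq_mul] at e3 ⊢
      rw [e3, Finset.mul_sum, add_comm, mul_comm (D i (J b j))]
      congr 1
      exact Finset.sum_congr rfl fun a _ => by ring
    rw [e, Finset.sum_congr rfl fun b _ => e2 b, Finset.sum_add_distrib]
    congr 1
    exact Finset.sum_comm
  have hQQ : ∀ i j, Q i * Q j = ∑ a, ∑ b, (J a i * J b j) • (Γ' a * Γ' b).map p := by
    intro i j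
    simp only [hQ, pulled, Finset.sum_mul, Finset.mul_sum]
    rw [Finset.sum_comm]
    refine Finset.sum_congr rfl fun a _ => Finset.sum_congr rfl fun b _ => ?_
    rw [Matrix.smul_mul, Matrix.mul_smul, smul_smul, Matrix.map_mul]
  have hS : ∑ a, ∑ b, (J a i * J b j) • (curv D' Γ' a b).map p
      = (Q j).map (D i) - (Q i).map (D j) + Q i * Q j - Q j * Q i := by
    have e1 : ∑ b, D i (J b j) • (Γ' b).map p = ∑ b, D j (J b i) • (Γ' b).map p :=
      Finset.sum_congr rfl fun b _ => by rw [hc.closed]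
    have sw : ∀ X : ι → ι → Matrix ι ι R, ∑ a, ∑ b, (J a j * J b i) • X a b
        = ∑ a, ∑ b, (J a i * J b j) • X b a := fun X => by
      rw [Finset.sum_comm]
      exact Finset.sum_congr rfl fun a _ => Finset.sum_congr rfl fun b _ => by
        rw [mul_comm]
    rw [hQD, hQD, hQQ, hQQ, e1, sw, sw]
    have e2 : ∀ a b, (curv D' Γ' a b).map p = ((Γ' b).map (D' a)).map p
        - ((Γ' a).map (D' b)).map p + (Γ' a * Γ' b).map p - (Γ' b * Γ' a).map p := by
      intro a b
      ext k l
      simp only [curv, Matrix.map_apply, Matrix.sub_apply, Matrix.add_apply, map_sub, map_add]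
    simp only [e2, smul_add, smul_sub, Finset.sum_add_distrib, Finset.sum_sub_distrib]
    abel
  have e1 := half i j
  have e2 := half j i
  rw [hS]
  calc _ = ((transform D p J K Γ' j).map (D i)
      + transform D p J K Γ' i * transform D p J K Γ' j) - ((transform D p J K Γ' i).map (D j)
      + transform D p J K Γ' j * transform D p J K Γ' i) := by rw [curv]; abel
    _ = _ := by
      rw [e1, e2, hJJ]
      noncomm_ring

theorem ric_transform (hc : IsCoordChange D D' p J K)
    (hD : ∀ i j f, D i (D j f) = D j (D i f)) :
    ric D (transform D p J K Γ') = Jᵀ * (ric D' Γ').map p * J := by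
  ext i j
  set T : ι → Matrix ι ι R := fun a => ∑ b, J b j • (curv D' Γ' a b).map p with hT
  have e1 : ∀ k, curv D (transform D p J K Γ') k j = ∑ a, J a k • (K * T a * J) := by
    intro k
    rw [hc.curv_transform hD, Finset.mul_sum, Finset.sum_mul]
    refine Finset.sum_congr rfl fun a _ => ?_
    rw [← Matrix.smul_mul, ← Matrix.mul_smul, hT, Finset.smul_sum]
    simp only [smul_smul]
  calc ric D (transform D p J K Γ') i j = ∑ k, ∑ a, J a k * (K * (T a * J)) k i := by
        simp only [ric, Matrix.of_apply, e1, Matrix.sum_apply, Matrix.smul_apply, smul_eq_mul,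
          Matrix.mul_assoc]
    _ = ∑ a, (T a * J) a i := by
        rw [Finset.sum_comm]
        refine Finset.sum_congr rfl fun a _ => ?_
        have : (J * (K * (T a * J))) a i = (T a * J) a i := by
          rw [← Matrix.mul_assoc, hc.mul_inv, Matrix.one_mul]
        exact this
    _ = ∑ a, ∑ d, ∑ b, J b j * p (curv D' Γ' a b a d) * J d i := by
        simp only [Matrix.mul_apply, hT, Matrix.sum_apply, Matrix.smul_apply, Matrix.map_apply,
          smul_eq_mul, Finset.sum_mul]
    _ = _ := by
        simp only [Matrix.mul_apply, Matrix.map_apply, Matrix.transpose_apply, ric,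
          Matrix.of_apply, map_sum, Finset.mul_sum, Finset.sum_mul]
        rw [Finset.sum_congr rfl fun a _ => Finset.sum_comm, Finset.sum_comm]
        refine Finset.sum_congr rfl fun b _ => ?_
        rw [Finset.sum_comm]
        exact Finset.sum_congr rfl fun d _ => Finset.sum_congr rfl fun a _ => by ring

theorem cov_transform (hc : IsCoordChange D D' p J K) (a : ι) (X : Matrix ι ι R') :
    cov D (transform D p J K Γ') a (Jᵀ * X.map p * J)
      = Jᵀ * (∑ e, J e a • (cov D' Γ' e X).map p) * J := by
  have e1 : ∑ e, J e a • (cov D' Γ' e X).map p = (X.map p).map (D a)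
      - (pulled p J Γ' a)ᵀ * X.map p - X.map p * pulled p J Γ' a := by
    rw [hc.map_map, pulled, transpose_sum, Finset.sum_mul, Finset.mul_sum,
        ← Finset.sum_sub_distrib, ← Finset.sum_sub_distrib]
    refine Finset.sum_congr rfl fun e _ => ?_
    rw [transpose_smul, Matrix.smul_mul, Matrix.mul_smul, ← smul_sub, ← smul_sub,
      ← transpose_map, ← Matrix.map_mul, ← Matrix.map_mul]
    congr 1
    ext k l
    simp only [cov, Matrix.map_apply, Matrix.sub_apply, map_sub]
  have e2 : (transform D p J K Γ' a)ᵀ * Jᵀ = (pulled p J Γ' a * J + J.map (D a))ᵀ := by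
    rw [← transpose_mul, hc.mul_transform]
  rw [cov, Matrix.mul_assoc _ J, hc.mul_transform, ← Matrix.mul_assoc, ← Matrix.mul_assoc, e2,
      map_mul_derivation, map_mul_derivation, e1, transpose_add, transpose_mul, transpose_map]
  noncomm_ring

end IsCoordChange

end CoordinateChange


/-! ### Metrics on open sets of ℝ⁴, and isometries between them. -/

section LocalMetrics

open TopologicalSpace Matrix Finset SmoothFn

/-- `G` is the matrix of a smooth nondegenerate symmetric form on `U`. -/
structure IsMetricOn (G : E4 → Matrix (Fin 4) (Fin 4) ℝ) (U : Opens E4) : Prop where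
  smooth : ∀ i j, ContDiffOn ℝ ∞ (fun y => G y i j) U
  symm : ∀ y ∈ U, (G y)ᵀ = G y
  det : ∀ y ∈ U, (G y).det ≠ 0

namespace IsMetricOn

variable {G G' : E4 → Matrix (Fin 4) (Fin 4) ℝ} {U V : Opens E4}

/-- The matrix of a metric, over the ring of smooth functions. -/
def mat (h : IsMetricOn G U) : Matrix (Fin 4) (Fin 4) (SmoothFn U) :=
  Matrix.of fun i j => SmoothFn.mk (fun y => G y i j) (h.smooth i j)

/-- The inverse matrix of a metric. -/
def inv (h : IsMetricOn G U) : Matrix (Fin 4) (Fin 4) (SmoothFn U) := h.mat⁻¹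

/-- The Christoffel symbols of a metric. -/
def conn (h : IsMetricOn G U) (i : Fin 4) : Matrix (Fin 4) (Fin 4) (SmoothFn U) :=
  chr partialD h.mat h.inv i

theorem map_mat (h : IsMetricOn G U) (y : U) : h.mat.map (eval y) = G y := by
  ext; rfl

theorem mul_inv (h : IsMetricOn G U) : h.mat * h.inv = 1 := by
  refine Matrix.mul_nonsing_inv _ (isUnit_of_forall_ne_zero fun y => ?_)
  rw [← AlgHom.coe_toRingHom, RingHom.map_det, RingHom.mapMatrix_apply, AlgHom.coe_toRingHom,
    h.map_mat]
  exact h.det y y.2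

theorem map_inv (h : IsMetricOn G U) (y : U) : h.inv.map (eval y) = (G y)⁻¹ := by
  refine (Matrix.inv_eq_right_inv ?_).symm
  rw [← h.map_mat y, ← Matrix.map_mul, h.mul_inv]
  exact Matrix.map_one _ (map_zero _) (map_one _)

theorem mat_transpose (h : IsMetricOn G U) : h.matᵀ = h.mat := by
  ext i j y
  exact congrFun (congrFun (h.symm y y.2) i) j

theorem isLeviCivita (h : IsMetricOn G U) : IsLeviCivita partialD h.mat h.conn :=
  isLeviCivita_chr partialD_comm h.mat_transpose h.mul_inv

theorem eval_partialD_mat (h : IsMetricOn G U) (i j l : Fin 4) (y : U) :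
    eval y (partialD i (h.mat j l)) = pd i (fun q => G q j l) y :=
  eval_partialD_eq (fun _ => rfl) i y

theorem eval_conn (h : IsMetricOn G U) (k i j : Fin 4) (y : U) :
    eval y (h.conn i k j) = christoffel G k i j y := by
  rw [conn, chr, Matrix.of_apply, map_smul, map_sum, christoffel, smul_eq_mul]
  congr 1
  refine Finset.sum_congr rfl fun l _ => ?_
  rw [map_mul, map_sub, map_add, ← h.map_inv y, h.eval_partialD_mat, h.eval_partialD_mat,
    h.eval_partialD_mat, Matrix.map_apply]

theorem eval_partialD_conn (h : IsMetricOn G U) (l k i j : Fin 4) (y : U) :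
    eval y (partialD l (h.conn i k j)) = pd l (christoffel G k i j) y :=
  eval_partialD_eq (fun y => h.eval_conn k i j y) l y

/-- The abstract contraction and the classical formula order the lower indices of Γ differently;
vanishing torsion reconciles them. -/
theorem eval_ric (h : IsMetricOn G U) (i j : Fin 4) (y : U) :
    eval y (ric partialD h.conn i j) = ricci G y i j := by
  have hs : ∀ k i j, christoffel G k i j y = christoffel G k j i y := fun k i j => by
    rw [← h.eval_conn, ← h.eval_conn, h.isLeviCivita.torsion]
  have hs' : ∀ l k i j, pd l (christoffel G k i j) y = pd l (christoffel G k j i) y :=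
    fun l k i j => by
      rw [← h.eval_partialD_conn, ← h.eval_partialD_conn, h.isLeviCivita.torsion]
  simp only [ric, curv, ricci, Matrix.of_apply, map_sum, map_sub, map_add, Matrix.sub_apply,
    Matrix.add_apply, Matrix.map_apply, Matrix.mul_apply, map_mul, h.eval_conn,
    h.eval_partialD_conn]
  rw [← Finset.sum_add_distrib]
  refine Finset.sum_congr rfl fun k _ => ?_
  rw [Finset.sum_sub_distrib, hs' k k i j, hs' j k i k]
  rw [add_sub_assoc]
  congr 2 <;> refine Finset.sum_congr rfl fun l _ => ?_
  · rw [hs l i j]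
  · rw [hs l i k]

theorem map_ric (h : IsMetricOn G U) (y : U) : (ric partialD h.conn).map (eval y) = ricci G y := by
  ext i j; exact h.eval_ric i j y

theorem map_inv_mul_ric (h : IsMetricOn G U) (y : U) :
    (h.inv * ric partialD h.conn).map (eval y) = ricciMixed G y := by
  rw [Matrix.map_mul, h.map_inv, h.map_ric, ricciMixed]

theorem eval_cov (h : IsMetricOn G U) (a b c : Fin 4) (y : U) :
    eval y (cov partialD h.conn a (ric partialD h.conn) b c) = covRicci G a b c y := by
  rw [cov, covRicci, Matrix.sub_apply, Matrix.sub_apply, map_sub, map_sub, Matrix.map_apply,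
    eval_partialD_eq (F := fun q => ricci G q b c) fun y => h.eval_ric b c y]
  simp only [Matrix.mul_apply, map_sum, map_mul, Matrix.transpose_apply, h.eval_conn, h.eval_ric]
  congr 1
  exact Finset.sum_congr rfl fun d _ => mul_comm _ _

end IsMetricOn

/-- The map `φ` carries the metric `G` on `U` to the metric `G'` on `V`. -/
structure IsIsometryOn (φ : E4 → E4) (G G' : E4 → Matrix (Fin 4) (Fin 4) ℝ)
    (U V : Opens E4) : Prop where
  smooth : ContDiffOn ℝ ∞ φ U
  mapsTo : Set.MapsTo φ U V
  pull : ∀ y (hy : y ∈ U), G y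
    = ((jacobian φ smooth).map (eval ⟨y, hy⟩))ᵀ * G' (φ y) * (jacobian φ smooth).map (eval ⟨y, hy⟩)

namespace IsIsometryOn

variable {φ : E4 → E4} {G G' : E4 → Matrix (Fin 4) (Fin 4) ℝ} {U V : Opens E4}

theorem mat_eq (i : IsIsometryOn φ G G' U V) (h : IsMetricOn G U) (h' : IsMetricOn G' V) :
    h.mat = (jacobian φ i.smooth)ᵀ * h'.mat.map (pullback φ i.smooth i.mapsTo)
      * jacobian φ i.smooth := by
  have e : ∀ y, h.mat.map (eval y) = ((jacobian φ i.smooth)ᵀ *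
      h'.mat.map (pullback φ i.smooth i.mapsTo) * jacobian φ i.smooth).map (eval y) := by
    intro y
    rw [h.map_mat, Matrix.map_mul, Matrix.map_mul, Matrix.transpose_map, i.pull y y.2]
    congr 2
    ext a b
    rw [Matrix.map_apply, Matrix.map_apply, eval_pullback]
    rfl
  ext a b y
  exact congrFun (congrFun (e y) a) b

/-- Nondegeneracy of G = Jᵀ G' J forces det J ≠ 0, so an isometry need not be assumed locally
invertible. -/
theorem exists_isCoordChange (i : IsIsometryOn φ G G' U V) (h : IsMetricOn G U) :
    ∃ K, IsCoordChange partialD partialD (pullback φ i.smooth i.mapsTo) (jacobian φ i.smooth) K := by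
  refine ⟨(jacobian φ i.smooth)⁻¹, Matrix.mul_nonsing_inv _ (isUnit_of_forall_ne_zero fun y => ?_),
    fun j f => partialD_pullback _ _ _ _, fun a j k => partialD_jacobian _ _ _ _⟩
  rw [← AlgHom.coe_toRingHom, RingHom.map_det, RingHom.mapMatrix_apply, AlgHom.coe_toRingHom]
  intro h0
  apply h.det y y.2
  rw [i.pull y y.2, Matrix.det_mul, h0, mul_zero]

theorem conn_eq (i : IsIsometryOn φ G G' U V) (h : IsMetricOn G U) (h' : IsMetricOn G' V)
    {K : Matrix (Fin 4) (Fin 4) (SmoothFn U)}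
    (hc : IsCoordChange partialD partialD (pullback φ i.smooth i.mapsTo)
      (jacobian φ i.smooth) K) :
    h.conn = IsCoordChange.transform partialD (pullback φ i.smooth i.mapsTo)
      (jacobian φ i.smooth) K h'.conn := by
  have := hc.isLeviCivita partialD_comm h'.isLeviCivita
  rw [← i.mat_eq h h'] at this
  exact (this.eq_chr h.mul_inv).symm

/-- The Codazzi equation for the Ricci tensor does not depend on the coordinates. -/
theorem covRicci_comm (i : IsIsometryOn φ G G' U V) (h : IsMetricOn G U) (h' : IsMetricOn G' V)
    {y : E4} (hy : y ∈ U)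
    (hY : ∀ a b c, covRicci G' a b c (φ y) - covRicci G' b a c (φ y) = 0) (a b c : Fin 4) :
    covRicci G a b c y - covRicci G b a c y = 0 := by
  obtain ⟨K, hc⟩ := i.exists_isCoordChange h
  set J := jacobian φ i.smooth
  set p := pullback φ i.smooth i.mapsTo
  set z : V := ⟨φ y, i.mapsTo hy⟩
  have key : ∀ a b c, covRicci G a b c y = ∑ s, ∑ e, ∑ r,
      eval ⟨y, hy⟩ (J e a) * eval ⟨y, hy⟩ (J r b) * eval ⟨y, hy⟩ (J s c) * covRicci G' e r s z := by
    intro a b c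
    rw [← h.eval_cov a b c ⟨y, hy⟩, i.conn_eq h h' hc, hc.ric_transform partialD_comm,
      hc.cov_transform]
    simp only [Matrix.mul_apply, Matrix.transpose_apply, Matrix.sum_apply, Matrix.smul_apply,
      Matrix.map_apply, smul_eq_mul, map_sum, map_mul, Finset.sum_mul, Finset.mul_sum]
    refine Finset.sum_congr rfl fun s _ => Finset.sum_congr rfl fun e _ =>
      Finset.sum_congr rfl fun r _ => ?_
    rw [← h'.eval_cov e r s z, eval_pullback]
    ring
  rw [key, key, sub_eq_zero]
  refine Finset.sum_congr rfl fun s _ => ?_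
  rw [Finset.sum_comm]
  refine Finset.sum_congr rfl fun e _ => Finset.sum_congr rfl fun r _ => ?_
  rw [sub_eq_zero.mp (hY r e s)]
  ring

/-- The Ricci endomorphisms at corresponding points are conjugate. -/
theorem ricciMixed_conj (i : IsIsometryOn φ G G' U V) (h : IsMetricOn G U)
    (h' : IsMetricOn G' V) {y : E4} (hy : y ∈ U) :
    ∃ P Q : Matrix (Fin 4) (Fin 4) ℝ, P * Q = 1 ∧ ricciMixed G y = Q * ricciMixed G' (φ y) * P := by
  obtain ⟨K, hc⟩ := i.exists_isCoordChange h
  set J := (jacobian φ i.smooth).map (eval ⟨y, hy⟩) with hJ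
  have hJK : J * K.map (eval ⟨y, hy⟩) = 1 := by
    rw [← Matrix.map_mul, hc.mul_inv]
    exact Matrix.map_one _ (map_zero _) (map_one _)
  have hp : G y = Jᵀ * G' (φ y) * J := i.pull y hy
  have hric : ricci G y = Jᵀ * ricci G' (φ y) * J := by
    rw [← h.map_ric ⟨y, hy⟩, i.conn_eq h h' hc, hc.ric_transform partialD_comm, Matrix.map_mul,
      Matrix.map_mul, Matrix.transpose_map]
    have e : ((ric partialD h'.conn).map (pullback φ i.smooth i.mapsTo)).map (eval ⟨y, hy⟩)
        = ricci G' (φ y) := by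
      rw [← h'.map_ric ⟨φ y, i.mapsTo hy⟩]
      ext a b
      rw [Matrix.map_apply, Matrix.map_apply, Matrix.map_apply, eval_pullback]
    rw [e]
  refine ⟨J, K.map (eval ⟨y, hy⟩), hJK, ?_⟩
  have hinv : (G y)⁻¹ = K.map (eval ⟨y, hy⟩) * (G' (φ y))⁻¹ * (K.map (eval ⟨y, hy⟩))ᵀ := by
    refine Matrix.inv_eq_right_inv ?_
    have hu : IsUnit (G' (φ y)).det := (h'.det _ (i.mapsTo hy)).isUnit
    have hKJ : Jᵀ * (K.map (eval ⟨y, hy⟩))ᵀ = 1 := by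
      rw [← transpose_mul, mul_eq_one_comm.mp hJK, transpose_one]
    have hJK' : ∀ X : Matrix (Fin 4) (Fin 4) ℝ, J * (K.map (eval ⟨y, hy⟩) * X) = X := fun X => by
      rw [← Matrix.mul_assoc, hJK, Matrix.one_mul]
    have hGG : ∀ X : Matrix (Fin 4) (Fin 4) ℝ, G' (φ y) * ((G' (φ y))⁻¹ * X) = X := fun X => by
      rw [← Matrix.mul_assoc, Matrix.mul_nonsing_inv _ hu, Matrix.one_mul]
    rw [hp, Matrix.mul_assoc, Matrix.mul_assoc, Matrix.mul_assoc, hJK', hGG, hKJ]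
  have hKJ : (K.map (eval ⟨y, hy⟩))ᵀ * Jᵀ = 1 := by
    rw [← transpose_mul, hJK, transpose_one]
  rw [ricciMixed, ricciMixed, hinv, hric]
  calc _ = K.map (eval ⟨y, hy⟩) * (G' (φ y))⁻¹ * ((K.map (eval ⟨y, hy⟩))ᵀ * Jᵀ)
        * ricci G' (φ y) * J := by simp only [Matrix.mul_assoc]
    _ = _ := by rw [hKJ]; simp only [Matrix.mul_assoc, Matrix.one_mul]

end IsIsometryOn

end LocalMetrics


/-! ### Component matrices of a Lorentz metric in charts. -/

section Charts

open TopologicalSpace Matrix Finset SmoothFn Topology Filter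

variable {M : Type*} [TopologicalSpace M] [ChartedSpace E4 M] [IsManifold (𝓡 4) ∞ M]

theorem mdifferentiableAt_chart_symm {e : OpenPartialHomeomorph M E4}
    (he : e ∈ IsManifold.maximalAtlas (𝓡 4) ∞ M) {y : E4} (hy : y ∈ e.target) :
    MDifferentiableAt (𝓡 4) (𝓡 4) e.symm y :=
  (contMDiffAt_symm_of_mem_maximalAtlas he hy).mdifferentiableAt (by simp)

theorem sum_smul_single (v : Fin 4 → ℝ) (b : Fin 4) :
    (∑ a, v a • EuclideanSpace.single a (1 : ℝ) : E4) b = v b := by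
  simp [Pi.single_apply]

/-- The domain of the coordinates of a chart. -/
def chartOpens (e : OpenPartialHomeomorph M E4) : Opens E4 := ⟨e.target, e.open_target⟩

/-- The coordinate vector fields of a chart. -/
def coordVec (e : OpenPartialHomeomorph M E4) (y : E4) : E4 →L[ℝ] TangentSpace (𝓡 4) (e.symm y) :=
  mfderiv (𝓡 4) (𝓡 4) e.symm y

theorem coordVec_injective {e : OpenPartialHomeomorph M E4}
    (he : e ∈ IsManifold.maximalAtlas (𝓡 4) ∞ M) {y : E4} (hy : y ∈ e.target) {v : E4}
    (hv : coordVec e y v = 0) : v = 0 := by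
  have h1 : MDifferentiableAt (𝓡 4) (𝓡 4) e (e.symm y) :=
    (contMDiffAt_of_mem_maximalAtlas he (e.map_target hy)).mdifferentiableAt (by simp)
  have h2 := mfderiv_comp y h1 (mdifferentiableAt_chart_symm he hy)
  have h3 : (e ∘ e.symm) =ᶠ[𝓝 y] id := by
    filter_upwards [e.open_target.mem_nhds hy] with x hx using e.right_inv hx
  rw [h3.mfderiv_eq, mfderiv_id] at h2
  have h4 := congrArg (fun L : E4 →L[ℝ] E4 => L v) h2
  have h5 : v = mfderiv (𝓡 4) (𝓡 4) e (e.symm y) (coordVec e y v) := h4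
  rw [h5, hv, map_zero]
  rfl

namespace LorentzMetric

/-- A pseudo-orthonormal basis gives the component matrix as Cᵀ η C, where C is injective because
the coordinate fields are independent. -/
theorem isMetricOn (g : LorentzMetric M) {e : OpenPartialHomeomorph M E4}
    (he : e ∈ IsManifold.maximalAtlas (𝓡 4) ∞ M) :
    IsMetricOn (components g.val e) (chartOpens e) := by
  refine ⟨g.smooth e he, fun y _ => ?_, fun y hy => ?_⟩
  · ext i j
    exact g.symm _ _ _
  · obtain ⟨b, hb⟩ := g.lorentz (e.symm y)
    set C : Matrix (Fin 4) (Fin 4) ℝ := Matrix.of fun a i =>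
      b.repr (coordVec e y (EuclideanSpace.single i 1)) a with hC
    have hG : components g.val e y = Cᵀ * eta * C := by
      ext i j
      have hw : ∀ i, coordVec e y (EuclideanSpace.single i 1) = ∑ a, C a i • b a := fun i =>
        (b.sum_repr _).symm
      change g.val (e.symm y) (coordVec e y (EuclideanSpace.single i 1))
        (coordVec e y (EuclideanSpace.single j 1)) = _
      rw [hw, hw]
      simp only [map_sum, map_smul, _root_.sum_apply, _root_.smul_apply, hb,
        smul_eq_mul, Matrix.mul_apply, Matrix.transpose_apply, Finset.sum_mul, Finset.mul_sum]
      exact Finset.sum_congr rfl fun a _ => Finset.sum_congr rfl fun b _ => by ring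
    rw [hG, Matrix.det_mul, Matrix.det_mul, Matrix.det_transpose]
    have h1 : eta.det ≠ 0 := by
      rw [eta, Matrix.det_diagonal]; simp [Fin.prod_univ_four]
    have h2 : C.det ≠ 0 := by
      intro h0
      obtain ⟨v, hv, hCv⟩ := Matrix.exists_mulVec_eq_zero_iff.mpr h0
      apply hv
      have h3 : coordVec e y (∑ i, v i • EuclideanSpace.single i 1) = 0 := by
        apply b.repr.injective
        ext a
        rw [map_sum, map_sum, map_zero]
        have := congrFun hCv a
        simp only [Matrix.mulVec, dotProduct, hC, Matrix.of_apply, Pi.zero_apply] at this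
        rw [Finsupp.finsetSum_apply, Finsupp.zero_apply, ← this]
        refine Finset.sum_congr rfl fun i _ => ?_
        rw [map_smul, map_smul, Finsupp.smul_apply, smul_eq_mul, mul_comm]
      have h4 := coordVec_injective he hy h3
      ext i
      have h5 := congrArg (fun w : E4 => w i) h4
      rwa [sum_smul_single] at h5
    exact mul_ne_zero (mul_ne_zero h2 h1) h2

/-- All that is required of φ is that it covers the identity of M. This form serves transition maps
and also the inverse of a newly built coordinate map. -/
theorem isIsometryOn (g : LorentzMetric M) {e e' : OpenPartialHomeomorph M E4}
    (he' : e' ∈ IsManifold.maximalAtlas (𝓡 4) ∞ M)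
    {φ : E4 → E4} {U : Opens E4} (hφ : ContDiffOn ℝ ∞ φ U)
    (hm : ∀ y ∈ U, φ y ∈ e'.target) (hs : ∀ y ∈ U, e'.symm (φ y) = e.symm y) :
    IsIsometryOn φ (components g.val e) (components g.val e') U (chartOpens e') := by
  refine ⟨hφ, fun y hy => hm y hy, fun y hy => ?_⟩
  have hd : DifferentiableAt ℝ φ y :=
    (hφ.contDiffAt (U.isOpen.mem_nhds hy)).differentiableAt (by simp)
  set J := (jacobian φ hφ).map (eval ⟨y, hy⟩) with hJ
  have h1 := mfderiv_comp y (mdifferentiableAt_chart_symm he' (hm y hy)) hd.mdifferentiableAt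
  have h3 : (e'.symm ∘ φ) =ᶠ[𝓝 y] e.symm := by
    filter_upwards [U.isOpen.mem_nhds hy] with x hx using hs x hx
  rw [h3.mfderiv_eq, mfderiv_eq_fderiv] at h1
  have h4 : ∀ i, (fderiv ℝ φ y (EuclideanSpace.single i 1) : E4)
      = ∑ a, J a i • EuclideanSpace.single a (1 : ℝ) := by
    intro i
    ext b
    rw [sum_smul_single, hJ, Matrix.map_apply, eval_jacobian]
  set u : Fin 4 → E4 := fun i => coordVec e y (EuclideanSpace.single i 1)
  set w : Fin 4 → E4 := fun i => coordVec e' (φ y) (EuclideanSpace.single i 1)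
  have h5 : ∀ i, u i = ∑ a, J a i • w a := by
    intro i
    have h6 : u i = coordVec e' (φ y) (fderiv ℝ φ y (EuclideanSpace.single i 1)) :=
      congrArg (fun L : E4 →L[ℝ] E4 => L (EuclideanSpace.single i 1)) h1
    rw [h6, h4, map_sum]
    exact Finset.sum_congr rfl fun a _ => map_smul (coordVec e' (φ y)) _ _
  -- The tangent spaces at propositionally equal points are all the type `E4`; fixing the vectors in
  -- `E4` first allows the base point to be replaced.
  have key : ∀ p q : M, p = q → ∀ u v : E4, g.val p u v = g.val q u v := by
    rintro p q rfl u v; rfl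
  have exp : ∀ L : E4 →L[ℝ] E4 →L[ℝ] ℝ, ∀ i j, L (u i) (u j)
      = ∑ a, ∑ b, J a i * J b j * L (w a) (w b) := by
    intro L i j
    rw [h5, h5]
    simp only [map_sum, map_smul, _root_.sum_apply, _root_.smul_apply, smul_eq_mul, Finset.mul_sum]
    rw [Finset.sum_comm]
    exact Finset.sum_congr rfl fun a _ => Finset.sum_congr rfl fun b _ => by ring
  ext i j
  have h7 : components g.val e y i j
      = ∑ a, ∑ b, J a i * J b j * components g.val e' (φ y) a b :=
    (key _ _ (hs y hy).symm (u i) (u j)).trans (exp (g.val (e'.symm (φ y))) i j)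
  rw [h7]
  simp only [Matrix.mul_apply, Matrix.transpose_apply, Finset.sum_mul]
  rw [Finset.sum_comm]
  exact Finset.sum_congr rfl fun a _ => Finset.sum_congr rfl fun b _ => by ring

theorem isIsometryOn_chart (g : LorentzMetric M) {e e' : OpenPartialHomeomorph M E4}
    (he : e ∈ IsManifold.maximalAtlas (𝓡 4) ∞ M) (he' : e' ∈ IsManifold.maximalAtlas (𝓡 4) ∞ M) :
    IsIsometryOn (e.symm.trans e') (components g.val e) (components g.val e')
      ⟨(e.symm.trans e').source, (e.symm.trans e').open_source⟩ (chartOpens e') := by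
  refine g.isIsometryOn he' ?_ (fun y hy => ?_) (fun y hy => ?_)
  · exact contMDiffOn_iff_contDiffOn.mp (contMDiffOn_of_mem_contDiffGroupoid
      (IsManifold.compatible_of_mem_maximalAtlas he he'))
  · exact e'.map_source hy.2
  · exact e'.left_inv hy.2

end LorentzMetric

theorem IsMetricOn.mono {G : E4 → Matrix (Fin 4) (Fin 4) ℝ} {U V : Opens E4} (h : IsMetricOn G U)
    (hV : V ≤ U) : IsMetricOn G V :=
  ⟨fun i j => (h.smooth i j).mono hV, fun y hy => h.symm y (hV hy), fun y hy => h.det y (hV hy)⟩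

end Charts


/-! ### Curvature of the warped line element. -/

section WarpedProduct

open Matrix Finset

variable {R : Type*} [CommRing R] [Algebra ℝ R] {D : Fin 4 → Derivation ℝ R R}

/-- The Christoffel symbols of `dz² + f (dx² + dy² - dt²)`, where `L` is `- 1/2` times the gradient
of `log f` in the directions `t, x, y` and `H` is half its derivative with respect to `z`. -/
def warpedConn (f H L₀ L₁ L₂ : R) : Fin 4 → Matrix (Fin 4) (Fin 4) R :=
  ![!![-L₀, -L₁, -L₂, H; -L₁, -L₀, 0, 0; -L₂, 0, -L₀, 0; f * H, 0, 0, 0],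
    !![-L₁, -L₀, 0, 0; -L₀, -L₁, -L₂, H; 0, L₂, -L₁, 0; 0, -(f * H), 0, 0],
    !![-L₂, 0, -L₀, 0; 0, -L₂, L₁, 0; -L₀, -L₁, -L₂, H; 0, 0, -(f * H), 0],
    !![H, 0, 0, 0; 0, H, 0, 0; 0, 0, H, 0; 0, 0, 0, 0]]

/-- Logarithmic derivatives of the functions occurring in the line element. -/
structure WarpedData (D : Fin 4 → Derivation ℝ R R) (f H H₁ κ c P L₀ L₁ L₂ : R) : Prop where
  comm : ∀ i j f, D i (D j f) = D j (D i f)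
  f0 : D 0 f = -2 * L₀ * f
  f1 : D 1 f = -2 * L₁ * f
  f2 : D 2 f = -2 * L₂ * f
  f3 : D 3 f = 2 * H * f
  H0 : D 0 H = 0
  H1 : D 1 H = 0
  H2 : D 2 H = 0
  H3 : D 3 H = H₁
  L00 : D 0 L₀ = -(c * P) - L₀ * L₀
  L10 : D 1 L₀ = -(L₀ * L₁)
  L20 : D 2 L₀ = -(L₀ * L₂)
  L30 : D 3 L₀ = 0
  L01 : D 0 L₁ = -(L₀ * L₁)
  L11 : D 1 L₁ = c * P - L₁ * L₁
  L21 : D 2 L₁ = -(L₁ * L₂)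
  L31 : D 3 L₁ = 0
  L02 : D 0 L₂ = -(L₀ * L₂)
  L12 : D 1 L₂ = -(L₁ * L₂)
  L22 : D 2 L₂ = c * P - L₂ * L₂
  L32 : D 3 L₂ = 0
  quad : -(L₀ * L₀) + L₁ * L₁ + L₂ * L₂ = 2 * c * (P - P * P)
  curvature : f * κ = 2 * c * (P * P)

variable {f H H₁ κ c P L₀ L₁ L₂ : R}

namespace WarpedData

theorem isLeviCivita (h : WarpedData D f H H₁ κ c P L₀ L₁ L₂) :
    IsLeviCivita D (diagonal ![-f, f, f, 1]) (warpedConn f H L₀ L₁ L₂) := by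
  refine ⟨h.comm, diagonal_transpose _, fun i j k => ?_, fun i => ?_⟩
  · fin_cases i <;> fin_cases j <;> fin_cases k <;> simp [warpedConn]
  · ext a b
    fin_cases i <;> fin_cases a <;> fin_cases b <;>
      simp [warpedConn, Matrix.mul_apply, Matrix.diagonal, h.f0, h.f1, h.f2,
        h.f3] <;> ring

/-- Replacing the traces Γ^k_{kl} by a known covector avoids most of the terms in the explicit Ricci
computation. -/
theorem ric_apply_eq (Γ : Fin 4 → Matrix (Fin 4) (Fin 4) R) (T : Fin 4 → R)
    (hT : ∀ l, ∑ k, Γ k k l = T l) (i j : Fin 4) :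
    ric D Γ i j = ∑ k, D k (Γ j k i) - D j (T i) + ∑ l, T l * Γ j l i
      - ∑ k, (Γ j * Γ k) k i := by
  simp only [ric, curv, Matrix.of_apply, Matrix.sub_apply, Matrix.add_apply, Matrix.map_apply,
    Finset.sum_sub_distrib, Finset.sum_add_distrib]
  congr 2
  · rw [← hT, map_sum]
  · simp only [Matrix.mul_apply]
    rw [Finset.sum_comm]
    exact Finset.sum_congr rfl fun l _ => by rw [← Finset.sum_mul, hT]

theorem sum_warpedConn (l : Fin 4) :
    ∑ k, warpedConn f H L₀ L₁ L₂ k k l = ![-3 * L₀, -3 * L₁, -3 * L₂, 3 * H] l := by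
  fin_cases l <;> simp [warpedConn, Fin.sum_univ_four] <;> ring

set_option maxHeartbeats 1000000 in
-- Here κ is the intrinsic curvature of the leaves. The off-diagonal entries are ring identities; on
-- the leaf diagonal, `quad` and `curvature` collect the gradient terms into f κ.
theorem ric_eq (h : WarpedData D f H H₁ κ c P L₀ L₁ L₂) :
    ric D (warpedConn f H L₀ L₁ L₂) = (2 * κ - H₁ - 3 * (H * H)) • diagonal ![-f, f, f, 1]
      + (-2 * (H₁ + κ)) • vecMulVec ![0, 0, 0, 1] ![0, 0, 0, 1] := by
  have h3 : ∀ i, D i (3 : R) = 0 := fun i => (D i).map_natCast 3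
  ext i j
  rw [ric_apply_eq _ _ sum_warpedConn]
  fin_cases i <;> fin_cases j <;>
    simp [warpedConn, Matrix.mul_apply, Fin.sum_univ_four,
      Derivation.leibniz, h.f3, h.H0, h.H1, h.H2, h.H3, h.L00, h.L10, h.L20,
      h.L30, h.L01, h.L11, h.L21, h.L31, h.L02, h.L12, h.L22, h.L32, h3]
  all_goals
    first
      | ring1
      | linear_combination 2 * h.quad + 2 * h.curvature
      | linear_combination -2 * h.quad - 2 * h.curvature

theorem covVec_normal (f H L₀ L₁ L₂ : R) (a : Fin 4) :
    covVec D (warpedConn f H L₀ L₁ L₂) a ![0, 0, 0, 1]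
      = H • ((diagonal ![-f, f, f, 1] : Matrix (Fin 4) (Fin 4) R) a
        - (![0, 0, 0, 1] : Fin 4 → R) a • ![0, 0, 0, 1]) := by
  ext b
  have e : ∀ b, D a ((![0, 0, 0, 1] : Fin 4 → R) b) = 0 := fun b => by fin_cases b <;> simp
  rw [covVec_apply, e, Fin.sum_univ_four]
  simp only [Pi.smul_apply, Pi.sub_apply, smul_eq_mul, Matrix.diagonal_apply]
  fin_cases a <;> fin_cases b <;> simp [warpedConn, mul_comm]

/-- The trace of the Ricci endomorphism is six times the function in `hR`. Its vanishing
z-derivative expresses D 3 H₁ through lower order data, and that is precisely the condition ρ' = μ H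
of the umbilic criterion. -/
theorem cov_ric_comm (h : WarpedData D f H H₁ κ c P L₀ L₁ L₂)
    (hκ : ∀ i, D i κ = -2 * H * κ * (![0, 0, 0, 1] : Fin 4 → R) i)
    (hR : D 3 (κ - H₁ - 2 * (H * H)) = 0) (a b d : Fin 4) :
    cov D (warpedConn f H L₀ L₁ L₂) a (ric D (warpedConn f H L₀ L₁ L₂)) b d
      = cov D (warpedConn f H L₀ L₁ L₂) b (ric D (warpedConn f H L₀ L₁ L₂)) a d := by
  have n2 : ∀ i, D i (2 : R) = 0 := fun i => (D i).map_natCast 2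
  have n3 : ∀ i, D i (3 : R) = 0 := fun i => (D i).map_natCast 3
  have e0 : D 0 H₁ = 0 := by rw [← h.H3, h.comm, h.H0, map_zero]
  have e1 : D 1 H₁ = 0 := by rw [← h.H3, h.comm, h.H1, map_zero]
  have e2 : D 2 H₁ = 0 := by rw [← h.H3, h.comm, h.H2, map_zero]
  have e3 : D 3 H₁ = -2 * H * κ - 4 * H * H₁ := by
    simp only [map_sub, Derivation.leibniz, smul_eq_mul, h.H3, hκ, n2] at hR
    simp only [Matrix.cons_val] at hR
    linear_combination -hR
  refine cov_ric_comm_of_umbilic h.isLeviCivita (covVec_normal f H L₀ L₁ L₂) h.ric_eq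
    (ρ' := -2 * (H₁ + κ) * H) (fun i => ?_) (fun i => ?_) rfl a b d
  · simp only [map_sub, Derivation.leibniz, smul_eq_mul, hκ, n2, n3]
    fin_cases i <;> simp [h.H0, h.H1, h.H2, h.H3, e0, e1, e2, e3]
    ring
  · have n2' : ∀ i, D i (-2 : R) = 0 := fun i => by rw [map_neg, n2, neg_zero]
    simp only [map_sub, map_add, Derivation.leibniz, smul_eq_mul, hκ, n2, n3, n2']
    fin_cases i <;> simp [h.H0, h.H1, h.H2, h.H3, e0, e1, e2, e3]
    ring

end WarpedData

end WarpedProduct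


/-! ### The line element in terms of coordinate functions. -/

section WarpedProduct

open Matrix Finset

variable {R : Type*} [CommRing R] [Algebra ℝ R] {D : Fin 4 → Derivation ℝ R R}

theorem derivation_inv {d : Derivation ℝ R R} {X Y : R} (h : X * Y = 1) :
    d Y = -(Y * Y * d X) := by
  have e := congrArg d h
  rw [Derivation.leibniz, Derivation.map_one_eq_zero, smul_eq_mul, smul_eq_mul] at e
  linear_combination Y * e - d Y * h

/-- Here P and Q are the inverses of the conformal denominator and of A, so f = A²P² and, with C =
k/4, the leaf curvature is 4CQ² = k/A². -/
theorem warpedData_of_coordinates (hD : ∀ i j f, D i (D j f) = D j (D i f)) {x : Fin 4 → R}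
    (hx : ∀ i j, D i (x j) = if i = j then 1 else 0) {C A P Q : R} (hC : ∀ i, D i C = 0)
    (hP : (1 + C * (x 1 * x 1 + x 2 * x 2 - x 0 * x 0)) * P = 1) (hQ : A * Q = 1)
    (hA : ∀ i, i ≠ 3 → D i A = 0) :
    WarpedData D (A * A * (P * P)) (Q * D 3 A) (D 3 (Q * D 3 A)) (4 * C * (Q * Q)) (2 * C) P
      (-(2 * C * P * x 0)) (2 * C * P * x 1) (2 * C * P * x 2) := by
  have n2 : ∀ i, D i (2 : R) = 0 := fun i => (D i).map_natCast 2
  have dP : ∀ i, D i P = _ := fun i => derivation_inv (d := D i) hP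
  simp only [map_add, map_sub, Derivation.leibniz, Derivation.map_one_eq_zero, hx, hC,
    smul_eq_mul] at dP
  have dQ : ∀ i, i ≠ 3 → D i Q = 0 := fun i hi => by rw [derivation_inv hQ, hA i hi]; ring
  have dA : ∀ i, i ≠ 3 → D i (D 3 A) = 0 := fun i hi => by rw [hD, hA i hi, map_zero]
  have a0 := hA 0 (by decide)
  have a1 := hA 1 (by decide)
  have a2 := hA 2 (by decide)
  constructor
  case comm => exact hD
  case H3 => rfl
  case f3 =>
    simp only [Derivation.leibniz, smul_eq_mul, dP]
    simp
    linear_combination -2 * A * D 3 A * P ^ 2 * hQ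
  case quad => linear_combination 4 * C * P * hP
  case curvature => linear_combination 4 * C * P ^ 2 * (A * Q + 1) * hQ
  case H0 | H1 | H2 =>
    rw [Derivation.leibniz, dQ _ (by decide), dA _ (by decide)]; simp
  all_goals
    simp only [map_neg, Derivation.leibniz, smul_eq_mul, dP, hC, hx, n2, a0, a1, a2]
    simp
    try ring

theorem derivation_kappa {C A Q : R} (hC : ∀ i, D i C = 0) (hQ : A * Q = 1)
    (hA : ∀ i, i ≠ 3 → D i A = 0) (i : Fin 4) :
    D i (4 * C * (Q * Q)) = -2 * (Q * D 3 A) * (4 * C * (Q * Q)) * (![0, 0, 0, 1] : Fin 4 → R) i := by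
  have n4 : ∀ i, D i (4 : R) = 0 := fun i => (D i).map_natCast 4
  simp only [Derivation.leibniz, smul_eq_mul, hC, n4, derivation_inv hQ]
  by_cases hi : i = 3
  · subst hi; simp; ring
  · rw [hA i hi]; fin_cases i <;> simp at hi ⊢

end WarpedProduct

/-! ### The line element with constant Ricci scalar is a Yang pure space. -/

section LineElement

open TopologicalSpace Matrix Finset SmoothFn Topology Filter

theorem isOpenMap_coord (i : Fin 4) : IsOpenMap fun q : E4 => q i :=
  (EuclideanSpace.proj (𝕜 := ℝ) i).isOpenMap fun r => ⟨EuclideanSpace.single i r, by simp⟩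

/-- The Ricci tensor of the line element, of constant trace, is a Codazzi tensor. -/
theorem IsMetricOn.covRicci_comm_of_lineElement {G : E4 → Matrix (Fin 4) (Fin 4) ℝ} {U : Opens E4}
    (h : IsMetricOn G U) {k : ℝ} {A : ℝ → ℝ} {R₀ : ℝ}
    (hA : ContDiffOn ℝ ∞ A ((fun q : E4 => q 3) '' U))
    (hG : ∀ q ∈ U, 0 < A (q 3) ∧ 1 + k / 4 * (q 1 ^ 2 + q 2 ^ 2 - q 0 ^ 2) ≠ 0 ∧
      G q = lineElement k A q)
    (hR : ∀ y ∈ U, ricciScalar G y = R₀) {y : E4} (hy : y ∈ U) (a b c : Fin 4) :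
    covRicci G a b c y - covRicci G b a c y = 0 := by
  have hO : IsOpen ((fun q : E4 => q 3) '' U) := isOpenMap_coord 3 _ U.isOpen
  set 𝒜 : SmoothFn U := SmoothFn.mk (fun y => A (y 3))
    (hA.comp (f := fun y : E4 => y 3) (by fun_prop) (Set.mapsTo_image _ _)) with h𝒜
  set x : Fin 4 → SmoothFn U := fun i => coord i with hxd
  set C : SmoothFn U := algebraMap ℝ _ (k / 4) with hCd
  have hC : ∀ i, partialD i C = 0 := fun i => (partialD i).map_algebraMap _
  have ex : ∀ (y : U) i, eval y (x i) = (y : E4) i := fun y i => rfl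
  have eC : ∀ (y : U), eval y C = k / 4 := fun y => (eval y).commutes _
  obtain ⟨P, hP⟩ := (isUnit_of_forall_ne_zero
    (f := 1 + C * (x 1 * x 1 + x 2 * x 2 - x 0 * x 0)) fun y => by
      have := (hG y y.2).2.1
      simpa only [map_add, map_sub, map_mul, map_one, ex, eC, pow_two] using this).exists_right_inv
  obtain ⟨Q, hQ⟩ := (isUnit_of_forall_ne_zero (f := 𝒜) fun y => (hG y y.2).1.ne').exists_right_inv
  have hA' : ∀ i, i ≠ 3 → partialD i 𝒜 = 0 := fun i hi => by
    ext y
    rw [eval_partialD_eq (F := A ∘ fun y : E4 => y 3) fun y => rfl, pd, map_zero]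
    have d1 : DifferentiableAt ℝ A ((y : E4) 3) :=
      (hA.contDiffAt (hO.mem_nhds ⟨y, y.2, rfl⟩)).differentiableAt (by simp)
    rw [fderiv_comp (y : E4) d1 (by fun_prop), ContinuousLinearMap.comp_apply]
    have : fderiv ℝ (fun y : E4 => y 3) y = EuclideanSpace.proj 3 :=
      (EuclideanSpace.proj (𝕜 := ℝ) 3).fderiv
    rw [this]
    simp [hi]
  have hW := warpedData_of_coordinates partialD_comm (x := x) (fun i j => partialD_coord i j)
    hC hP hQ hA'
  have hκ := derivation_kappa (D := partialD) hC hQ hA'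
  set f := 𝒜 * 𝒜 * (P * P) with hf
  have hmat : h.mat = diagonal ![-f, f, f, 1] := by
    have eP : ∀ y : U, eval y P = (1 + k / 4 * ((y : E4) 1 ^ 2 + (y : E4) 2 ^ 2 - (y : E4) 0 ^ 2))⁻¹ :=
      fun y => by
        have := congrArg (eval y) hP
        simp only [map_add, map_sub, map_mul, map_one, ex, eC] at this
        refine eq_inv_of_mul_eq_one_right ?_
        linear_combination this
    ext i j y
    have e := congrFun (congrFun (hG y y.2).2.2 i) j
    have ef : eval y f = A ((y : E4) 3) ^ 2 /
        (1 + k / 4 * ((y : E4) 1 ^ 2 + (y : E4) 2 ^ 2 - (y : E4) 0 ^ 2)) ^ 2 := by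
      rw [hf, map_mul, map_mul, map_mul, eP, h𝒜, eval_mk]
      field_simp
    change G y i j = _
    rw [e, lineElement, ← ef, Matrix.diagonal_apply, Matrix.diagonal_apply]
    split_ifs
    · fin_cases i <;> simp
    · simp
  -- Uniqueness of the Levi-Civita connection replaces any expansion of the Christoffel formula.
  have hconn : h.conn = warpedConn f (Q * partialD 3 𝒜) (-(2 * C * P * x 0)) (2 * C * P * x 1)
      (2 * C * P * x 2) := by
    have := hW.isLeviCivita
    rw [← hmat] at this
    exact (this.eq_chr h.mul_inv).symm
  have hric := hW.ric_eq
  rw [← hconn, ← hmat] at hric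
  set κ := 4 * C * (Q * Q)
  set H := Q * partialD 3 𝒜
  have hGi : h.inv * h.mat = 1 := mul_eq_one_comm.mp h.mul_inv
  have hs : (h.inv * ric partialD h.conn).trace = algebraMap ℝ _ R₀ := by
    ext y
    rw [AlgHom.commutes, ← hR y y.2, ricciScalar, ← h.map_inv_mul_ric y]
    exact AddMonoidHom.map_trace (eval y).toAddMonoidHom _
  have h33 : h.inv 3 3 = 1 := by
    have := congrFun (congrFun hGi 3) 3
    rw [hmat] at this
    simpa using this
  have hs' : (h.inv * ric partialD h.conn).trace
      = 6 * (κ - partialD 3 H - 2 * (H * H)) := by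
    rw [hric, Matrix.mul_add, Matrix.mul_smul, Matrix.mul_smul, hGi, Matrix.trace_add,
      Matrix.trace_smul, Matrix.trace_smul, Matrix.mul_vecMulVec, Matrix.trace_vecMulVec]
    have : (h.inv *ᵥ ![0, 0, 0, 1]) ⬝ᵥ ![0, 0, 0, 1] = 1 := by
      simp [dotProduct, Fin.sum_univ_four, Matrix.mulVec, h33]
    rw [this]
    simp
    ring
  -- The constant scalar is 6 times this function; the factor 6 is cancelled after evaluation at
  -- points, where it is a nonzero real number.
  have hR' : partialD 3 (κ - partialD 3 H - 2 * (H * H)) = 0 := by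
    have : partialD 3 (6 * (κ - partialD 3 H - 2 * (H * H))) = 0 := by
      rw [← hs', hs]; exact (partialD 3).map_algebraMap _
    have n6 : partialD 3 (6 : SmoothFn U) = 0 := (partialD 3).map_natCast 6
    rw [Derivation.leibniz, n6, smul_zero, add_zero] at this
    ext y
    have := congrArg (eval y) this
    rw [smul_eq_mul, map_mul, map_zero, map_ofNat] at this
    rw [map_zero]
    linarith
  have := congrArg (eval ⟨y, hy⟩) (hW.cov_ric_comm hκ hR' a b c)
  rw [← hconn, h.eval_cov, h.eval_cov] at this
  exact sub_eq_zero.mpr this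

namespace LorentzMetric

variable {M : Type*} [TopologicalSpace M] [ChartedSpace E4 M] [IsManifold (𝓡 4) ∞ M]

/-- The Codazzi equation holds in the adapted chart around the given point and is tensorial, so the
transition map carries it to an arbitrary chart. -/
theorem isYangPureSpace_of_lineElement (g : LorentzMetric M) (hR : g.HasConstantRicciScalar)
    (hL : g.HasLineElement) : g.IsYangPureSpace := by
  intro e he y hy a b c
  obtain ⟨R₀, hR⟩ := hR
  obtain ⟨k, hL⟩ := hL
  obtain ⟨e', he', hp, A, hA, hG⟩ := hL (e.symm y)
  have hi := g.isIsometryOn_chart he he'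
  refine hi.covRicci_comm ((g.isMetricOn he).mono fun y hy => hy.1) (g.isMetricOn he')
    (y := y) ⟨hy, hp⟩ (fun a b c => ?_) a b c
  exact (g.isMetricOn he').covRicci_comm_of_lineElement hA hG (hR e' he')
    (e'.map_source hp) a b c

end LorentzMetric

end LineElement


/-! ### Smooth eigenvalues and eigenvectors of the Ricci tensor. -/

section SegreType

open TopologicalSpace Matrix Finset SmoothFn Topology Filter

variable {G : E4 → Matrix (Fin 4) (Fin 4) ℝ} {U V : Opens E4}

/-- A tetrad adapted to the Segré type. -/
theorem SegreAt.exists_frame {y : E4} (hs : SegreAt G y) (hdet : (G y).det ≠ 0) :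
    ∃ (F : Matrix (Fin 4) (Fin 4) ℝ) (n : Fin 4 → ℝ) (ρ μ : ℝ), Fᵀ * G y * F = eta ∧
      F.col 3 = (G y)⁻¹ *ᵥ n ∧ n ⬝ᵥ (G y)⁻¹ *ᵥ n = 1 ∧ μ ≠ 0 ∧
      ricci G y = ρ • G y + μ • vecMulVec n n := by
  obtain ⟨v, hv, ρ, σ, hρσ, h0, h1, h2, h3⟩ := hs
  set F : Matrix (Fin 4) (Fin 4) ℝ := Matrix.of fun i a => v a i with hF
  have hcol : ∀ a, F.col a = v a := fun a => rfl
  have hη : Fᵀ * G y * F = eta := by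
    ext a b
    rw [← hv a b, Matrix.mul_assoc]
    rfl
  have hu : IsUnit (G y).det := hdet.isUnit
  have hFd : F.det ≠ 0 := by
    intro h0
    have := congrArg Matrix.det hη
    rw [Matrix.det_mul, h0, mul_zero, eta, Matrix.det_diagonal] at this
    simp [Fin.prod_univ_four] at this
  -- Bilinear forms agreeing on a frame agree, so the Ricci decomposition can be checked in the
  -- tetrad, where all matrices are diagonal.
  have hinj : ∀ X Y : Matrix (Fin 4) (Fin 4) ℝ, Fᵀ * X * F = Fᵀ * Y * F → X = Y := by
    intro X Y h
    have h1 : Fᵀ⁻¹ * (Fᵀ * X * F) * F⁻¹ = Fᵀ⁻¹ * (Fᵀ * Y * F) * F⁻¹ := by rw [h]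
    have hFt : IsUnit Fᵀ.det := by rw [Matrix.det_transpose]; exact hFd.isUnit
    have e : ∀ X : Matrix (Fin 4) (Fin 4) ℝ, Fᵀ⁻¹ * (Fᵀ * X * F) * F⁻¹ = X := fun X => by
      rw [Matrix.mul_assoc Fᵀ, Matrix.nonsing_inv_mul_cancel_left _ _ hFt,
        Matrix.mul_nonsing_inv_cancel_right _ _ hFd.isUnit]
    rwa [e, e] at h1
  have hGn : (G y)⁻¹ *ᵥ (G y *ᵥ v 3) = v 3 := by
    rw [Matrix.mulVec_mulVec, Matrix.nonsing_inv_mul _ hu, Matrix.one_mulVec]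
  refine ⟨F, G y *ᵥ v 3, ρ, σ - ρ, hη, by rw [hGn, hcol], ?_, sub_ne_zero.mpr hρσ.symm, ?_⟩
  · rw [hGn, dotProduct_comm, hv]; simp [eta]
  · apply hinj
    have hm : ricciMixed G y * F = F * diagonal ![ρ, ρ, ρ, σ] := by
      have hc : ∀ a, ricciMixed G y *ᵥ v a = (![ρ, ρ, ρ, σ] : Fin 4 → ℝ) a • v a := by
        intro a; fin_cases a
        · exact h0
        · exact h1
        · exact h2
        · exact h3
      ext i a
      rw [Matrix.mul_diagonal, mul_comm]
      exact congrFun (hc a) i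
    have hr : ricci G y = G y * ricciMixed G y := by
      rw [ricciMixed, Matrix.mul_nonsing_inv_cancel_left _ _ hu]
    have hn : Fᵀ *ᵥ (G y *ᵥ v 3) = Pi.single 3 1 := by
      ext a
      have : v a ⬝ᵥ (G y *ᵥ v 3) = _ := hv a 3
      refine this.trans ?_
      fin_cases a <;> simp [eta]
    have hn' : (G y *ᵥ v 3) ᵥ* F = Pi.single 3 1 := by rw [← Matrix.mulVec_transpose, hn]
    rw [hr, Matrix.mul_assoc, Matrix.mul_assoc, hm, ← Matrix.mul_assoc (G y), ← Matrix.mul_assoc,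
      ← Matrix.mul_assoc, hη, Matrix.mul_add, Matrix.add_mul, Matrix.mul_smul, Matrix.smul_mul, hη,
      Matrix.mul_smul, Matrix.smul_mul, Matrix.mul_vecMulVec, hn, Matrix.vecMulVec_mul, hn', eta]
    ext a b
    fin_cases a <;> fin_cases b <;> simp [vecMulVec_apply]

/-- The tracefree part of the Ricci endomorphism. -/
def tracefreeRicci (G : E4 → Matrix (Fin 4) (Fin 4) ℝ) (y : E4) : Matrix (Fin 4) (Fin 4) ℝ :=
  ricciMixed G y - (ricciScalar G y / 4) • 1

/-- The difference of the eigenvalues of the Ricci endomorphism. -/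
def eigenvalueGap (G : E4 → Matrix (Fin 4) (Fin 4) ℝ) (y : E4) : ℝ :=
  2 * (tracefreeRicci G y * tracefreeRicci G y * tracefreeRicci G y).trace
    / (tracefreeRicci G y * tracefreeRicci G y).trace

/-- The eigenvalue of multiplicity three of the Ricci endomorphism. -/
def tripleEigenvalue (G : E4 → Matrix (Fin 4) (Fin 4) ℝ) (y : E4) : ℝ :=
  (ricciScalar G y - eigenvalueGap G y) / 4

theorem ricciMixed_eq {y : E4} (hdet : (G y).det ≠ 0) {n : Fin 4 → ℝ} {ρ μ : ℝ}
    (hr : ricci G y = ρ • G y + μ • vecMulVec n n) :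
    ricciMixed G y = ρ • 1 + μ • vecMulVec ((G y)⁻¹ *ᵥ n) n := by
  rw [ricciMixed, hr, Matrix.mul_add, Matrix.mul_smul, Matrix.mul_smul,
    Matrix.nonsing_inv_mul _ hdet.isUnit, Matrix.mul_vecMulVec]

theorem ricciScalar_eq {y : E4} (hdet : (G y).det ≠ 0) {n : Fin 4 → ℝ} {ρ μ : ℝ}
    (hn : n ⬝ᵥ (G y)⁻¹ *ᵥ n = 1) (hr : ricci G y = ρ • G y + μ • vecMulVec n n) :
    ricciScalar G y = 4 * ρ + μ := by
  rw [ricciScalar, ricciMixed_eq hdet hr, Matrix.trace_add, Matrix.trace_smul, Matrix.trace_smul,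
    Matrix.trace_vecMulVec, dotProduct_comm, hn]
  simp
  ring

/-- The tracefree part is μ (E - 1/4) with E a projection of rank one. The quotient of the cubic by
the quadratic trace recovers μ with its sign, as a rational expression in Ricci, which makes μ and ρ
smooth and chart independent without choosing eigenvectors. -/
theorem trace_tracefreeRicci {y : E4} (hdet : (G y).det ≠ 0) {n : Fin 4 → ℝ} {ρ μ : ℝ}
    (hn : n ⬝ᵥ (G y)⁻¹ *ᵥ n = 1) (hr : ricci G y = ρ • G y + μ • vecMulVec n n) :
    (tracefreeRicci G y * tracefreeRicci G y).trace = 3 / 4 * μ ^ 2 ∧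
    (tracefreeRicci G y * tracefreeRicci G y * tracefreeRicci G y).trace = 3 / 8 * μ ^ 3 := by
  set E := vecMulVec ((G y)⁻¹ *ᵥ n) n with hE
  have hEE : E * E = E := by
    rw [hE, Matrix.vecMulVec_mul_vecMulVec, hn, one_smul]
  have ht : E.trace = 1 := by rw [hE, Matrix.trace_vecMulVec, dotProduct_comm, hn]
  have h1 : (1 : Matrix (Fin 4) (Fin 4) ℝ).trace = 4 := by simp
  have hS : tracefreeRicci G y = μ • (E - (1 / 4 : ℝ) • 1) := by
    rw [tracefreeRicci, ricciScalar_eq hdet hn hr, ricciMixed_eq hdet hr]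
    module
  have h2 : tracefreeRicci G y * tracefreeRicci G y
      = (μ ^ 2) • ((1 / 2 : ℝ) • E + (1 / 16 : ℝ) • 1) := by
    rw [hS, Matrix.smul_mul, Matrix.mul_smul, Matrix.sub_mul, Matrix.mul_sub, Matrix.mul_sub, hEE]
    simp only [Matrix.smul_mul, Matrix.mul_smul, Matrix.one_mul, Matrix.mul_one]
    module
  have h3 : tracefreeRicci G y * tracefreeRicci G y * tracefreeRicci G y
      = (μ ^ 3) • ((7 / 16 : ℝ) • E - (1 / 64 : ℝ) • 1) := by
    rw [h2, hS, Matrix.smul_mul, Matrix.mul_smul, Matrix.add_mul, Matrix.mul_sub, Matrix.mul_sub]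
    simp only [Matrix.smul_mul, Matrix.mul_smul, Matrix.one_mul, Matrix.mul_one, hEE]
    module
  constructor
  · rw [h2, Matrix.trace_smul, Matrix.trace_add, Matrix.trace_smul, Matrix.trace_smul, ht, h1]
    simp only [smul_eq_mul]; ring
  · rw [h3, Matrix.trace_smul, Matrix.trace_sub, Matrix.trace_smul, Matrix.trace_smul, ht, h1]
    simp only [smul_eq_mul]; ring

theorem eigenvalueGap_eq {y : E4} (hdet : (G y).det ≠ 0) {n : Fin 4 → ℝ} {ρ μ : ℝ} (hμ : μ ≠ 0)
    (hn : n ⬝ᵥ (G y)⁻¹ *ᵥ n = 1) (hr : ricci G y = ρ • G y + μ • vecMulVec n n) :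
    eigenvalueGap G y = μ := by
  obtain ⟨h2, h3⟩ := trace_tracefreeRicci hdet hn hr
  rw [eigenvalueGap, h2, h3]
  field_simp
  norm_num

theorem tripleEigenvalue_eq {y : E4} (hdet : (G y).det ≠ 0) {n : Fin 4 → ℝ} {ρ μ : ℝ} (hμ : μ ≠ 0)
    (hn : n ⬝ᵥ (G y)⁻¹ *ᵥ n = 1) (hr : ricci G y = ρ • G y + μ • vecMulVec n n) :
    tripleEigenvalue G y = ρ := by
  rw [tripleEigenvalue, eigenvalueGap_eq hdet hμ hn hr, ricciScalar_eq hdet hn hr]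
  ring

theorem SegreAt.exists_eigenframe {y : E4} (hs : SegreAt G y) (hdet : (G y).det ≠ 0) :
    ∃ (F : Matrix (Fin 4) (Fin 4) ℝ) (n : Fin 4 → ℝ), Fᵀ * G y * F = eta ∧
      F.col 3 = (G y)⁻¹ *ᵥ n ∧ n ⬝ᵥ (G y)⁻¹ *ᵥ n = 1 ∧ eigenvalueGap G y ≠ 0 ∧
      ricci G y = tripleEigenvalue G y • G y + eigenvalueGap G y • vecMulVec n n := by
  obtain ⟨F, n, ρ, μ, hF, hc, hn, hμ, hr⟩ := hs.exists_frame hdet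
  have e1 := eigenvalueGap_eq hdet hμ hn hr
  have e2 := tripleEigenvalue_eq hdet hμ hn hr
  exact ⟨F, n, hF, hc, hn, by rwa [e1], by rwa [e1, e2]⟩

namespace IsMetricOn

theorem contDiffOn_ricciMixed (h : IsMetricOn G U) (i j : Fin 4) :
    ContDiffOn ℝ ∞ (fun y => ricciMixed G y i j) U :=
  ((h.inv * ric partialD h.conn) i j).contDiffOn.congr fun y hy => by
    rw [toFun_of_mem _ hy, ← h.map_inv_mul_ric ⟨y, hy⟩, Matrix.map_apply]

theorem contDiffOn_ricciScalar (h : IsMetricOn G U) : ContDiffOn ℝ ∞ (ricciScalar G) U := by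
  unfold ricciScalar Matrix.trace
  exact ContDiffOn.sum fun i _ => h.contDiffOn_ricciMixed i i

theorem contDiffOn_tracefreeRicci (h : IsMetricOn G U) (i j : Fin 4) :
    ContDiffOn ℝ ∞ (fun y => tracefreeRicci G y i j) U :=
  (h.contDiffOn_ricciMixed i j).sub
    ((h.contDiffOn_ricciScalar.div_const 4).mul contDiffOn_const)

theorem contDiffOn_eigenvalueGap (h : IsMetricOn G U) (hS : ∀ y ∈ U, SegreAt G y) :
    ContDiffOn ℝ ∞ (eigenvalueGap G) U := by
  have hT := h.contDiffOn_tracefreeRicci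
  have h2 : ∀ i j, ContDiffOn ℝ ∞ (fun y => (tracefreeRicci G y * tracefreeRicci G y) i j) U :=
    fun i j => by
      simp only [Matrix.mul_apply]
      exact ContDiffOn.sum fun k _ => (hT i k).mul (hT k j)
  have h3 : ∀ i j, ContDiffOn ℝ ∞ (fun y => (tracefreeRicci G y * tracefreeRicci G y
      * tracefreeRicci G y) i j) U :=
    fun i j => by
      simp only [Matrix.mul_apply (N := tracefreeRicci G _)]
      exact ContDiffOn.sum fun k _ => (h2 i k).mul (hT k j)
  refine ContDiffOn.div (contDiffOn_const.mul (ContDiffOn.sum fun i _ => h3 i i))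
    (ContDiffOn.sum fun i _ => h2 i i) fun y hy => ?_
  obtain ⟨F, n, -, -, hn, hμ, hr⟩ := (hS y hy).exists_eigenframe (h.det y hy)
  have := (trace_tracefreeRicci (h.det y hy) hn hr).1
  rw [this]
  positivity

theorem contDiffOn_tripleEigenvalue (h : IsMetricOn G U) (hS : ∀ y ∈ U, SegreAt G y) :
    ContDiffOn ℝ ∞ (tripleEigenvalue G) U :=
  (h.contDiffOn_ricciScalar.sub (h.contDiffOn_eigenvalueGap hS)).div_const 4

/-- The eigenvalue of multiplicity three, as a smooth function. -/
def rho (h : IsMetricOn G U) (hS : ∀ y ∈ U, SegreAt G y) : SmoothFn U :=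
  SmoothFn.mk (tripleEigenvalue G) (h.contDiffOn_tripleEigenvalue hS)

/-- The difference of the eigenvalues, as a smooth function. -/
def mu (h : IsMetricOn G U) (hS : ∀ y ∈ U, SegreAt G y) : SmoothFn U :=
  SmoothFn.mk (eigenvalueGap G) (h.contDiffOn_eigenvalueGap hS)

theorem eval_rho (h : IsMetricOn G U) (hS : ∀ y ∈ U, SegreAt G y) (y : U) :
    eval y (h.rho hS) = tripleEigenvalue G y := rfl

theorem eval_mu (h : IsMetricOn G U) (hS : ∀ y ∈ U, SegreAt G y) (y : U) :
    eval y (h.mu hS) = eigenvalueGap G y := rfl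

theorem eval_mu_ne_zero (h : IsMetricOn G U) (hS : ∀ y ∈ U, SegreAt G y) (y : U) :
    eval y (h.mu hS) ≠ 0 := by
  obtain ⟨F, n, -, -, -, hμ, -⟩ := (hS y y.2).exists_eigenframe (h.det y y.2)
  exact hμ

theorem four_mul_rho_add_mu (h : IsMetricOn G U) (hS : ∀ y ∈ U, SegreAt G y) :
    4 * h.rho hS + h.mu hS = (h.inv * ric partialD h.conn).trace := by
  ext y
  have e : eval y (h.inv * ric partialD h.conn).trace = ricciScalar G y := by
    rw [ricciScalar, ← h.map_inv_mul_ric y]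
    exact AddMonoidHom.map_trace (eval y).toAddMonoidHom _
  rw [e, map_add, map_mul, map_ofNat, h.eval_rho, h.eval_mu, tripleEigenvalue]
  ring

/-- A unit eigenvector of the Ricci tensor belonging to the simple eigenvalue. -/
structure IsNormal (h : IsMetricOn G U) (hS : ∀ y ∈ U, SegreAt G y) (n : Fin 4 → SmoothFn U) :
    Prop where
  unit : n ⬝ᵥ h.inv *ᵥ n = 1
  ric_eq : ric partialD h.conn = h.rho hS • h.mat + h.mu hS • vecMulVec n n

/-- Only n⊗n is given smoothly, as (Ric - ρ g)/μ. Where its diagonal entry T i i is positive, row i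
divided by √(T i i) is a smooth choice of n; some diagonal entry is positive at `y₀` because n is
not zero. -/
theorem exists_isNormal (h : IsMetricOn G U) (hS : ∀ y ∈ U, SegreAt G y) {y₀ : E4} (hy₀ : y₀ ∈ U) :
    ∃ (V : Opens E4) (hV : V ≤ U), y₀ ∈ V ∧ ∃ n : Fin 4 → SmoothFn V,
      (h.mono hV).IsNormal (fun y hy => hS y (hV hy)) n := by
  set T : E4 → Matrix (Fin 4) (Fin 4) ℝ := fun y =>
    (eigenvalueGap G y)⁻¹ • (ricci G y - tripleEigenvalue G y • G y) with hT
  have key : ∀ y ∈ U, ∃ n : Fin 4 → ℝ, n ⬝ᵥ (G y)⁻¹ *ᵥ n = 1 ∧ eigenvalueGap G y ≠ 0 ∧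
      ricci G y = tripleEigenvalue G y • G y + eigenvalueGap G y • vecMulVec n n ∧
      T y = vecMulVec n n := by
    intro y hy
    obtain ⟨F, n, -, -, hn, hμ, hr⟩ := (hS y hy).exists_eigenframe (h.det y hy)
    refine ⟨n, hn, hμ, hr, ?_⟩
    rw [hT]
    dsimp only
    rw [hr, add_sub_cancel_left, smul_smul, inv_mul_cancel₀ hμ, one_smul]
  have hTs : ∀ i j, ContDiffOn ℝ ∞ (fun y => T y i j) U := fun i j => by
    have hric : ContDiffOn ℝ ∞ (fun y => ricci G y i j) U :=
      (ric partialD h.conn i j).contDiffOn.congr fun y hy => by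
        rw [toFun_of_mem _ hy, h.eval_ric]
    exact ((h.contDiffOn_eigenvalueGap hS).inv fun y hy => (key y hy).choose_spec.2.1).mul
      (hric.sub ((h.contDiffOn_tripleEigenvalue hS).mul (h.smooth i j)))
  obtain ⟨i, hi⟩ : ∃ i, 0 < T y₀ i i := by
    obtain ⟨n, hn, -, -, hTn⟩ := key y₀ hy₀
    by_contra! hc
    have : n = 0 := by
      ext i
      have := hc i
      rw [hTn, vecMulVec_apply] at this
      exact mul_self_eq_zero.mp (le_antisymm this (mul_self_nonneg _))
    rw [this, zero_dotProduct] at hn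
    exact zero_ne_one hn
  set V : Opens E4 := ⟨U ∩ (fun y => T y i i) ⁻¹' Set.Ioi 0,
    (hTs i i).continuousOn.isOpen_inter_preimage U.isOpen isOpen_Ioi⟩
  have hV : V ≤ U := fun y hy => hy.1
  refine ⟨V, hV, ⟨hy₀, hi⟩, fun j => SmoothFn.mk (fun y => T y i j / √(T y i i))
    (((hTs i j).mono hV).div (((hTs i i).mono hV).sqrt fun y hy => (ne_of_gt hy.2))
      fun y hy => (Real.sqrt_pos.mpr hy.2).ne'), ?_⟩
  have hprod : ∀ y : V, ∀ j k, T y i j / √(T y i i) * (T y i k / √(T y i i)) = T y j k := by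
    intro y j k
    obtain ⟨n, -, -, -, hTn⟩ := key y y.2.1
    have hp : 0 < T y i i := y.2.2
    rw [div_mul_div_comm, Real.mul_self_sqrt hp.le, div_eq_iff hp.ne', hTn]
    simp only [vecMulVec_apply]
    ring
  constructor
  · ext y
    obtain ⟨n, hn, -, -, hTn⟩ := key y y.2.1
    have hinv : ∀ j k, eval y ((h.mono hV).inv j k) = (G y)⁻¹ j k := fun j k =>
      congrFun (congrFun ((h.mono hV).map_inv y) j) k
    simp only [dotProduct, Matrix.mulVec, map_sum, map_mul, map_one, hinv, eval_mk] at hn ⊢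
    rw [← hn]
    simp only [Finset.mul_sum]
    refine Finset.sum_congr rfl fun j _ => Finset.sum_congr rfl fun k _ => ?_
    have := (hprod y j k).trans (congrFun (congrFun hTn j) k)
    rw [vecMulVec_apply] at this
    linear_combination (G y)⁻¹ j k * this
  · ext j k y
    obtain ⟨n, hn, -, hr, hTn⟩ := key y y.2.1
    rw [(h.mono hV).eval_ric, hr]
    simp only [Matrix.add_apply, Matrix.smul_apply, smul_eq_mul, map_add, map_mul, eval_rho,
      eval_mu, vecMulVec_apply, eval_mk, hprod]
    rw [hTn, vecMulVec_apply]
    rfl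

end IsMetricOn

end SegreType


/-! ### The deviation of the curvature from that of a warped product. -/

section DifferentialRing

open Matrix Finset

variable {ι : Type*} [Fintype ι] [DecidableEq ι] {R : Type*} [CommRing R] [Algebra ℝ R]
  {D : ι → Derivation ℝ R R} {G Gi : Matrix ι ι R} {Γ : ι → Matrix ι ι R} {n : ι → R} {p q : R}

/-- The difference between the Riemann tensor and that of a warped product, where `p` is the
sectional curvature of the planes tangent to the leaves and `q` that of the planes containing the
normal `n`. -/
def curvDefect (D : ι → Derivation ℝ R R) (G : Matrix ι ι R) (Γ : ι → Matrix ι ι R) (n : ι → R)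
    (p q : R) (a b c d : ι) : R :=
  (G * curv D Γ a b) c d - p * (G a c * G b d - G a d * G b c)
    - (q - p) * (n a * n c * G b d + G a c * (n b * n d) - n a * n d * G b c - G a d * (n b * n c))

theorem curvDefect_swap (a b c d : ι) :
    curvDefect D G Γ n p q b a c d = -curvDefect D G Γ n p q a b c d := by
  simp only [curvDefect]
  rw [IsLeviCivita.curv_swap, Matrix.mul_neg, Matrix.neg_apply]
  ring

namespace IsLeviCivita

theorem curvDefect_skew (h : IsLeviCivita D G Γ) (a b c d : ι) :
    curvDefect D G Γ n p q a b d c = -curvDefect D G Γ n p q a b c d := by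
  have e := congrFun (congrFun (h.transpose_curv_mul a b) c) d
  have e' : (G * curv D Γ a b) d c = ((curv D Γ a b)ᵀ * G) c d := by
    have : ((G * curv D Γ a b)ᵀ) c d = ((curv D Γ a b)ᵀ * Gᵀ) c d := by rw [transpose_mul]
    rwa [h.symm] at this
  simp only [curvDefect]
  rw [e', e, Matrix.neg_apply]
  ring

theorem curvDefect_cyclic (h : IsLeviCivita D G Γ) (a b c d : ι) :
    curvDefect D G Γ n p q a b c d + curvDefect D G Γ n p q b d c a
      + curvDefect D G Γ n p q d a c b = 0 := by
  have e : (G * curv D Γ a b) c d + (G * curv D Γ b d) c a + (G * curv D Γ d a) c b = 0 := by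
    simp only [Matrix.mul_apply, ← Finset.sum_add_distrib, ← mul_add]
    exact Finset.sum_eq_zero fun k _ => by rw [h.bianchi_first, mul_zero]
  simp only [curvDefect]
  rw [h.apply_comm d b, h.apply_comm b a, h.apply_comm d a]
  linear_combination e

/-- The bridge to `IsWarpedCurvature`: contracted with any covector, the defect is the difference of
the two sides there. -/
theorem sum_curvDefect_mul (h : IsLeviCivita D G Γ) (hG : G * Gi = 1)
    (w : ι → R) (a b d : ι) :
    ∑ c, curvDefect D G Γ n p q a b c d * (Gi *ᵥ w) c = ((curv D Γ a b)ᵀ *ᵥ w) d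
      - p * (w a * G b d - G a d * w b) - (q - p) * (n a * (w ⬝ᵥ Gi *ᵥ n) * G b d
        + w a * n b * n d - n a * n d * w b - G a d * n b * (w ⬝ᵥ Gi *ᵥ n)) := by
  have hGw : ∀ a, ∑ c, G a c * (Gi *ᵥ w) c = w a := fun a => inner_row hG w a
  have hnw : ∑ c, n c * (Gi *ᵥ w) c = w ⬝ᵥ Gi *ᵥ n := by rw [h.inner_comm hG w n]; rfl
  have hc : ∑ c, (G * curv D Γ a b) c d * (Gi *ᵥ w) c = ((curv D Γ a b)ᵀ *ᵥ w) d := by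
    have e : (G *ᵥ (Gi *ᵥ w)) = w := by rw [Matrix.mulVec_mulVec, hG, Matrix.one_mulVec]
    have e2 : ((curv D Γ a b)ᵀ *ᵥ (G *ᵥ (Gi *ᵥ w))) d = ∑ c, (G * curv D Γ a b) c d * (Gi *ᵥ w) c := by
      rw [Matrix.mulVec_mulVec]
      simp only [Matrix.mulVec, dotProduct]
      refine Finset.sum_congr rfl fun c _ => ?_
      congr 1
      simp only [Matrix.mul_apply, Matrix.transpose_apply]
      exact Finset.sum_congr rfl fun k _ => by rw [mul_comm, h.apply_comm c k]
    rw [← e2, e]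
  rw [← hc, ← hGw a, ← hGw b, ← hnw]
  simp only [curvDefect, Finset.mul_sum, Finset.sum_mul, ← Finset.sum_add_distrib,
    ← Finset.sum_sub_distrib]
  exact Finset.sum_congr rfl fun c _ => by ring

/-- The model curvature has Ricci tensor (2p + q) g + 2(q - p) n⊗n in dimension four, so matching ρ
and μ makes the defect tracefree. -/
theorem sum_inv_mul_curvDefect (h : IsLeviCivita D G Γ) (hG : G * Gi = 1)
    (hcard : Fintype.card ι = 4) (hn : n ⬝ᵥ Gi *ᵥ n = 1) {ρ μ : R}
    (hric : ric D Γ = ρ • G + μ • vecMulVec n n) (hρ : ρ = 2 * p + q) (hμ : μ = 2 * (q - p))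
    (b d : ι) : ∑ a, ∑ c, Gi a c * curvDefect D G Γ n p q a b c d = 0 := by
  have hGi : Gi * G = 1 := mul_eq_one_comm.mp hG
  have hs : ∀ a b, Gi a b = Gi b a := fun a b => by
    conv_lhs => rw [← inv_transpose h.symm hG]
    rfl
  have hG1 : ∀ x a, ∑ c, Gi a c * G x c = (1 : Matrix ι ι R) a x := fun x a => by
    rw [← hGi, Matrix.mul_apply]
    exact Finset.sum_congr rfl fun c _ => by rw [h.apply_comm x c]
  have hν : ∀ a, ∑ c, Gi a c * n c = (Gi *ᵥ n) a := fun a => rfl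
  have hnν : ∑ a, n a * (Gi *ᵥ n) a = 1 := hn
  have hGν : ∀ x, ∑ a, G a x * (Gi *ᵥ n) a = n x := fun x => by
    rw [← inner_row hG n x]
    exact Finset.sum_congr rfl fun a _ => by rw [h.apply_comm a x]
  have hR : ∀ a, ∑ c, Gi a c * (G * curv D Γ a b) c d = curv D Γ a b a d := fun a => by
    have : (Gi * (G * curv D Γ a b)) a d = curv D Γ a b a d := by
      rw [← Matrix.mul_assoc, hGi, Matrix.one_mul]
    exact this
  have inner : ∀ a, ∑ c, Gi a c * curvDefect D G Γ n p q a b c d = curv D Γ a b a d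
      - p * ((1 : Matrix ι ι R) a a * G b d - G a d * (1 : Matrix ι ι R) a b)
      - (q - p) * (n a * (Gi *ᵥ n) a * G b d + (1 : Matrix ι ι R) a a * (n b * n d)
        - n a * n d * (1 : Matrix ι ι R) a b - G a d * (n b * (Gi *ᵥ n) a)) := by
    intro a
    rw [← hR, ← hG1, ← hG1, ← hν]
    simp only [curvDefect, Finset.mul_sum, Finset.sum_mul, ← Finset.sum_add_distrib,
      ← Finset.sum_sub_distrib]
    exact Finset.sum_congr rfl fun c _ => by ring
  have hRic : ∑ a, curv D Γ a b a d = ρ * G d b + μ * (n d * n b) := by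
    have := congrFun (congrFun hric d) b
    simpa [ric, vecMulVec_apply] using this
  have i1 : ∑ a, (1 : Matrix ι ι R) a a = 4 := by simp [hcard]
  have i2 : ∑ a, G a d * (1 : Matrix ι ι R) a b = G b d := by simp [Matrix.one_apply]
  have i3 : ∑ a, n a * (1 : Matrix ι ι R) a b = n b := by simp [Matrix.one_apply]
  calc _ = ∑ a, curv D Γ a b a d - p * ((∑ a, (1 : Matrix ι ι R) a a) * G b d
        - ∑ a, G a d * (1 : Matrix ι ι R) a b)
      - (q - p) * ((∑ a, n a * (Gi *ᵥ n) a) * G b d + (∑ a, (1 : Matrix ι ι R) a a) * (n b * n d)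
        - n d * ∑ a, n a * (1 : Matrix ι ι R) a b - n b * ∑ a, G a d * (Gi *ᵥ n) a) := by
        simp only [inner, Finset.mul_sum, Finset.sum_mul, ← Finset.sum_add_distrib,
          ← Finset.sum_sub_distrib]
        exact Finset.sum_congr rfl fun c _ => by ring
    _ = 0 := by
        rw [i1, i2, i3, hnν, hGν, hRic, h.apply_comm d b, hρ, hμ]
        ring

end IsLeviCivita

theorem IsUmbilic.sum_curvDefect_mul_normal {H H' : R} (hU : IsUmbilic D G Gi Γ n H)
    (h : IsLeviCivita D G Γ) (hG : G * Gi = 1) (hH : ∀ a, D a H = H' * n a)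
    (hq : q = -(H' + H * H)) (a b d : ι) :
    ∑ c, curvDefect D G Γ n p q a b c d * (Gi *ᵥ n) c = 0 := by
  rw [h.sum_curvDefect_mul hG, hU.curv_transpose_mulVec h hH, hU.unit, hq]
  simp only [Pi.smul_apply, Pi.sub_apply, smul_eq_mul]
  ring

end DifferentialRing

/-! ### Algebraic curvature tensors that are tracefree and tangent to three dimensions. -/

section LinearAlgebra

open Matrix Finset

theorem skew_eq_zero {f : Fin 4 → Fin 4 → ℝ} (hf : ∀ a b, f b a = -f a b) (h01 : f 0 1 = 0)
    (h02 : f 0 2 = 0) (h03 : f 0 3 = 0) (h12 : f 1 2 = 0) (h13 : f 1 3 = 0) (h23 : f 2 3 = 0)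
    (a b : Fin 4) : f a b = 0 := by
  have hd : ∀ a, f a a = 0 := fun a => by linarith [hf a a]
  have h10 := hf 0 1
  have h20 := hf 0 2
  have h30 := hf 0 3
  have h21 := hf 1 2
  have h31 := hf 1 3
  have h32 := hf 2 3
  fin_cases a <;> fin_cases b <;>
    simp only [Fin.zero_eta, Fin.mk_one, Fin.reduceFinMk, hd, h01, h02, h03, h12, h13, h23, h10,
      h20, h30, h21, h31, h32, neg_zero]

/-- The Weyl tensor of a three dimensional space vanishes. -/
theorem weyl_eq_zero_of_frame {W : Fin 4 → Fin 4 → Fin 4 → Fin 4 → ℝ}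
    (s1 : ∀ a b c d, W b a c d = -W a b c d) (s2 : ∀ a b c d, W a b d c = -W a b c d)
    (cyc : ∀ a b c d, W a b c d + W b d c a + W d a c b = 0) (h3 : ∀ a b d, W a b 3 d = 0)
    (hr : ∀ b d, -W 0 b 0 d + W 1 b 1 d + W 2 b 2 d = 0) (a b c d : Fin 4) : W a b c d = 0 := by
  -- The usual octahedron argument: pair symmetry follows from the skew symmetries and four cyclic
  -- identities.
  have pair : ∀ a b c d, W a b c d = W c d a b := by
    intro a b c d
    linarith [cyc a b c d, cyc b c d a, cyc c d a b, cyc d a b c, s1 a b c d, s1 b c d a,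
      s1 c d a b, s1 d a b c, s2 a b c d, s2 b c d a, s2 c d a b, s2 d a b c, s1 a c b d,
      s1 b d a c, s1 a c d b, s1 b d c a, s2 a c b d, s2 b d a c, s2 c a b d, s2 d b a c,
      s1 a b d c, s1 b c a d, s1 c d b a, s1 d a c b]
  have h3' : ∀ a b c, W a b c 3 = 0 := fun a b c => by rw [s2, h3, neg_zero]
  have h3l : ∀ b c d, W 3 b c d = 0 := fun b c d => by rw [pair, h3]
  have h3m : ∀ a c d, W a 3 c d = 0 := fun a c d => by rw [pair, h3']
  have z1 : ∀ a c d, W a a c d = 0 := fun a c d => by linarith [s1 a a c d]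
  have z2 : ∀ a b c, W a b c c = 0 := fun a b c => by linarith [s2 a b c c]
  -- With all components carrying an index 3 gone, six independent components remain, and the trace
  -- equations over three dimensions determine them.
  have r00 := hr 0 0
  have r01 := hr 0 1
  have r02 := hr 0 2
  have r10 := hr 1 0
  have r11 := hr 1 1
  have r12 := hr 1 2
  have r20 := hr 2 0
  have r21 := hr 2 1
  have r22 := hr 2 2
  simp only [z1, z2] at r00 r01 r02 r10 r11 r12 r20 r21 r22
  have t := fun a b c d => s1 a b c d
  have t2 := fun a b c d => s2 a b c d
  refine skew_eq_zero (f := fun a b => W a b c d) (fun a b => s1 a b c d) ?_ ?_ (h3m _ _ _) ?_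
    (h3m _ _ _) (h3m _ _ _) a b <;>
  refine skew_eq_zero (s2 _ _) ?_ ?_ (h3' _ _ _) ?_ (h3' _ _ _) (h3' _ _ _) c d <;>
  linarith [s1 0 1 0 1, s1 0 1 1 0, s2 0 1 0 1, s1 0 2 0 2, s1 0 2 2 0, s2 0 2 0 2, s1 1 2 1 2,
    s1 1 2 2 1, s2 1 2 1 2, s1 0 1 1 2, s1 0 1 2 1, s2 0 1 1 2, s1 0 1 0 2, s1 0 1 2 0, s2 0 1 0 2,
    s1 0 2 0 1, s1 0 2 1 0, s2 0 2 0 1, s1 0 2 1 2, s1 0 2 2 1, s2 0 2 1 2, s1 1 2 0 1, s1 1 2 1 0,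
    s2 1 2 0 1, s1 1 2 0 2, s1 1 2 2 0, s2 1 2 0 2]

theorem eq_zero_of_forall_sum_mul {F : Matrix (Fin 4) (Fin 4) ℝ} (hF : F.det ≠ 0)
    {f : Fin 4 → ℝ} (h : ∀ p, ∑ a, F a p * f a = 0) : f = 0 := by
  refine Matrix.eq_zero_of_mulVec_eq_zero (M := Fᵀ) (by rwa [Matrix.det_transpose]) ?_
  ext p
  exact h p

/-- The Weyl tensor of a three dimensional space vanishes. -/
theorem weyl_eq_zero {F gi : Matrix (Fin 4) (Fin 4) ℝ} (hF : F.det ≠ 0) (hgi : F * eta * Fᵀ = gi)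
    {T : Fin 4 → Fin 4 → Fin 4 → Fin 4 → ℝ}
    (s1 : ∀ a b c d, T b a c d = -T a b c d) (s2 : ∀ a b c d, T a b d c = -T a b c d)
    (cyc : ∀ a b c d, T a b c d + T b d c a + T d a c b = 0)
    (h3 : ∀ a b d, ∑ c, T a b c d * F c 3 = 0)
    (hr : ∀ b d, ∑ a, ∑ c, gi a c * T a b c d = 0) (a b c d : Fin 4) : T a b c d = 0 := by
  set W : Fin 4 → Fin 4 → Fin 4 → Fin 4 → ℝ := fun p q r s =>
    ∑ a, ∑ b, ∑ c, ∑ d, F a p * F b q * F c r * F d s * T a b c d with hW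
  have hW3 : ∀ p q s, W p q 3 s = 0 := by
    intro p q s
    rw [hW]
    refine Finset.sum_eq_zero fun a _ => Finset.sum_eq_zero fun b _ => ?_
    rw [Finset.sum_comm]
    refine Finset.sum_eq_zero fun d _ => ?_
    calc _ = F a p * F b q * F d s * ∑ c, T a b c d * F c 3 := by
          rw [Finset.mul_sum]; exact Finset.sum_congr rfl fun c _ => by ring
      _ = 0 := by rw [h3, mul_zero]
  have hW0 : ∀ p q r s, W p q r s = 0 := by
    refine weyl_eq_zero_of_frame ?_ ?_ ?_ hW3 ?_
    · intro p q r s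
      simp only [hW, ← Finset.sum_neg_distrib]
      rw [Finset.sum_comm]
      refine Finset.sum_congr rfl fun a _ => Finset.sum_congr rfl fun b _ =>
        Finset.sum_congr rfl fun c _ => Finset.sum_congr rfl fun d _ => ?_
      rw [s1 a b]; ring
    · intro p q r s
      simp only [hW, ← Finset.sum_neg_distrib]
      refine Finset.sum_congr rfl fun a _ => Finset.sum_congr rfl fun b _ => ?_
      rw [Finset.sum_comm]
      refine Finset.sum_congr rfl fun c _ => Finset.sum_congr rfl fun d _ => ?_
      rw [s2 a b]; ring
    · have cy : ∀ f : Fin 4 → Fin 4 → Fin 4 → Fin 4 → ℝ,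
          ∑ a, ∑ b, ∑ c, ∑ d, f b d c a = ∑ a, ∑ b, ∑ c, ∑ d, f a b c d := by
        intro f
        rw [Finset.sum_comm]
        refine Finset.sum_congr rfl fun x _ => ?_
        rw [Finset.sum_comm, Finset.sum_comm (f := fun y c => ∑ d, f x y c d)]
        exact Finset.sum_congr rfl fun c _ => Finset.sum_comm
      intro p q r s
      have e1 : W q s r p = ∑ a, ∑ b, ∑ c, ∑ d, F a p * F b q * F c r * F d s * T b d c a := by
        simp only [hW]
        rw [← cy fun a b c d => F a q * F b s * F c r * F d p * T a b c d]
        refine Finset.sum_congr rfl fun a _ => Finset.sum_congr rfl fun b _ =>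
          Finset.sum_congr rfl fun c _ => Finset.sum_congr rfl fun d _ => ?_
        ring
      have e2 : W s p r q = ∑ a, ∑ b, ∑ c, ∑ d, F a p * F b q * F c r * F d s * T d a c b := by
        simp only [hW]
        rw [← cy fun a b c d => F a s * F b p * F c r * F d q * T a b c d,
          ← cy fun b d c a => F d s * F a p * F c r * F b q * T d a c b]
        refine Finset.sum_congr rfl fun a _ => Finset.sum_congr rfl fun b _ =>
          Finset.sum_congr rfl fun c _ => Finset.sum_congr rfl fun d _ => ?_
        ring
      rw [e1, e2]
      simp only [hW, ← Finset.sum_add_distrib, ← mul_add, cyc, mul_zero, Finset.sum_const_zero]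
    · intro q s
      have hg : ∀ a c, gi a c = -(F a 0 * F c 0) + F a 1 * F c 1 + F a 2 * F c 2 + F a 3 * F c 3 := by
        intro a c
        rw [← hgi, eta, Matrix.mul_apply, Fin.sum_univ_four]
        simp only [Matrix.mul_diagonal, Matrix.transpose_apply]
        simp
      have e : -W 0 q 0 s + W 1 q 1 s + W 2 q 2 s + W 3 q 3 s
          = ∑ a, ∑ b, ∑ c, ∑ d, F b q * F d s * (gi a c * T a b c d) := by
        simp only [hW, ← Finset.sum_neg_distrib, ← Finset.sum_add_distrib]
        refine Finset.sum_congr rfl fun a _ => Finset.sum_congr rfl fun b _ =>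
          Finset.sum_congr rfl fun c _ => Finset.sum_congr rfl fun d _ => ?_
        rw [hg]; ring
      rw [hW3, add_zero] at e
      rw [e, Finset.sum_comm]
      refine Finset.sum_eq_zero fun b _ => ?_
      calc _ = ∑ d, ∑ a, ∑ c, F b q * F d s * (gi a c * T a b c d) := by
            rw [Finset.sum_comm (s := Finset.univ) (t := Finset.univ)
              (f := fun d a => ∑ c, F b q * F d s * (gi a c * T a b c d))]
            exact Finset.sum_congr rfl fun a _ => Finset.sum_comm
        _ = 0 := by
            refine Finset.sum_eq_zero fun d _ => ?_
            simp only [← Finset.mul_sum, hr, mul_zero]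
  -- The frame matrix is invertible, so it can be stripped from one slot at a time.
  have k1 : ∀ q r s a, ∑ b, ∑ c, ∑ d, F b q * F c r * F d s * T a b c d = 0 := fun q r s =>
    congrFun (eq_zero_of_forall_sum_mul hF
      (f := fun a => ∑ b, ∑ c, ∑ d, F b q * F c r * F d s * T a b c d) fun p => by
        rw [← hW0 p q r s]
        simp only [hW, Finset.mul_sum, mul_assoc])
  have k2 : ∀ r s a b, ∑ c, ∑ d, F c r * F d s * T a b c d = 0 := fun r s a =>
    congrFun (eq_zero_of_forall_sum_mul hF
      (f := fun b => ∑ c, ∑ d, F c r * F d s * T a b c d) fun q => by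
        rw [← k1 q r s a]
        simp only [Finset.mul_sum, mul_assoc])
  have k3 : ∀ s a b c, ∑ d, F d s * T a b c d = 0 := fun s a b =>
    congrFun (eq_zero_of_forall_sum_mul hF (f := fun c => ∑ d, F d s * T a b c d) fun r => by
        rw [← k2 r s a b]
        simp only [Finset.mul_sum, mul_assoc])
  exact congrFun (eq_zero_of_forall_sum_mul hF (f := T a b c) fun s => k3 s a b c) d

end LinearAlgebra

/-! ### The curvature is that of a warped product. -/

section LocalMetrics

open TopologicalSpace Matrix Finset SmoothFn

variable {G : E4 → Matrix (Fin 4) (Fin 4) ℝ} {U : Opens E4}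

/-- An orthonormal frame containing the normal up to a factor. -/
theorem IsMetricOn.IsNormal.exists_frame {h : IsMetricOn G U} {hS : ∀ y ∈ U, SegreAt G y}
    {n : Fin 4 → SmoothFn U} (hn : h.IsNormal hS n) (y : U) :
    ∃ (F : Matrix (Fin 4) (Fin 4) ℝ) (c : ℝ), Fᵀ * G y * F = eta ∧
      F.col 3 = c • ((G y)⁻¹ *ᵥ fun i => eval y (n i)) := by
  obtain ⟨F, m, hF, hF3, hm, hμ0, hr⟩ := (hS y y.2).exists_eigenframe (h.det y y.2)
  have hnn : vecMulVec m m = vecMulVec (fun i => eval y (n i)) (fun i => eval y (n i)) := by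
    have e : (ric partialD h.conn).map (eval y) = tripleEigenvalue G y • G y
        + eigenvalueGap G y • vecMulVec (fun i => eval y (n i)) (fun i => eval y (n i)) := by
      rw [hn.ric_eq]
      ext i j
      simp only [Matrix.map_apply, Matrix.add_apply, Matrix.smul_apply, smul_eq_mul, map_add,
        map_mul, h.eval_rho, h.eval_mu, vecMulVec_apply]
      rfl
    rw [h.map_ric, hr] at e
    exact smul_right_injective _ hμ0 (add_left_cancel e)
  have hc : m = ((fun i => eval y (n i)) ⬝ᵥ (G y)⁻¹ *ᵥ m) • fun i => eval y (n i) := by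
    have e := congrArg (fun M => M *ᵥ ((G y)⁻¹ *ᵥ m)) hnn
    rw [Matrix.vecMulVec_mulVec, Matrix.vecMulVec_mulVec, hm] at e
    simpa using e
  refine ⟨F, (fun i => eval y (n i)) ⬝ᵥ (G y)⁻¹ *ᵥ m, hF, ?_⟩
  rw [← Matrix.mulVec_smul, ← hc, hF3]

/-- The defect has the symmetries of a curvature tensor, is annihilated by the normal and is
tracefree; at each point an orthonormal frame reduces it to the three-dimensional vanishing theorem.
-/
theorem IsMetricOn.IsNormal.isWarpedCurvature {h : IsMetricOn G U} {hS : ∀ y ∈ U, SegreAt G y}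
    {n : Fin 4 → SmoothFn U} (hn : h.IsNormal hS n) {H H' ψ : SmoothFn U}
    (hU : IsUmbilic partialD h.mat h.inv h.conn n H) (hH : ∀ a, partialD a H = H' * n a)
    (hρ : h.rho hS = 2 * (ψ - H * H) - (H' + H * H))
    (hμ : h.mu hS = 2 * (-(H' + H * H) - (ψ - H * H))) :
    IsWarpedCurvature partialD h.mat h.inv h.conn n H H' ψ := by
  set p := ψ - H * H with hp
  set q := -(H' + H * H) with hq
  set T := curvDefect partialD h.mat h.conn n p q with hT
  have key : ∀ a b c d, T a b c d = 0 := by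
    intro a b c d
    ext y
    rw [map_zero]
    obtain ⟨F, c₀, hF, hF3⟩ := hn.exists_frame y
    have hηη : eta * eta = 1 := by
      rw [eta, Matrix.diagonal_mul_diagonal]
      ext i j; fin_cases i <;> fin_cases j <;> simp
    have hF1 : F * (eta * (Fᵀ * G y)) = 1 := by
      rw [mul_eq_one_comm, Matrix.mul_assoc, Matrix.mul_assoc, ← Matrix.mul_assoc Fᵀ, hF, hηη]
    have hFd : F.det ≠ 0 := fun h0 => by
      have := congrArg Matrix.det hF1
      rw [Matrix.det_mul, h0, zero_mul, Matrix.det_one] at this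
      exact zero_ne_one this
    have hgi : F * eta * Fᵀ = (G y)⁻¹ := by
      refine (Matrix.inv_eq_left_inv ?_).symm
      rw [Matrix.mul_assoc, Matrix.mul_assoc, hF1]
    refine weyl_eq_zero hFd hgi (T := fun a b c d => eval y (T a b c d)) ?_ ?_ ?_ ?_ ?_ a b c d
    · intro a b c d; rw [← map_neg, hT, curvDefect_swap]
    · intro a b c d; rw [← map_neg, hT, h.isLeviCivita.curvDefect_skew]
    · intro a b c d; rw [← map_add, ← map_add, hT, h.isLeviCivita.curvDefect_cyclic, map_zero]
    · intro a b d
      have e := congrArg (eval y)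
        (hU.sum_curvDefect_mul_normal (p := p) h.isLeviCivita h.mul_inv hH hq a b d)
      have hF3' : ∀ c, F c 3 = c₀ * eval y ((h.inv *ᵥ n) c) := by
        intro c
        have := congrFun hF3 c
        rw [← h.map_inv y] at this
        refine this.trans ?_
        simp [Matrix.mulVec, dotProduct]
      simp only [map_sum, map_mul, map_zero] at e
      simp only [hF3', mul_left_comm _ c₀, ← Finset.mul_sum]
      rw [hT, e, mul_zero]
    · intro b d
      have e := congrArg (eval y) (h.isLeviCivita.sum_inv_mul_curvDefect (p := p) (q := q)
        h.mul_inv (by simp) hn.unit hn.ric_eq (by rw [hρ, hq]; ring) (by rw [hμ]) b d)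
      simp only [map_sum, map_mul, map_zero] at e
      rw [← e]
      refine Finset.sum_congr rfl fun a _ => Finset.sum_congr rfl fun c _ => ?_
      rw [← h.map_inv y]; rfl
  intro a b w k
  have e := h.isLeviCivita.sum_curvDefect_mul (n := n) (p := p) (q := q) h.mul_inv w a b k
  rw [Finset.sum_eq_zero fun c _ => by rw [← hT, key, zero_mul]] at e
  linear_combination -e

end LocalMetrics


/-! ### The umbilic structure of a Yang pure space, and the invariant that becomes k. -/

section Structure

open TopologicalSpace Matrix Finset SmoothFn Topology Filter

theorem fderiv_eq_zero_of_pd {f : E4 → ℝ} {y : E4} (h : ∀ i, pd i f y = 0) : fderiv ℝ f y = 0 := by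
  ext v
  conv_lhs => rw [← (EuclideanSpace.basisFun (Fin 4) ℝ).sum_repr v]
  simp only [map_sum, map_smul, EuclideanSpace.basisFun_apply]
  exact Finset.sum_eq_zero fun i _ => by
    have := h i
    rw [pd] at this
    rw [this, smul_zero]

theorem SmoothFn.eval_eq_of_partialD_eq_zero {U : Opens E4} (hU : IsPreconnected (U : Set E4))
    {f : SmoothFn U} (h : ∀ i, partialD i f = 0) (x y : U) : eval x f = eval y f := by
  rw [← toFun_apply, ← toFun_apply]
  refine U.isOpen.is_const_of_fderiv_eq_zero hU (f.contDiffOn.differentiableOn (by simp))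
    (fun z hz => fderiv_eq_zero_of_pd fun i => ?_) x.2 y.2
  exact congrArg (eval ⟨z, hz⟩) (h i)

theorem SmoothFn.eventually_eq_of_partialD_eq_zero {U : Opens E4}
    {f : SmoothFn U} (h : ∀ i, partialD i f = 0) (x : U) :
    ∀ᶠ y in 𝓝 (x : E4), f.toFun y = f.toFun x := by
  obtain ⟨r, hr, hb⟩ := Metric.isOpen_iff.mp U.isOpen x x.2
  filter_upwards [Metric.ball_mem_nhds (x : E4) hr] with y hy
  refine Metric.isOpen_ball.is_const_of_fderiv_eq_zero (convex_ball _ _).isPreconnected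
    ((f.contDiffOn.mono hb).differentiableOn (by simp)) (fun z hz => fderiv_eq_zero_of_pd fun i => ?_)
    hy (Metric.mem_ball_self hr)
  exact congrArg (eval ⟨z, hb hz⟩) (h i)

/-- The squared norm of the gradient. -/
def gradNormSq (G : E4 → Matrix (Fin 4) (Fin 4) ℝ) (f : E4 → ℝ) (y : E4) : ℝ :=
  (fun i => pd i f y) ⬝ᵥ (G y)⁻¹ *ᵥ fun i => pd i f y

/-- The function which turns out to be the constant `k` of the line element. -/
def leafCurvature (G : E4 → Matrix (Fin 4) (Fin 4) ℝ) (y : E4) : ℝ :=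
  ((eigenvalueGap G y ^ 2) ^ (-1 / 8 : ℝ)) ^ 2 * ((2 * tripleEigenvalue G y - eigenvalueGap G y) / 6
    + gradNormSq G (tripleEigenvalue G) y / eigenvalueGap G y ^ 2)

variable {G : E4 → Matrix (Fin 4) (Fin 4) ℝ} {U : Opens E4}

/-- The geometry of the leaves orthogonal to `n`, with `A` the warping function. -/
structure IsWarpedNormal (h : IsMetricOn G U) (n : Fin 4 → SmoothFn U) (A H H' ψ : SmoothFn U) :
    Prop where
  umbilic : IsUmbilic partialD h.mat h.inv h.conn n H
  deriv_H : ∀ a, partialD a H = H' * n a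
  deriv_psi : ∀ a, partialD a ψ = -2 * H * ψ * n a
  deriv_A : ∀ a, partialD a A = H * A * n a
  curvature : IsWarpedCurvature partialD h.mat h.inv h.conn n H H' ψ
  pos : ∀ y, 0 < eval y A
  leaf : ∀ y : U, eval y (A * A * ψ) = leafCurvature G y

namespace IsMetricOn

theorem codazzi (h : IsMetricOn G U)
    (hY : ∀ y ∈ U, ∀ a b c, covRicci G a b c y - covRicci G b a c y = 0) (a b c : Fin 4) :
    cov partialD h.conn a (ric partialD h.conn) b c
      = cov partialD h.conn b (ric partialD h.conn) a c := by
  ext y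
  rw [h.eval_cov, h.eval_cov, ← sub_eq_zero]
  exact hY y y.2 a b c

theorem partialD_scalar (h : IsMetricOn G U)
    (hY : ∀ y ∈ U, ∀ a b c, covRicci G a b c y - covRicci G b a c y = 0) (i : Fin 4) :
    partialD i (h.inv * ric partialD h.conn).trace = 0 :=
  h.isLeviCivita.derivation_scalar_eq_zero h.mul_inv (h.codazzi hY) i

theorem eval_trace (h : IsMetricOn G U) (y : U) :
    eval y (h.inv * ric partialD h.conn).trace = ricciScalar G y := by
  rw [ricciScalar, ← h.map_inv_mul_ric y]
  exact AddMonoidHom.map_trace (eval y).toAddMonoidHom _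

theorem eventually_ricciScalar_eq (h : IsMetricOn G U)
    (hY : ∀ y ∈ U, ∀ a b c, covRicci G a b c y - covRicci G b a c y = 0) {y : E4} (hy : y ∈ U) :
    ∀ᶠ z in 𝓝 y, ricciScalar G z = ricciScalar G y := by
  filter_upwards [eventually_eq_of_partialD_eq_zero (h.partialD_scalar hY) ⟨y, hy⟩,
    U.isOpen.mem_nhds hy] with z hz hzU
  rwa [toFun_of_mem _ hzU, toFun_of_mem _ hy, h.eval_trace, h.eval_trace] at hz

/-- The warping function. -/
theorem exists_warping (h : IsMetricOn G U) (hS : ∀ y ∈ U, SegreAt G y) :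
    ∃ A : SmoothFn U, (∀ y : U, eval y A = (eigenvalueGap G y ^ 2) ^ (-1 / 8 : ℝ)) ∧
      ∀ a, 4 * (h.mu hS * partialD a A) = -(A * partialD a (h.mu hS)) := by
  have hμ := h.eval_mu_ne_zero hS
  have hsm := h.contDiffOn_eigenvalueGap hS
  refine ⟨SmoothFn.mk (fun y => (eigenvalueGap G y ^ 2) ^ (-1 / 8 : ℝ))
    ((hsm.pow 2).rpow_const_of_ne fun y hy => pow_ne_zero 2 (hμ ⟨y, hy⟩)), fun y => rfl,
    fun a => ?_⟩
  ext y
  have hm : eigenvalueGap G y ≠ 0 := hμ y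
  have hp : 0 < eigenvalueGap G y ^ 2 := by positivity
  have hd : DifferentiableAt ℝ (eigenvalueGap G) y :=
    (hsm.contDiffAt (U.isOpen.mem_nhds y.2)).differentiableAt (by simp)
  have e := ((hd.hasFDerivAt.pow 2).rpow_const (p := (-1 / 8 : ℝ)) (Or.inl hp.ne')).fderiv
  simp only [map_neg, map_mul, map_ofNat, eval_mk, eval_mu]
  rw [mu, partialD_mk, partialD_mk, eval_mk, eval_mk, pd, pd, e, Real.rpow_sub_one hp.ne']
  simp
  field_simp
  ring

/-- From dμ = -4τ n = -4μ H n, the function A = |μ|^(-1/4) has dA = H A n. Solving ρ = 2p + q and μ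
= 2(q - p) gives p = (2ρ - μ)/6, and the Gauss equation gives ψ = p + H². Since dρ = τ n, H² =
|dρ|²/μ² does not depend on the sign of n, so A²ψ is an invariant of the metric. -/
theorem exists_isWarpedNormal (h : IsMetricOn G U) (hS : ∀ y ∈ U, SegreAt G y)
    (hY : ∀ y ∈ U, ∀ a b c, covRicci G a b c y - covRicci G b a c y = 0)
    {n : Fin 4 → SmoothFn U} (hn : h.IsNormal hS n) :
    ∃ A H H' ψ, IsWarpedNormal h n A H H' ψ := by
  set ρ := h.rho hS
  set μ := h.mu hS
  obtain ⟨μi, hμ⟩ := (isUnit_of_forall_ne_zero (h.eval_mu_ne_zero hS)).exists_right_inv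
  have hR : ∀ a, partialD a μ = -4 * partialD a ρ := fun a => by
    have e := h.partialD_scalar hY a
    have n4 : partialD a (4 : SmoothFn U) = 0 := (partialD a).map_natCast 4
    rw [← h.four_mul_rho_add_mu hS, map_add, Derivation.leibniz, n4, smul_zero, add_zero,
      smul_eq_mul] at e
    linear_combination e
  obtain ⟨τ, hτ, hU⟩ := codazzi_isUmbilic h.isLeviCivita h.mul_inv (by simp) hn.unit hμ hn.ric_eq
    (h.codazzi hY) hR
  obtain ⟨τ', hτ'⟩ := hU.exists_derivation_eq h.isLeviCivita hτ
  set H := τ * μi with hHd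
  -- Differentiating the factor 1/μ contributes 4τ²/μ² = 4H².
  have hH : ∀ a, partialD a H = (τ' * μi + 4 * H * H) * n a := fun a => by
    rw [hHd, Derivation.leibniz, derivation_inv hμ, hR, hτ, hτ', smul_eq_mul, smul_eq_mul]
    ring
  set H' := τ' * μi + 4 * H * H
  have h3 := hU.three_mul_eq h.isLeviCivita h.mul_inv (by simp) hn.ric_eq hH
  set s : SmoothFn U := algebraMap ℝ _ (1 / 6) with hs
  have hs6 : s * 6 = 1 := by
    rw [hs, ← map_ofNat (algebraMap ℝ (SmoothFn U)) 6, ← map_mul]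
    norm_num
  have hsD : ∀ a, partialD a s = 0 := fun a => (partialD a).map_algebraMap _
  obtain ⟨A, hA, hAD⟩ := h.exists_warping hS
  replace hτ : ∀ a, partialD a ρ = τ * n a := hτ
  replace h3 : -3 * (H' + H * H) = ρ + μ := h3
  have hτH : τ = μ * H := by rw [hHd]; linear_combination -τ * hμ
  refine ⟨A, H, H', s * (2 * ρ - μ) + H * H, hU, hH, fun a => ?_, fun a => ?_,
    hn.isWarpedCurvature hU hH ?_ ?_, fun y => ?_, fun y => ?_⟩
  · have n2 : partialD a (2 : SmoothFn U) = 0 := (partialD a).map_natCast 2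
    simp only [map_add, map_sub, Derivation.leibniz, smul_eq_mul, hsD, n2, hH, hR, hτ]
    linear_combination 6 * s * n a * hτH - 2 * H * n a * (H' + H * H) * hs6 - 4 * s * H * n a * h3
  · have e := hAD a
    rw [hR, hτ, hτH] at e
    have : 4 * partialD a A = 4 * (H * A * n a) := by
      linear_combination μi * e - 4 * (partialD a A - H * A * n a) * hμ
    ext y
    have := congrArg (eval y) this
    rw [map_mul, map_mul, map_ofNat] at this
    linarith
  · change ρ = _
    linear_combination -(ρ + (H' + H * H)) * hs6 - 2 * s * h3
  · change μ = _
    linear_combination -(μ + 2 * (H' + H * H)) * hs6 - 4 * s * h3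
  · rw [hA]
    have := h.eval_mu_ne_zero hS y
    rw [h.eval_mu] at this
    positivity
  · have hg : gradNormSq G (tripleEigenvalue G) y = eval y (τ * τ) := by
      have e : ∀ i, pd i (tripleEigenvalue G) y = eval y τ * eval y (n i) := fun i => by
        rw [← map_mul, ← hτ]
        exact (eval_partialD_eq (h.eval_rho hS) i y).symm
      have hu := congrArg (eval y) hn.unit
      simp only [dotProduct, Matrix.mulVec, map_sum, map_mul, map_one] at hu
      have : (fun i => pd i (tripleEigenvalue G) y) = eval y τ • fun i => eval y (n i) := by
        ext i; exact e i
      rw [gradNormSq, this, Matrix.mulVec_smul, dotProduct_smul, smul_dotProduct, ← h.map_inv y]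
      simp only [dotProduct, Matrix.mulVec, Matrix.map_apply, smul_eq_mul]
      rw [hu, map_mul, mul_one]
    have hi : eval y μi = (eigenvalueGap G y)⁻¹ := by
      have := congrArg (eval y) hμ
      rw [map_mul, map_one] at this
      exact eq_inv_of_mul_eq_one_right this
    rw [leafCurvature, hg, hHd]
    simp only [map_mul, map_add, map_sub, hA, hi, hs, AlgHom.commutes, map_ofNat]
    change _ * (algebraMap ℝ ℝ (1 / 6) * (2 * tripleEigenvalue G y - eigenvalueGap G y) + _) = _
    simp only [Algebra.algebraMap_self, RingHom.id_apply]
    ring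

end IsMetricOn

end Structure


/-! ### Local constants become global ones. -/

section Globalization

open TopologicalSpace Matrix Finset SmoothFn Topology Filter

namespace IsIsometryOn

variable {φ : E4 → E4} {G G' : E4 → Matrix (Fin 4) (Fin 4) ℝ} {U V : Opens E4}

theorem ricciScalar_eq (i : IsIsometryOn φ G G' U V) (h : IsMetricOn G U) (h' : IsMetricOn G' V)
    {y : E4} (hy : y ∈ U) : ricciScalar G y = ricciScalar G' (φ y) := by
  obtain ⟨P, Q, hPQ, hr⟩ := i.ricciMixed_conj h h' hy
  rw [ricciScalar, ricciScalar, hr, Matrix.trace_mul_comm, ← Matrix.mul_assoc, hPQ, Matrix.one_mul]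

theorem eigenvalueGap_eq (i : IsIsometryOn φ G G' U V) (h : IsMetricOn G U) (h' : IsMetricOn G' V)
    {y : E4} (hy : y ∈ U) : eigenvalueGap G y = eigenvalueGap G' (φ y) := by
  obtain ⟨P, Q, hPQ, hr⟩ := i.ricciMixed_conj h h' hy
  have hQP : Q * P = 1 := mul_eq_one_comm.mp hPQ
  have e : tracefreeRicci G y = Q * tracefreeRicci G' (φ y) * P := by
    rw [tracefreeRicci, tracefreeRicci, i.ricciScalar_eq h h' hy, hr, Matrix.mul_sub,
      Matrix.sub_mul, Matrix.mul_smul, Matrix.smul_mul, Matrix.mul_one, hQP]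
  have ht : ∀ X : Matrix (Fin 4) (Fin 4) ℝ, (Q * X * P).trace = X.trace := fun X => by
    rw [Matrix.trace_mul_comm, ← Matrix.mul_assoc, hPQ, Matrix.one_mul]
  have hm : ∀ X Y : Matrix (Fin 4) (Fin 4) ℝ, Q * X * P * (Q * Y * P) = Q * (X * Y) * P :=
    fun X Y => by
      calc _ = Q * X * (P * Q) * Y * P := by simp only [Matrix.mul_assoc]
        _ = _ := by rw [hPQ, Matrix.mul_one]; simp only [Matrix.mul_assoc]
  rw [eigenvalueGap, eigenvalueGap, e, hm, hm, ht, ht]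

theorem tripleEigenvalue_eq (i : IsIsometryOn φ G G' U V) (h : IsMetricOn G U)
    (h' : IsMetricOn G' V) {y : E4} (hy : y ∈ U) :
    tripleEigenvalue G y = tripleEigenvalue G' (φ y) := by
  rw [tripleEigenvalue, tripleEigenvalue, i.ricciScalar_eq h h' hy, i.eigenvalueGap_eq h h' hy]

theorem gradNormSq_eq (i : IsIsometryOn φ G G' U V) (h : IsMetricOn G U) {f f' : E4 → ℝ}
    (hf' : ContDiffOn ℝ ∞ f' V) (hf : ∀ y ∈ U, f y = f' (φ y)) {y : E4} (hy : y ∈ U) :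
    gradNormSq G f y = gradNormSq G' f' (φ y) := by
  set J := (jacobian φ i.smooth).map (eval ⟨y, hy⟩) with hJ
  have hp : G y = Jᵀ * G' (φ y) * J := i.pull y hy
  have hGd := h.det y hy
  have hJd : J.det ≠ 0 := fun h0 => hGd (by rw [hp, Matrix.det_mul, h0, mul_zero])
  have hJtd : Jᵀ.det ≠ 0 := by rwa [Matrix.det_transpose]
  have hG'd : (G' (φ y)).det ≠ 0 := fun h0 => hGd (by
    rw [hp, Matrix.det_mul, Matrix.det_mul, h0, mul_zero, zero_mul])
  have hgrad : (fun j => pd j f y) = Jᵀ *ᵥ fun a => pd a f' (φ y) := by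
    ext j
    have e := congrArg (eval ⟨y, hy⟩) (partialD_pullback i.smooth i.mapsTo (SmoothFn.mk f' hf') j)
    rw [eval_partialD_eq (F := f) fun z => by rw [eval_pullback, eval_mk, hf z z.2], map_sum] at e
    rw [e]
    simp only [Matrix.mulVec, dotProduct]
    refine Finset.sum_congr rfl fun a _ => ?_
    rw [map_mul, eval_pullback, partialD_mk, eval_mk]
    rfl
  set w := fun a => pd a f' (φ y)
  have hinv : J * ((G y)⁻¹ * Jᵀ) = (G' (φ y))⁻¹ := by
    rw [hp, Matrix.mul_inv_rev, Matrix.mul_inv_rev, Matrix.mul_assoc, Matrix.mul_assoc,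
      Matrix.nonsing_inv_mul _ hJtd.isUnit, Matrix.mul_one,
      Matrix.mul_nonsing_inv_cancel_left _ _ hJd.isUnit]
  rw [gradNormSq, gradNormSq, hgrad, ← hinv, ← Matrix.mulVec_mulVec, ← Matrix.mulVec_mulVec,
    Matrix.dotProduct_mulVec w J, Matrix.mulVec_transpose]

theorem leafCurvature_eq (i : IsIsometryOn φ G G' U V) (h : IsMetricOn G U)
    (h' : IsMetricOn G' V) (hS' : ∀ y ∈ V, SegreAt G' y) {y : E4} (hy : y ∈ U) :
    leafCurvature G y = leafCurvature G' (φ y) := by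
  rw [leafCurvature, leafCurvature, i.eigenvalueGap_eq h h' hy, i.tripleEigenvalue_eq h h' hy,
    i.gradNormSq_eq h (h'.contDiffOn_tripleEigenvalue hS')
      (fun z hz => i.tripleEigenvalue_eq h h' hz) hy]

end IsIsometryOn

/-- In A²ψ the logarithmic derivatives 2H n of A² and -2H n of ψ cancel. -/
theorem IsMetricOn.eventually_leafCurvature_eq {G : E4 → Matrix (Fin 4) (Fin 4) ℝ} {U : Opens E4}
    (h : IsMetricOn G U) (hS : ∀ y ∈ U, SegreAt G y)
    (hY : ∀ y ∈ U, ∀ a b c, covRicci G a b c y - covRicci G b a c y = 0) {y : E4} (hy : y ∈ U) :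
    ∀ᶠ z in 𝓝 y, leafCurvature G z = leafCurvature G y := by
  obtain ⟨V, hV, hyV, n, hn⟩ := h.exists_isNormal hS hy
  obtain ⟨A, H, H', ψ, hw⟩ :=
    (h.mono hV).exists_isWarpedNormal _ (fun y hy => hY y (hV hy)) hn
  have hd : ∀ i, partialD i (A * A * ψ) = 0 := fun i => by
    simp only [Derivation.leibniz, smul_eq_mul, hw.deriv_A, hw.deriv_psi]
    ring
  filter_upwards [eventually_eq_of_partialD_eq_zero hd ⟨y, hyV⟩, V.isOpen.mem_nhds hyV] with z hz hzV
  rwa [toFun_of_mem _ hzV, toFun_of_mem _ hyV, hw.leaf, hw.leaf] at hz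

variable {M : Type*} [TopologicalSpace M] [ChartedSpace E4 M] [IsManifold (𝓡 4) ∞ M]

/-- Chart independence turns the family into one function on M; it is locally constant, hence
constant by connectedness. -/
theorem exists_const_of_chart [ConnectedSpace M] {F : OpenPartialHomeomorph M E4 → E4 → ℝ}
    (hinv : ∀ e ∈ IsManifold.maximalAtlas (𝓡 4) ∞ M, ∀ e' ∈ IsManifold.maximalAtlas (𝓡 4) ∞ M,
      ∀ y ∈ (e.symm.trans e').source, F e y = F e' (e' (e.symm y)))
    (hloc : ∀ e ∈ IsManifold.maximalAtlas (𝓡 4) ∞ M, ∀ y ∈ e.target, ∀ᶠ z in 𝓝 y, F e z = F e y) :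
    ∃ c, ∀ e ∈ IsManifold.maximalAtlas (𝓡 4) ∞ M, ∀ y ∈ e.target, F e y = c := by
  set f : M → ℝ := fun p => F (chartAt E4 p) (chartAt E4 p p) with hf
  have hch : ∀ p : M, chartAt E4 p ∈ IsManifold.maximalAtlas (𝓡 4) ∞ M := fun p =>
    IsManifold.chart_mem_maximalAtlas p
  have hfe : ∀ e ∈ IsManifold.maximalAtlas (𝓡 4) ∞ M, ∀ p ∈ e.source, f p = F e (e p) := by
    intro e he p hp
    have := hinv e he _ (hch p) (e p) ⟨e.map_source hp, by
      change e.symm (e p) ∈ (chartAt E4 p).source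
      rw [e.left_inv hp]; exact mem_chart_source _ _⟩
    rw [this, e.left_inv hp]
  have hlc : IsLocallyConstant f := by
    rw [IsLocallyConstant.iff_eventually_eq]
    intro p
    set e := chartAt E4 p
    have h1 := hloc e (hch p) (e p) (mem_chart_target _ _)
    have h2 : Tendsto e (𝓝 p) (𝓝 (e p)) := e.continuousAt (mem_chart_source _ _)
    filter_upwards [h2.eventually h1, e.open_source.mem_nhds (mem_chart_source _ _)] with q hq hqs
    rw [hfe e (hch p) q hqs, hq]
  obtain ⟨p₀⟩ : Nonempty M := inferInstance
  refine ⟨f p₀, fun e he y hy => ?_⟩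
  rw [← hlc.apply_eq_of_preconnectedSpace (e.symm y) p₀, hfe e he _ (e.map_target hy),
    e.right_inv hy]

namespace LorentzMetric

theorem isIsometryOn_chart_mem (g : LorentzMetric M) {e e' : OpenPartialHomeomorph M E4}
    (he : e ∈ IsManifold.maximalAtlas (𝓡 4) ∞ M) :
    IsMetricOn (components g.val e) ⟨(e.symm.trans e').source, (e.symm.trans e').open_source⟩ :=
  (g.isMetricOn he).mono fun _ hy => hy.1

theorem hasConstantRicciScalar [ConnectedSpace M] (g : LorentzMetric M) (hY : g.IsYangPureSpace) :
    g.HasConstantRicciScalar :=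
  exists_const_of_chart
    (fun _ he _ he' _ hy => (g.isIsometryOn_chart he he').ricciScalar_eq
      (g.isIsometryOn_chart_mem he) (g.isMetricOn he') hy)
    fun e he _ hy => (g.isMetricOn he).eventually_ricciScalar_eq (hY e he) hy

theorem exists_leafCurvature_eq [ConnectedSpace M] (g : LorentzMetric M) (hS : g.HasSegreType)
    (hY : g.IsYangPureSpace) : ∃ k, ∀ e ∈ IsManifold.maximalAtlas (𝓡 4) ∞ M, ∀ y ∈ e.target,
      leafCurvature (components g.val e) y = k :=
  exists_const_of_chart
    (fun _ he e' he' _ hy => (g.isIsometryOn_chart he he').leafCurvature_eq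
      (g.isIsometryOn_chart_mem he) (g.isMetricOn he') (hS e' he') hy)
    fun e he _ hy => (g.isMetricOn he).eventually_leafCurvature_eq (hS e he) (hY e he) hy

end LorentzMetric

end Globalization


/-! ### Parallel sections of flat linear connections. -/

section Frobenius

open Set Metric Topology Filter
open scoped NNReal

set_option maxSynthPendingDepth 5

variable {E F : Type*} [NormedAddCommGroup E] [NormedSpace ℝ E] [NormedAddCommGroup F]
  [NormedSpace ℝ F]

/-- Bounds on a ball for a connection form and its first two derivatives. -/
structure ConnBound (B : E → E →L[ℝ] F →L[ℝ] F) (y₀ : E) (r C : ℝ) : Prop where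
  pos : 0 < r
  le_one : r ≤ 1
  one_le : 1 ≤ C
  mul_le : C * r ≤ 1 / 2
  diff : ∀ x ∈ ball y₀ r, DifferentiableAt ℝ B x
  norm_le : ∀ x ∈ ball y₀ r, ‖B x‖ ≤ C
  norm_fderiv_le : ∀ x ∈ ball y₀ r, ‖fderiv ℝ B x‖ ≤ C
  taylor : ∀ x k, x ∈ ball y₀ r → x + k ∈ ball y₀ r →
    ‖B (x + k) - B x - fderiv ℝ B x k‖ ≤ C * ‖k‖ ^ 2

/-- A Lipschitz bound for the derivative gives the quadratic Taylor remainder. Shrinking the ball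
until C r ≤ 1/2 makes the radial equation solvable on the whole unit interval. -/
theorem exists_connBound {B : E → E →L[ℝ] F →L[ℝ] F} {y₀ : E} {U : Set E} (hU : U ∈ 𝓝 y₀)
    (hB : ContDiffOn ℝ ∞ B U) : ∃ r C, ball y₀ r ⊆ U ∧ ConnBound B y₀ r C := by
  have hB0 : ContDiffAt ℝ ∞ B y₀ := hB.contDiffAt hU
  have hB1 : ContDiffAt ℝ 1 (fderiv ℝ B) y₀ := hB0.fderiv_right (m := 1) (by
    exact WithTop.coe_le_coe.mpr le_top)
  obtain ⟨K, t, ht, hK⟩ := hB1.exists_lipschitzOnWith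
  have e1 : ∀ᶠ x in 𝓝 y₀, ‖B x‖ < ‖B y₀‖ + 1 :=
    hB0.continuousAt.norm.eventually_lt continuousAt_const (by simp)
  have e2 : ∀ᶠ x in 𝓝 y₀, ‖fderiv ℝ B x‖ < ‖fderiv ℝ B y₀‖ + 1 :=
    hB1.continuousAt.norm.eventually_lt continuousAt_const (by simp)
  have e3 : ∀ᶠ x in 𝓝 y₀, ContDiffAt ℝ 1 B x :=
    (hB0.of_le (m := 1) (by exact WithTop.coe_le_coe.mpr le_top)).eventually (by simp)
  obtain ⟨s, hs, hb⟩ := Metric.eventually_nhds_iff_ball.mp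
    (e1.and (e2.and (e3.and ((eventually_mem_set.mpr ht).and (eventually_mem_set.mpr hU)))))
  set C : ℝ := ‖B y₀‖ + ‖fderiv ℝ B y₀‖ + K + 1 with hC
  have hC1 : 1 ≤ C := by
    have := K.2; rw [hC]; linarith [norm_nonneg (B y₀), norm_nonneg (fderiv ℝ B y₀), K.coe_nonneg]
  have hC0 : 0 < C := by linarith
  set r := min s (1 / (2 * C)) with hr
  have hrs : ball y₀ r ⊆ ball y₀ s := ball_subset_ball (min_le_left _ _)
  have hrC : r ≤ 1 / (2 * C) := min_le_right _ _
  refine ⟨r, C, fun x hx => (hb x (hrs hx)).2.2.2.2, lt_min hs (by positivity), ?_, hC1, ?_, ?_, ?_,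
    ?_, ?_⟩
  · refine hrC.trans ?_
    rw [div_le_one (by positivity)]; linarith
  · calc C * r ≤ C * (1 / (2 * C)) := by gcongr
      _ = 1 / 2 := by field_simp
  · exact fun x hx => (hb x (hrs hx)).2.2.1.differentiableAt (by simp)
  · intro x hx
    have := (hb x (hrs hx)).1.le
    linarith [norm_nonneg (fderiv ℝ B y₀), K.coe_nonneg]
  · intro x hx
    have := (hb x (hrs hx)).2.1.le
    linarith [norm_nonneg (B y₀), K.coe_nonneg]
  · intro x k hx hk
    have hseg : segment ℝ x (x + k) ⊆ ball y₀ r := (convex_ball y₀ r).segment_subset hx hk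
    have := (convex_segment x (x + k)).norm_image_sub_le_of_norm_hasFDerivWithin_le'
      (f := B) (f' := fderiv ℝ B) (φ := fderiv ℝ B x) (C := K * ‖k‖)
      (fun z hz => ((hb z (hrs (hseg hz))).2.2.1.differentiableAt
        (by simp)).hasFDerivAt.hasFDerivWithinAt) (fun z hz => ?_) (left_mem_segment ℝ _ _)
      (right_mem_segment ℝ _ _)
    · rw [add_sub_cancel_left] at this
      refine this.trans ?_
      have hKC : (K : ℝ) ≤ C := by linarith [norm_nonneg (B y₀), norm_nonneg (fderiv ℝ B y₀)]
      calc K * ‖k‖ * ‖k‖ = K * ‖k‖ ^ 2 := by ring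
        _ ≤ _ := by gcongr
    · have h1 := hK.norm_sub_le (hb z (hrs (hseg hz))).2.2.2.1 (hb x (hrs hx)).2.2.2.1
      refine h1.trans ?_
      gcongr
      obtain ⟨a, b, ha, hb', hab, rfl⟩ := hz
      have : a • x + b • (x + k) - x = b • k := by
        rw [smul_add, ← add_assoc, ← add_smul, hab, one_smul, add_sub_cancel_left]
      rw [this, norm_smul, Real.norm_of_nonneg hb']
      have : b ≤ 1 := by linarith
      nlinarith [norm_nonneg k]

namespace ConnBound

variable {B : E → E →L[ℝ] F →L[ℝ] F} {y₀ : E} {r C : ℝ}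

theorem mem_ball (_h : ConnBound B y₀ r C) {v : E} (hv : ‖v‖ < r) {t : ℝ} (ht : t ∈ Icc (0 : ℝ) 1) :
    y₀ + t • v ∈ ball y₀ r := by
  rw [mem_ball_iff_norm, add_sub_cancel_left, norm_smul, Real.norm_of_nonneg ht.1]
  nlinarith [norm_nonneg v, ht.2]

theorem norm_apply_le (h : ConnBound B y₀ r C) {v : E} (hv : ‖v‖ < r) {t : ℝ}
    (ht : t ∈ Icc (0 : ℝ) 1) : ‖B (y₀ + t • v) v‖ ≤ 1 / 2 := by
  refine ((B _).le_opNorm v).trans (le_trans ?_ h.mul_le)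
  have := h.norm_le _ (h.mem_ball hv ht)
  have := h.one_le
  gcongr

/-- A solution along the segment from `y₀` to `y₀ + v`. -/
def IsRadial (B : E → E →L[ℝ] F →L[ℝ] F) (y₀ : E) (Y₀ : F) (v : E) (α : ℝ → F) : Prop :=
  α 0 = Y₀ ∧ ∀ t ∈ Icc (0 : ℝ) 1, HasDerivWithinAt α (B (y₀ + t • v) v (α t)) (Icc 0 1) t

theorem exists_isRadial [CompleteSpace F] (h : ConnBound B y₀ r C) (Y₀ : F) {v : E}
    (hv : ‖v‖ < r) : ∃ α, IsRadial B y₀ Y₀ v α := by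
  -- In the ball of radius a around Y₀ the speed is at most (2‖Y₀‖ + 1)/2 ≤ a, so a solution cannot
  -- leave it before time 1.
  set a : ℝ≥0 := ‖Y₀‖₊ + 1 with ha
  have hP : IsPicardLindelof (fun t Y => B (y₀ + t • v) v Y) (tmin := 0) (tmax := 1)
      ⟨0, by simp⟩ Y₀ a 0 a 1 := by
    refine ⟨fun t ht => ?_, fun x _ => ?_, fun t ht x hx => ?_, ?_⟩
    · refine LipschitzWith.lipschitzOnWith ((B (y₀ + t • v) v).lipschitz.weaken ?_)
      rw [← NNReal.coe_le_coe]
      exact (h.norm_apply_le hv ht).trans (by norm_num)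
    · intro t ht
      have h1 : ContinuousAt B (y₀ + t • v) := (h.diff _ (h.mem_ball hv ht)).continuousAt
      have h2 : ContinuousAt (fun t : ℝ => B (y₀ + t • v)) t :=
        ContinuousAt.comp (f := fun t : ℝ => y₀ + t • v) h1 (by fun_prop)
      exact ((h2.clm_apply continuousAt_const).clm_apply continuousAt_const).continuousWithinAt
    · refine ((B (y₀ + t • v) v).le_opNorm x).trans ?_
      have h1 := h.norm_apply_le hv ht
      have h2 : ‖x‖ ≤ ‖Y₀‖ + (‖Y₀‖ + 1) := by
        have := mem_closedBall_iff_norm.mp hx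
        rw [ha] at this
        push_cast at this
        calc ‖x‖ = ‖Y₀ + (x - Y₀)‖ := by rw [add_sub_cancel]
          _ ≤ _ := (norm_add_le _ _).trans (by gcongr)
      rw [ha]
      push_cast
      calc _ ≤ 1 / 2 * (‖Y₀‖ + (‖Y₀‖ + 1)) := by gcongr
        _ ≤ _ := by linarith
    · simp
  obtain ⟨α, h0, hα⟩ := hP.exists_eq_forall_mem_Icc_hasDerivWithinAt₀
  exact ⟨α, h0, hα⟩

set_option maxHeartbeats 1000000 in
-- This quadratic estimate says that the radially constructed section is differentiable with
-- derivative B. Flatness enters because the variation of a radial solution is, to first order,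
-- parallel transport in the direction t k.
theorem norm_sub_le (h : ConnBound B y₀ r C)
    (hflat : ∀ x ∈ ball y₀ r, ∀ v w, fderiv ℝ B x v w + (B x w).comp (B x v)
      = fderiv ℝ B x w v + (B x v).comp (B x w)) {Y₀ : F} {v k : E} (hv : ‖v‖ < r)
    (hk : ‖v + k‖ < r) (hk1 : ‖k‖ ≤ 1) {α β : ℝ → F} (hα : IsRadial B y₀ Y₀ v α)
    (hβ : IsRadial B y₀ Y₀ (v + k) β) {m : ℝ} (hm : ∀ t ∈ Icc (0 : ℝ) 1, ‖α t‖ ≤ m) :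
    ‖β 1 - α 1 - B (y₀ + v) k (α 1)‖ ≤ 10 * C ^ 2 * m * ‖k‖ ^ 2 := by
  have hnh : ∀ t ∈ Ico (0 : ℝ) 1, Icc (0 : ℝ) 1 ∈ 𝓝[≥] t := fun t ht => Icc_mem_nhdsGE_of_mem ht
  have hIcc : ∀ t ∈ Ico (0 : ℝ) 1, t ∈ Icc (0 : ℝ) 1 := fun t ht => ⟨ht.1, ht.2.le⟩
  set γ : ℝ → E := fun t => y₀ + t • v with hγ
  -- The predicted neighbouring solution: α transported from the ray of v to the ray of v + k, whose
  -- distance at time t is t k. It is compared with β by Grönwall's inequality.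
  set w : ℝ → F := fun t => α t + t • B (γ t) k (α t) with hw
  set w' : ℝ → F := fun t => B (γ t) v (α t) + (t • (fderiv ℝ B (γ t) v k (α t)
    + B (γ t) k (B (γ t) v (α t))) + (1 : ℝ) • B (γ t) k (α t)) with hw'
  have hwd : ∀ t ∈ Icc (0 : ℝ) 1, HasDerivWithinAt w (w' t) (Icc 0 1) t := by
    intro t ht
    have hγd : HasDerivAt γ v t := by
      have := ((hasDerivAt_id t).smul_const v).const_add y₀
      rwa [one_smul] at this
    have h1 := (h.diff (γ t) (h.mem_ball hv ht)).hasFDerivAt.comp_hasDerivAt t hγd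
    have h2 : HasDerivWithinAt (fun t => B (γ t) k) (fderiv ℝ B (γ t) v k) (Icc 0 1) t := by
      simpa using (h1.clm_apply (hasDerivAt_const t k)).hasDerivWithinAt
    exact (hα.2 t ht).add ((hasDerivWithinAt_id t _).smul (h2.clm_apply (hα.2 t ht)))
  have hmm : 0 ≤ m := (norm_nonneg _).trans (hm 0 (by simp))
  have hC := h.one_le
  have hr1 := h.le_one
  have hvk : ‖v + k‖ ≤ 1 := hk.le.trans hr1
  -- The Grönwall lemma asks for a Lipschitz bound at all times, so time is clamped to the unit
  -- interval.
  set V : ℝ → F → F := fun t Y => B (y₀ + (projIcc (0 : ℝ) 1 zero_le_one t : ℝ) • (v + k)) (v + k) Y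
    with hV
  have hVt : ∀ t ∈ Ico (0 : ℝ) 1, V t = B (y₀ + t • (v + k)) (v + k) := fun t ht => by
    ext Y
    rw [hV]; dsimp only; rw [projIcc_of_mem _ (hIcc t ht)]
  have hest := dist_le_of_approx_trajectories_ODE (v := V) (K := 1) (f := β) (g := w) (δ := 0)
    (εf := 0) (εg := 5 * C ^ 2 * m * ‖k‖ ^ 2) (a := 0) (b := 1)
    (f' := fun t => B (y₀ + t • (v + k)) (v + k) (β t)) (g' := w')
    (fun t => (B _ (v + k)).lipschitz.weaken (by
      rw [← NNReal.coe_le_coe]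
      exact (h.norm_apply_le hk (projIcc (0 : ℝ) 1 zero_le_one t).2).trans (by norm_num)))
    (fun t ht => (hβ.2 t ht).continuousWithinAt)
    (fun t ht => (hβ.2 t (hIcc t ht)).mono_of_mem_nhdsWithin (hnh t ht))
    (fun t ht => by rw [hVt t ht, dist_self])
    (fun t ht => (hwd t ht).continuousWithinAt)
    (fun t ht => (hwd t (hIcc t ht)).mono_of_mem_nhdsWithin (hnh t ht))
    (fun t ht => ?_) (by rw [hβ.1, hw]; simp [hα.1]) 1 (by simp)
  · rw [gronwallBound_of_K_ne_0 (by simp)] at hest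
    -- The defect of w is at most 5 C² m ‖k‖²; the Grönwall factor e - 1 ≤ 2 turns 5 into 10.
    have he : Real.exp 1 - 1 ≤ 2 := by linarith [Real.exp_one_lt_d9]
    have hw1 : w 1 = α 1 + B (y₀ + v) k (α 1) := by simp [hw, hγ]
    rw [hw1, dist_eq_norm] at hest
    rw [sub_sub]
    refine hest.trans ?_
    simp only [zero_mul, zero_add, NNReal.coe_one, div_one, sub_zero, one_mul]
    have : 0 ≤ 5 * C ^ 2 * m * ‖k‖ ^ 2 := by positivity
    nlinarith
  · rw [hVt t ht, dist_eq_norm]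
    have ht' := hIcc t ht
    have hx : γ t ∈ ball y₀ r := h.mem_ball hv ht'
    have hβx : y₀ + t • (v + k) = γ t + t • k := by simp only [hγ, smul_add, add_assoc]
    have hx' : γ t + t • k ∈ ball y₀ r := hβx ▸ h.mem_ball hk ht'
    rw [hβx]
    set R := B (γ t + t • k) - B (γ t) - fderiv ℝ B (γ t) (t • k) with hR
    have hRn : ‖R‖ ≤ C * ‖k‖ ^ 2 := by
      refine (h.taylor _ _ hx hx').trans ?_
      rw [norm_smul, Real.norm_of_nonneg ht.1]
      have : t * ‖k‖ ≤ ‖k‖ := by nlinarith [norm_nonneg k, ht.2]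
      have := mul_nonneg ht.1 (norm_nonneg k)
      gcongr
    set x := γ t
    set Y := α t with hY
    have hYm : ‖Y‖ ≤ m := hm t ht'
    have hBx : B (x + t • k) = B x + t • fderiv ℝ B x k + R := by rw [hR, map_smul]; abel
    have hf := congrArg (fun L : F →L[ℝ] F => L Y) (hflat x hx v k)
    simp only [_root_.add_apply, ContinuousLinearMap.comp_apply] at hf
    set B' := fderiv ℝ B x
    have hw0 : w t = Y + t • B x k Y := rfl
    have hw1 : w' t = B x v Y + (t • (B' v k Y + B x k (B x v Y)) + (1 : ℝ) • B x k Y) := rfl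
    -- After flatness exchanges the two derivatives, all terms linear in k cancel. Five terms of
    -- second or higher order remain, each bounded by C² m ‖k‖².
    have key : w' t - B (x + t • k) (v + k) (w t) = -(t • B' k k Y + R (v + k) Y
        + t • B x k (B x k Y) + (t * t) • B' k (v + k) (B x k Y)
        + t • R (v + k) (B x k Y)) := by
      rw [hw0, hw1, hBx, hf]
      simp only [_root_.add_apply, _root_.smul_apply, map_add, map_smul]
      module
    rw [key, norm_neg]
    have hB : ‖B x k Y‖ ≤ C * ‖k‖ * m := by
      refine ((B x k).le_opNorm _).trans ?_
      gcongr
      exact ((B x).le_opNorm _).trans (by gcongr; exact h.norm_le x hx)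
    have n1 : ‖B' k k Y‖ ≤ C * ‖k‖ * ‖k‖ * m := by
      refine ((B' k k).le_opNorm _).trans ?_
      gcongr
      refine ((B' k).le_opNorm _).trans ?_
      gcongr
      exact (B'.le_opNorm _).trans (by gcongr; exact h.norm_fderiv_le x hx)
    have n2 : ∀ Z, ‖R (v + k) Z‖ ≤ C * ‖k‖ ^ 2 * ‖Z‖ := fun Z => by
      refine ((R (v + k)).le_opNorm _).trans ?_
      gcongr
      refine (R.le_opNorm _).trans ?_
      calc _ ≤ C * ‖k‖ ^ 2 * 1 := by gcongr
        _ = _ := mul_one _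
    have n3 : ‖B x k (B x k Y)‖ ≤ C * ‖k‖ * (C * ‖k‖ * m) := by
      refine ((B x k).le_opNorm _).trans ?_
      gcongr
      exact ((B x).le_opNorm _).trans (by gcongr; exact h.norm_le x hx)
    have n4 : ‖B' k (v + k) (B x k Y)‖ ≤ C * ‖k‖ * 1 * (C * ‖k‖ * m) := by
      refine ((B' k (v + k)).le_opNorm _).trans ?_
      gcongr
      refine ((B' k).le_opNorm _).trans ?_
      gcongr
      exact (B'.le_opNorm _).trans (by gcongr; exact h.norm_fderiv_le x hx)
    have hts : ∀ Z : F, ‖t • Z‖ ≤ ‖Z‖ := fun Z => by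
      rw [norm_smul, Real.norm_of_nonneg ht.1]
      nlinarith [norm_nonneg Z, ht.2]
    have htts : ∀ Z : F, ‖(t * t) • Z‖ ≤ ‖Z‖ := fun Z => by
      rw [mul_smul]; exact (hts _).trans (hts _)
    have b2 : C * ‖k‖ ^ 2 * ‖Y‖ ≤ C ^ 2 * m * ‖k‖ ^ 2 := by
      calc _ ≤ C * ‖k‖ ^ 2 * m := by gcongr
        _ ≤ (C * C) * ‖k‖ ^ 2 * m := by gcongr; nlinarith
        _ = _ := by ring
    have b1 : C * ‖k‖ * ‖k‖ * m ≤ C ^ 2 * m * ‖k‖ ^ 2 := by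
      calc _ = C * ‖k‖ ^ 2 * m := by ring
        _ ≤ (C * C) * ‖k‖ ^ 2 * m := by gcongr; nlinarith
        _ = _ := by ring
    have b5 : C * ‖k‖ ^ 2 * ‖B x k Y‖ ≤ C ^ 2 * m * ‖k‖ ^ 2 := by
      calc _ ≤ C * ‖k‖ ^ 2 * (C * 1 * m) := by
            gcongr; exact hB.trans (by gcongr)
        _ = _ := by ring
    calc _ ≤ ‖B' k k Y‖ + ‖R (v + k) Y‖ + ‖B x k (B x k Y)‖ + ‖B' k (v + k) (B x k Y)‖
          + ‖R (v + k) (B x k Y)‖ := by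
          refine (norm_add_le _ _).trans (add_le_add ?_ (hts _))
          refine (norm_add_le _ _).trans (add_le_add ?_ (htts _))
          refine (norm_add_le _ _).trans (add_le_add ?_ (hts _))
          exact (norm_add_le _ _).trans (add_le_add (hts _) le_rfl)
      _ ≤ _ := by
          have e1 := n2 Y
          have e2 := n2 (B x k Y)
          have e3 : C * ‖k‖ * (C * ‖k‖ * m) = C ^ 2 * m * ‖k‖ ^ 2 := by ring
          have e4 : C * ‖k‖ * 1 * (C * ‖k‖ * m) = C ^ 2 * m * ‖k‖ ^ 2 := by ring
          rw [e3] at n3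
          rw [e4] at n4
          linarith

/-- **Frobenius theorem** for linear systems: a flat connection has parallel sections. -/
theorem exists_parallel [CompleteSpace F] (h : ConnBound B y₀ r C)
    (hflat : ∀ x ∈ ball y₀ r, ∀ v w, fderiv ℝ B x v w + (B x w).comp (B x v)
      = fderiv ℝ B x w v + (B x v).comp (B x w)) (Y₀ : F) :
    ∃ Y : E → F, Y y₀ = Y₀ ∧ ∀ x ∈ ball y₀ r, HasFDerivAt Y ((B x).flip (Y x)) x := by
  have hex : ∀ v : E, ‖v‖ < r → ∃ α, IsRadial B y₀ Y₀ v α := fun v hv => h.exists_isRadial Y₀ hv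
  choose! α hα using hex
  -- The section at x is the time-one value of the solution along the segment from y₀ to x.
  refine ⟨fun x => α (x - y₀) 1, ?_, fun x hx => ?_⟩
  · have h0 := hα 0 (by simpa using h.pos)
    change α (y₀ - y₀) 1 = Y₀
    rw [sub_self]
    have hd : ∀ t ∈ Icc (0 : ℝ) 1, HasDerivWithinAt (α 0) 0 (Icc 0 1) t := fun t ht => by
      simpa using h0.2 t ht
    have := (convex_Icc (0 : ℝ) 1).is_const_of_fderivWithin_eq_zero (𝕜 := ℝ) (f := α 0)
      (fun t ht => (hd t ht).differentiableWithinAt) (fun t ht => by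
        rw [(hd t ht).hasFDerivWithinAt.fderivWithin (uniqueDiffOn_Icc zero_lt_one t ht)]
        ext; simp) (x := 1) (y := 0) (by simp) (by simp)
    rw [this, h0.1]
  · set v := x - y₀ with hv
    have hvr : ‖v‖ < r := mem_ball_iff_norm.mp hx
    have hc : ContinuousOn (α v) (Icc 0 1) := fun t ht => ((hα v hvr).2 t ht).continuousWithinAt
    obtain ⟨m, hm⟩ := isCompact_Icc.exists_bound_of_continuousOn hc
    have hyv : y₀ + v = x := by rw [hv]; abel
    rw [hasFDerivAt_iff_isLittleO_nhds_zero]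
    refine Asymptotics.IsBigO.trans_isLittleO (g := fun k : E => ‖k‖ ^ 2) ?_ ?_
    · refine Asymptotics.IsBigO.of_bound (10 * C ^ 2 * m) ?_
      have e1 : ∀ᶠ k : E in 𝓝 0, ‖v + k‖ < r :=
        ContinuousAt.eventually_lt (by fun_prop) continuousAt_const (by simpa using hvr)
      have e2 : ∀ᶠ k : E in 𝓝 0, ‖k‖ < 1 :=
        ContinuousAt.eventually_lt (by fun_prop) continuousAt_const (by simp)
      filter_upwards [e1, e2] with k hk hk1
      have := h.norm_sub_le hflat hvr hk hk1.le (hα v hvr) (hα (v + k) hk) hm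
      rw [norm_pow, norm_norm]
      have e : x + k - y₀ = v + k := by rw [hv]; abel
      rw [e, ContinuousLinearMap.flip_apply]
      rwa [hyv] at this
    · simpa using Asymptotics.isLittleO_norm_pow_id (E' := E) one_lt_two

/-- Bootstrapping: the equation expresses the derivative through the section itself, so each order
of smoothness yields the next. -/
theorem contDiffOn_parallel {U : Set E} (hU : IsOpen U) (hB : ContDiffOn ℝ ∞ B U) {Y : E → F}
    (hY : ∀ x ∈ U, HasFDerivAt Y ((B x).flip (Y x)) x) : ContDiffOn ℝ ∞ Y U := by
  rw [contDiffOn_infty]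
  intro n
  induction n with
  | zero =>
    rw [Nat.cast_zero, contDiffOn_zero]
    exact fun x hx => (hY x hx).continuousAt.continuousWithinAt
  | succ n ih =>
    rw [Nat.cast_succ, contDiffOn_succ_iff_fderiv_of_isOpen hU]
    refine ⟨fun x hx => (hY x hx).differentiableAt.differentiableWithinAt, by simp, ?_⟩
    refine ContDiffOn.congr (f := fun x => (B x).flip (Y x)) ?_ fun x hx => (hY x hx).fderiv
    have hBn : ContDiffOn ℝ n B U := hB.of_le (WithTop.coe_le_coe.mpr le_top)
    have hfl : ContDiffOn ℝ n (fun x => (B x).flip) U :=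
      (ContinuousLinearMap.flipₗᵢ ℝ E F F).toContinuousLinearEquiv.contDiff.comp_contDiffOn hBn
    exact hfl.clm_apply ih

end ConnBound

end Frobenius


/-! ### The Frobenius theorem in coordinates, for matrices of smooth functions. -/

section ParallelSections

open TopologicalSpace Matrix Finset SmoothFn Topology Filter Metric

set_option maxSynthPendingDepth 5

variable {κ : Type*} [Fintype κ] [DecidableEq κ] {V : Opens E4}

theorem fderiv_apply_eq_sum_pd (f : E4 → ℝ) (y v : E4) :
    fderiv ℝ f y v = ∑ a, v a * pd a f y := by
  conv_lhs => rw [← (EuclideanSpace.basisFun (Fin 4) ℝ).sum_repr v]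
  simp [pd]

/-- The elementary operator sending the `a`-th coordinate of the direction and the `j`-th component
of a section to the `i`-th component. -/
def elemConn (κ : Type*) [Fintype κ] [DecidableEq κ] (a : Fin 4) (i j : κ) :
    E4 →L[ℝ] (κ → ℝ) →L[ℝ] (κ → ℝ) :=
  (EuclideanSpace.proj (𝕜 := ℝ) a).smulRight
    ((ContinuousLinearMap.proj (R := ℝ) (φ := fun _ : κ => ℝ) j).smulRight (Pi.single i (1 : ℝ)))

/-- The connection form with given matrices. -/
def connForm (B : Fin 4 → Matrix κ κ (SmoothFn V)) (x : E4) : E4 →L[ℝ] (κ → ℝ) →L[ℝ] (κ → ℝ) :=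
  ∑ a, ∑ i, ∑ j, (B a i j).toFun x • elemConn κ a i j

theorem sum_elemConn_apply (c : Fin 4 → κ → κ → ℝ) (v : E4) (Y : κ → ℝ) (i : κ) :
    (∑ a, ∑ i, ∑ j, c a i j • elemConn κ a i j : E4 →L[ℝ] (κ → ℝ) →L[ℝ] (κ → ℝ)) v Y i
      = ∑ a, v a * ∑ j, c a i j * Y j := by
  simp only [elemConn, _root_.sum_apply, _root_.smul_apply, ContinuousLinearMap.smulRight_apply,
    Finset.sum_apply, Pi.smul_apply, smul_eq_mul, ContinuousLinearMap.proj_apply,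
    PiLp.proj_apply, Pi.single_apply, mul_ite, mul_one, mul_zero]
  refine Finset.sum_congr rfl fun a _ => ?_
  rw [Finset.sum_comm, Finset.mul_sum]
  refine Finset.sum_congr rfl fun j _ => ?_
  simp
  ring

theorem connForm_apply (B : Fin 4 → Matrix κ κ (SmoothFn V)) (x v : E4) (Y : κ → ℝ) (i : κ) :
    connForm B x v Y i = ∑ a, v a * ∑ j, (B a i j).toFun x * Y j :=
  sum_elemConn_apply (fun a i j => (B a i j).toFun x) v Y i

theorem contDiffOn_connForm (B : Fin 4 → Matrix κ κ (SmoothFn V)) :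
    ContDiffOn ℝ ∞ (connForm B) V :=
  ContDiffOn.sum fun a _ => ContDiffOn.sum fun i _ => ContDiffOn.sum fun j _ =>
    (B a i j).contDiffOn.smul contDiffOn_const

theorem fderiv_connForm_apply (B : Fin 4 → Matrix κ κ (SmoothFn V)) (x : V) (v w : E4)
    (Y : κ → ℝ) (i : κ) : fderiv ℝ (connForm B) x v w Y i
      = ∑ b, ∑ a, v b * w a * ∑ j, eval x (partialD b (B a i j)) * Y j := by
  have h : HasFDerivAt (connForm B) (∑ a, ∑ i, ∑ j, (fderiv ℝ (B a i j).toFun x).smulRight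
      (elemConn κ a i j)) x :=
    HasFDerivAt.fun_sum fun a _ => HasFDerivAt.fun_sum fun i _ => HasFDerivAt.fun_sum fun j _ =>
      ((B a i j).differentiableAt x).hasFDerivAt.smul_const _
  rw [h.fderiv]
  have e : (∑ a, ∑ i, ∑ j, (fderiv ℝ (B a i j).toFun x).smulRight (elemConn κ a i j)) v
      = ∑ a, ∑ i, ∑ j, (fderiv ℝ (B a i j).toFun x v) • elemConn κ a i j := by
    simp only [_root_.sum_apply, ContinuousLinearMap.smulRight_apply]
  rw [e, sum_elemConn_apply, Finset.sum_comm]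
  refine Finset.sum_congr rfl fun a _ => ?_
  simp only [fderiv_apply_eq_sum_pd, Finset.sum_mul, Finset.mul_sum]
  rw [Finset.sum_comm]
  refine Finset.sum_congr rfl fun b _ => Finset.sum_congr rfl fun j _ => ?_
  rw [eval_partialD]
  ring

/-- **Frobenius theorem**: a flat linear system has local solutions with prescribed initial
values. -/
theorem exists_parallel_sections {B : Fin 4 → Matrix κ κ (SmoothFn V)}
    (hflat : ∀ a b, (B b).map (partialD a) + B b * B a = (B a).map (partialD b) + B a * B b)
    {y₀ : E4} (hy₀ : y₀ ∈ V) :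
    ∃ r > 0, ball y₀ r ⊆ (V : Set E4) ∧ ∀ Y₀ : κ → ℝ, ∃ Y : E4 → κ → ℝ, Y y₀ = Y₀ ∧
      (∀ i, ContDiffOn ℝ ∞ (fun x => Y x i) (ball y₀ r)) ∧
      ∀ x ∈ ball y₀ r, ∀ a i, pd a (fun q => Y q i) x = ∑ j, (B a i j).toFun x * Y x j := by
  obtain ⟨r, C, hrV, hb⟩ := exists_connBound (V.isOpen.mem_nhds hy₀) (contDiffOn_connForm B)
  refine ⟨r, hb.pos, hrV, fun Y₀ => ?_⟩
  have hfl : ∀ x ∈ ball y₀ r, ∀ v w, fderiv ℝ (connForm B) x v w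
      + (connForm B x w).comp (connForm B x v) = fderiv ℝ (connForm B) x w v
      + (connForm B x v).comp (connForm B x w) := by
    intro x hx v w
    set z : V := ⟨x, hrV hx⟩
    have e : ∀ v w : E4, ∀ Y i, (fderiv ℝ (connForm B) x v w
        + (connForm B x w).comp (connForm B x v)) Y i
        = ∑ b, ∑ a, v b * w a * ∑ j, eval z (((B a).map (partialD b) + B a * B b) i j) * Y j := by
      intro v w Y i
      have e1 := fderiv_connForm_apply B z v w Y i
      have e2 : connForm B x w (connForm B x v Y) i
          = ∑ b, ∑ a, v b * w a * ∑ j, eval z ((B a * B b) i j) * Y j := by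
        rw [connForm_apply, Finset.sum_comm]
        refine Finset.sum_congr rfl fun a _ => ?_
        simp only [connForm_apply, Matrix.mul_apply, map_sum, map_mul, Finset.sum_mul,
          Finset.mul_sum]
        rw [Finset.sum_comm]
        refine Finset.sum_congr rfl fun b _ => ?_
        rw [Finset.sum_comm]
        refine Finset.sum_congr rfl fun j _ => Finset.sum_congr rfl fun k _ => ?_
        rw [toFun_of_mem _ (hrV hx), toFun_of_mem _ (hrV hx)]
        ring
      rw [_root_.add_apply, ContinuousLinearMap.comp_apply, Pi.add_apply, e2]
      refine (congrArg (· + _) e1).trans ?_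
      rw [← Finset.sum_add_distrib]
      refine Finset.sum_congr rfl fun b _ => ?_
      rw [← Finset.sum_add_distrib]
      refine Finset.sum_congr rfl fun a _ => ?_
      rw [← mul_add, ← Finset.sum_add_distrib]
      congr 1
      refine Finset.sum_congr rfl fun j _ => ?_
      rw [Matrix.add_apply, Matrix.map_apply, map_add, add_mul]
    ext Y i
    rw [e, e, Finset.sum_comm]
    refine Finset.sum_congr rfl fun a _ => Finset.sum_congr rfl fun b _ => ?_
    rw [hflat a b]
    ring
  obtain ⟨Y, hY0, hY⟩ := hb.exists_parallel hfl Y₀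
  have hs := ConnBound.contDiffOn_parallel isOpen_ball ((contDiffOn_connForm B).mono hrV) hY
  refine ⟨Y, hY0, fun i => (contDiffOn_pi.mp hs) i, fun x hx a i => ?_⟩
  have h1 : HasFDerivAt (fun q => Y q i) _ x := hasFDerivAt_pi'.mp (hY x hx) i
  rw [pd, h1.fderiv]
  change connForm B x (EuclideanSpace.single a 1) (Y x) i = _
  rw [connForm_apply, Finset.sum_eq_single a (fun b _ hb => by simp [hb]) (by simp)]
  simp

end ParallelSections


/-! ### Naturality under algebra homomorphisms commuting with the derivations. -/

section RingHoms

open Matrix Finset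

variable {ι : Type*} [Fintype ι] [DecidableEq ι] {R R' : Type*} [CommRing R] [Algebra ℝ R]
  [CommRing R'] [Algebra ℝ R'] {D : ι → Derivation ℝ R R} {D' : ι → Derivation ℝ R' R'}
  {G Gi : Matrix ι ι R} {Γ : ι → Matrix ι ι R} {n : ι → R} {H ψ : R} {p : R →ₐ[ℝ] R'}

theorem map_dotProduct_mulVec (p : R →ₐ[ℝ] R') (v w : ι → R) (M : Matrix ι ι R) :
    p (v ⬝ᵥ M *ᵥ w) = (fun a => p (v a)) ⬝ᵥ M.map p *ᵥ fun a => p (w a) := by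
  simp [dotProduct, Matrix.mulVec]

theorem IsUmbilic.map (hp : ∀ i f, D' i (p f) = p (D i f)) (hU : IsUmbilic D G Gi Γ n H) :
    IsUmbilic D' (G.map p) (Gi.map p) (fun a => (Γ a).map p) (fun a => p (n a)) (p H) := by
  refine ⟨?_, fun a => ?_⟩
  · rw [← map_dotProduct_mulVec, hU.unit, map_one]
  · ext b
    have := congrArg p (congrFun (hU.cov a) b)
    rw [covVec_apply] at this ⊢
    simp only [map_sub, map_sum, map_mul, Pi.smul_apply, Pi.sub_apply, smul_eq_mul] at this
    simp only [hp, Matrix.map_apply, Pi.smul_apply, Pi.sub_apply, smul_eq_mul]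
    exact this

theorem prolong_map (p : R →ₐ[ℝ] R') (a : ι) :
    (prolong G Gi Γ n H ψ a).map p = prolong (G.map p) (Gi.map p) (fun a => (Γ a).map p)
      (fun a => p (n a)) (p H) (p ψ) a := by
  have h1 : ∀ i j, p ((1 : Matrix ι ι R) i j) = (1 : Matrix ι ι R') i j := fun i j => by
    rw [Matrix.one_apply, Matrix.one_apply]; split_ifs <;> simp
  have h2 : ∀ d, p ((Gi *ᵥ n) d) = (Gi.map p *ᵥ fun a => p (n a)) d := fun d => by
    simp [Matrix.mulVec, dotProduct]
  ext (_ | b) (_ | d) <;> simp [prolong, h1, h2]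

theorem chr_map (hp : ∀ i f, D' i (p f) = p (D i f)) (i : ι) :
    (chr D G Gi i).map p = chr D' (G.map p) (Gi.map p) i := by
  ext k j
  simp [chr, hp]

end RingHoms

/-! ### The distance function z and linear coordinates on the leaves. -/

section Leaves

open TopologicalSpace Matrix Finset SmoothFn Topology Filter Metric

variable {G : E4 → Matrix (Fin 4) (Fin 4) ℝ} {U V W : Opens E4}

namespace SmoothFn

/-- Restriction to a smaller open set. -/
def res (hW : W ≤ V) : SmoothFn V →ₐ[ℝ] SmoothFn W := pullback id contDiffOn_id hW

theorem eval_res (hW : W ≤ V) (f : SmoothFn V) (y : W) :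
    eval y (res hW f) = eval ⟨y, hW y.2⟩ f :=
  eval_pullback _ _ _ _

theorem partialD_res (hW : W ≤ V) (i : Fin 4) (f : SmoothFn V) :
    partialD i (res hW f) = res hW (partialD i f) := by
  ext y
  rw [eval_res, eval_partialD_eq (F := f.toFun) fun y => by rw [eval_res, toFun_of_mem]]
  rfl

theorem eq_algebraMap_of_partialD_eq_zero (hV : IsPreconnected (V : Set E4))
    {f : SmoothFn V} (hf : ∀ a, partialD a f = 0) {y₀ : V} {c : ℝ} (hc : eval y₀ f = c) :
    f = algebraMap ℝ _ c := by
  ext y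
  rw [AlgHom.commutes, eval_eq_of_partialD_eq_zero hV hf y y₀, hc]
  rfl

/-- The differential of a function. -/
def grad (f : SmoothFn U) : Fin 4 → SmoothFn U := fun a => partialD a f

end SmoothFn

namespace IsMetricOn

theorem mat_mono (h : IsMetricOn G V) (hW : W ≤ V) : (h.mono hW).mat = h.mat.map (res hW) := by
  ext i j y
  rw [Matrix.map_apply, eval_res]
  rfl

theorem inv_mono (h : IsMetricOn G V) (hW : W ≤ V) : (h.mono hW).inv = h.inv.map (res hW) := by
  refine Matrix.inv_eq_right_inv ?_
  rw [h.mat_mono hW, ← Matrix.map_mul, h.mul_inv]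
  exact Matrix.map_one _ (map_zero _) (map_one _)

theorem conn_mono (h : IsMetricOn G V) (hW : W ≤ V) :
    (h.mono hW).conn = fun a => (h.conn a).map (res hW) := by
  ext1 a
  rw [conn, conn, chr_map (partialD_res hW), ← h.mat_mono hW, ← h.inv_mono hW]

theorem eval_inner (h : IsMetricOn G V) (v w : Fin 4 → SmoothFn V) (y : V) :
    eval y (v ⬝ᵥ h.inv *ᵥ w)
      = (fun a => eval y (v a)) ⬝ᵥ (G y)⁻¹ *ᵥ fun a => eval y (w a) := by
  rw [map_dotProduct_mulVec, h.map_inv]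

end IsMetricOn

/-- The functions `z` and `f`, of which `z` is the distance from a leaf, and the functions `f` are
restrictions of linear coordinates when the leaves are realized as quadrics. -/
structure LeafCoordinates (h : IsMetricOn G U) (k : ℝ) (A H z : SmoothFn U)
    (f : Fin 3 → SmoothFn U) : Prop where
  pos : ∀ y, 0 < eval y A
  deriv_A : ∀ a, partialD a A = H * A * partialD a z
  inner_zz : grad z ⬝ᵥ h.inv *ᵥ grad z = 1
  inner_fz : ∀ i, grad (f i) ⬝ᵥ h.inv *ᵥ grad z = 0
  inner_ff : ∀ i j, A * A * (grad (f i) ⬝ᵥ h.inv *ᵥ grad (f j))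
    + algebraMap ℝ _ k * (f i * f j) = algebraMap ℝ _ (eta i.castSucc j.castSucc)
  small : ∀ y, 0 < 1 - k * ∑ i : Fin 3, eta i.castSucc i.castSucc * eval y (f i) ^ 2

namespace IsWarpedNormal

variable {n : Fin 4 → SmoothFn V} {A H H' ψ : SmoothFn V} {h : IsMetricOn G V}

theorem exists_distance (hw : IsWarpedNormal h n A H H' ψ) {y₀ : E4} (hy₀ : y₀ ∈ V) :
    ∃ r > 0, ball y₀ r ⊆ (V : Set E4) ∧ ∃ z : E4 → ℝ, ContDiffOn ℝ ∞ z (ball y₀ r) ∧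
      ∀ x ∈ ball y₀ r, ∀ a, pd a z x = (n a).toFun x := by
  -- Solving dz = n as a linear system: parallel sections are pairs (z, c) with dz = c n and dc = 0,
  -- taken with c = 1. Flatness is closedness of n.
  set B : Fin 4 → Matrix (Fin 2) (Fin 2) (SmoothFn V) := fun a => !![0, n a; 0, 0] with hB
  obtain ⟨r, hr, hrV, hs⟩ := exists_parallel_sections (B := B) (fun a b => by
    ext i j : 2
    have := hw.umbilic.derivation_apply_comm h.isLeviCivita a b
    fin_cases i <;> fin_cases j <;> simp [hB, this]) hy₀
  obtain ⟨Y, hY0, hYs, hY⟩ := hs ![0, 1]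
  have hz : ∀ x : V, (0 : SmoothFn V).toFun x = 0 := fun x => by rw [toFun_apply, map_zero]
  have h1 : ∀ x ∈ ball y₀ r, Y x 1 = 1 := by
    intro x hx
    have h0 := isOpen_ball.is_const_of_fderiv_eq_zero (𝕜 := ℝ) (f := fun q => Y q 1)
      (convex_ball y₀ r).isPreconnected
      ((hYs 1).differentiableOn (by simp)) (fun x hx => fderiv_eq_zero_of_pd fun a => by
        rw [hY x hx]
        simp [hB, hz ⟨x, hrV hx⟩, Fin.sum_univ_two]) hx (mem_ball_self hr)
    rw [h0, hY0]
    simp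
  refine ⟨r, hr, hrV, fun q => Y q 0, hYs 0, fun x hx a => ?_⟩
  rw [hY x hx, Fin.sum_univ_two, h1 x hx]
  simp [hB, hz ⟨x, hrV hx⟩]

/-- The three parallel sections start at f = 0 with differentials tangent to the leaf and
orthonormal after rescaling by A. Both the normal component of w and A²⟨w, w'⟩ + k f f' are constant
along parallel sections, so their initial values persist. -/
theorem exists_leafCoordinates (hw : IsWarpedNormal h n A H H' ψ) {hS : ∀ y ∈ V, SegreAt G y}
    (hn : h.IsNormal hS n) {k : ℝ} (hk : ∀ y ∈ V, leafCurvature G y = k) {y₀ : E4} (hy₀ : y₀ ∈ V) :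
    ∃ (W : Opens E4) (hW : W ≤ V), y₀ ∈ W ∧ ∃ A' H' z f,
      LeafCoordinates (h.mono hW) k A' H' z f := by
  obtain ⟨r₁, hr₁, hrV₁, z, hzs, hz⟩ := hw.exists_distance hy₀
  obtain ⟨r₂, hr₂, hrV₂, hs⟩ := exists_parallel_sections (κ := Option (Fin 4))
    (B := prolong h.mat h.inv h.conn n H ψ)
    (fun a b => hw.umbilic.prolong_flat h.isLeviCivita h.mul_inv hw.deriv_H hw.deriv_psi
      hw.curvature a b) hy₀
  obtain ⟨F, c, hF, hF3⟩ := hn.exists_frame ⟨y₀, hy₀⟩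
  set α := eval ⟨y₀, hy₀⟩ A with hα
  have hα0 : α ≠ 0 := (hw.pos _).ne'
  -- Lowered tangent frame vectors, divided by A(y₀) so that A²⟨w i, w j⟩ starts as η.
  set w₀ : Fin 3 → Fin 4 → ℝ := fun i => α⁻¹ • (G y₀ *ᵥ F.col i.castSucc) with hw₀
  choose Y hY0 hYs hY using fun i => hs (fun x => x.elim 0 (w₀ i))
  have hcont : ContinuousAt (fun x => 1 - k * ∑ i : Fin 3,
      eta i.castSucc i.castSucc * Y i x none ^ 2) y₀ := by
    have : ∀ i, ContinuousAt (fun x => Y i x none) y₀ := fun i =>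
      ((hYs i none).continuousOn).continuousAt (ball_mem_nhds y₀ hr₂)
    fun_prop
  -- All f vanish at y₀, so the quantity whose square root defines the last quadric coordinate is
  -- near 1.
  have hpos : ∀ᶠ x in 𝓝 y₀, 0 < 1 - k * ∑ i : Fin 3, eta i.castSucc i.castSucc * Y i x none ^ 2 :=
    continuousAt_const.eventually_lt hcont (by simp [hY0])
  obtain ⟨r₃, hr₃, hrp⟩ := Metric.eventually_nhds_iff_ball.mp hpos
  set r := min r₁ (min r₂ r₃)
  have hr : 0 < r := lt_min hr₁ (lt_min hr₂ hr₃)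
  set W : Opens E4 := ⟨ball y₀ r, isOpen_ball⟩
  have hW₁ : (W : Set E4) ⊆ ball y₀ r₁ := ball_subset_ball (min_le_left _ _)
  have hW₂ : (W : Set E4) ⊆ ball y₀ r₂ :=
    ball_subset_ball ((min_le_right _ _).trans (min_le_left _ _))
  have hW₃ : (W : Set E4) ⊆ ball y₀ r₃ :=
    ball_subset_ball ((min_le_right _ _).trans (min_le_right _ _))
  have hW : W ≤ V := fun x hx => hrV₁ (hW₁ hx)
  have hy₀W : y₀ ∈ W := mem_ball_self hr
  have hWc : IsPreconnected (W : Set E4) := (convex_ball y₀ r).isPreconnected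
  set p := res hW with hp
  have hpD : ∀ i f, partialD i (p f) = p (partialD i f) := partialD_res hW
  set Z : SmoothFn W := SmoothFn.mk z (hzs.mono hW₁)
  set f : Fin 3 → SmoothFn W := fun i =>
    SmoothFn.mk (fun x => Y i x none) ((hYs i none).mono hW₂) with hf
  set w : Fin 3 → Fin 4 → SmoothFn W := fun i b =>
    SmoothFn.mk (fun x => Y i x (some b)) ((hYs i (some b)).mono hW₂) with hwd
  set hm := h.mono hW
  have hmat : hm.mat = h.mat.map p := h.mat_mono hW
  have hinv : hm.inv = h.inv.map p := h.inv_mono hW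
  have hconn : hm.conn = fun a => (h.conn a).map p := h.conn_mono hW
  have hU : IsUmbilic partialD hm.mat hm.inv hm.conn (fun a => p (n a)) (p H) := by
    rw [hmat, hinv, hconn]; exact hw.umbilic.map hpD
  have hA : ∀ a, partialD a (p A) = p H * p A * p (n a) := fun a => by
    rw [hpD, hw.deriv_A, map_mul, map_mul]
  have hψ : ∀ a, partialD a (p ψ) = -2 * p H * p ψ * p (n a) := fun a => by
    rw [hpD, hw.deriv_psi, map_mul, map_mul, map_mul, map_neg, map_ofNat]
  have hZ : ∀ a, partialD a Z = p (n a) := fun a => by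
    ext y
    rw [partialD_mk, eval_mk, hz y (hW₁ y.2), eval_res, toFun_of_mem _ (hW y.2)]
  have hpar : ∀ i, IsUmbilic.IsParallel partialD hm.mat hm.inv hm.conn (fun a => p (n a)) (p H)
      (p ψ) (f i) (w i) := by
    intro i a x
    have e : ∀ x, optionElim (f i) (w i) x = SmoothFn.mk (fun q => Y i q x) ((hYs i x).mono hW₂) :=
      fun x => by cases x <;> rfl
    rw [hmat, hinv, hconn, ← prolong_map]
    ext y
    rw [e, partialD_mk, eval_mk, hY i y (hW₂ y.2)]
    simp only [Matrix.mulVec, dotProduct, map_sum, map_mul, Matrix.map_apply, e, eval_mk]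
    refine Finset.sum_congr rfl fun j _ => ?_
    rw [eval_res, toFun_of_mem _ (hW y.2)]
  have ef : ∀ i, eval ⟨y₀, hy₀W⟩ (f i) = 0 := fun i => by rw [hf, eval_mk, hY0]; rfl
  have ew : ∀ i, (fun b => eval ⟨y₀, hy₀W⟩ (w i b)) = w₀ i := fun i => by
    ext b; rw [hwd]; dsimp only; rw [eval_mk, hY0]; rfl
  have en : ∀ b, eval ⟨y₀, hy₀W⟩ (p (n b)) = eval ⟨y₀, hy₀⟩ (n b) := fun b => eval_res _ _ _
  have hGd := h.det y₀ hy₀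
  have hGs := h.symm y₀ hy₀
  have hη : ∀ a b, F.col a ⬝ᵥ G y₀ *ᵥ F.col b = eta a b := fun a b => by
    rw [← hF, Matrix.mul_assoc]; rfl
  have hGG : ∀ v, (G y₀)⁻¹ *ᵥ (G y₀ *ᵥ v) = v := fun v => by
    rw [Matrix.mulVec_mulVec, Matrix.nonsing_inv_mul _ hGd.isUnit, Matrix.one_mulVec]
  have hGc : ∀ v w, (G y₀ *ᵥ v) ⬝ᵥ w = v ⬝ᵥ G y₀ *ᵥ w := fun v w => by
    rw [Matrix.dotProduct_mulVec, ← Matrix.mulVec_transpose, hGs]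
  have hwn : ∀ i, w i ⬝ᵥ hm.inv *ᵥ (fun a => p (n a)) = 0 := by
    intro i
    have e := SmoothFn.eq_algebraMap_of_partialD_eq_zero hWc (y₀ := ⟨y₀, hy₀W⟩) (c := 0)
      (hU.derivation_inner_normal hm.isLeviCivita hm.mul_inv (hpar i)) ?_
    · rw [e, map_zero]
    · rw [hm.eval_inner, ew]
      simp only [en]
      have hc : c ≠ 0 := fun h0 => by
        have := hη 3 3
        rw [hF3, h0, zero_smul, zero_dotProduct] at this
        simp [eta] at this
      have e1 := hη i.castSucc 3
      rw [← hGc, hF3, dotProduct_smul] at e1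
      have e2 : eta i.castSucc 3 = 0 := by fin_cases i <;> simp [eta]
      rw [e2] at e1
      rw [hw₀]
      dsimp only
      rw [smul_dotProduct, (smul_eq_zero.mp e1).resolve_left hc, smul_zero]
  have hfw : ∀ i, grad (f i) = w i := fun i => by
    ext1 a
    rw [grad, (hpar i).derivation, hwn, zero_mul, sub_zero]
  have hkA : p A * p A * p ψ = algebraMap ℝ _ k := by
    rw [← map_mul, ← map_mul]
    ext y
    rw [eval_res, hw.leaf, AlgHom.commutes]
    exact hk y (hW y.2)
  refine ⟨W, hW, hy₀W, p A, p H, Z, f, fun y => ?_, fun a => ?_, ?_, fun i => ?_, fun i j => ?_,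
    fun y => hrp y (hW₃ y.2)⟩
  · rw [eval_res]; exact hw.pos _
  · rw [hA, hZ]
  · have : grad Z = fun a => p (n a) := funext hZ
    rw [this]; exact hU.unit
  · have : grad Z = fun a => p (n a) := funext hZ
    rw [this, hfw, hwn]
  · rw [hfw, hfw]
    have e := SmoothFn.eq_algebraMap_of_partialD_eq_zero hWc (y₀ := ⟨y₀, hy₀W⟩)
      (c := eta i.castSucc j.castSucc) (IsUmbilic.derivation_inner_add hm.isLeviCivita hm.mul_inv hA
        hψ (hpar i) (hpar j) (hwn i) (hwn j)) ?_
    · rw [← hkA]; exact e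
    · rw [map_add, map_mul, map_mul, map_mul _ _ (f i * f j), map_mul _ (f i), ef, zero_mul,
        mul_zero, add_zero, hm.eval_inner, ew, ew, hw₀]
      dsimp only
      have eA : eval ⟨y₀, hy₀W⟩ (p A) = α := eval_res _ _ _
      rw [eA, Matrix.mulVec_smul, hGG, smul_dotProduct, dotProduct_smul, hGc, hη]
      simp only [smul_eq_mul]
      field_simp

end IsWarpedNormal

end Leaves


/-! ### Stereographic projection of the leaves. -/

section Stereographic

open TopologicalSpace Matrix Finset SmoothFn

/-- The Gram matrix of the differentials `x i` of stereographic coordinates `X i = f i / u` on a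
quadric, where `W i` are the differentials of linear coordinates `f i`, and `dr` is that of the
remaining linear coordinate `r = 2 u - 1`. -/
theorem stereographic_gram {ι E : Type*} [Fintype ι] [DecidableEq ι] [AddCommGroup E] [Module ℝ E]
    {B : LinearMap.BilinForm ℝ E} (hB : ∀ v w, B v w = B w v) {ε X : ι → ℝ}
    (hε : ∀ i, ε i * ε i = 1) {W x : ι → E} {dr : E} {α k r u : ℝ} (hr : r ≠ 0) (hu : r = 2 * u - 1)
    (hW : ∀ i, W i = u • x i + (X i / 2) • dr)
    (hdr : r • dr = (-k) • ∑ l, (ε l * (u * X l)) • W l)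
    (hr2 : r * r = 1 - k * ∑ l, ε l * (u * X l) ^ 2)
    (hWW : ∀ i j, α * α * B (W i) (W j) + k * ((u * X i) * (u * X j)) = diagonal ε i j) (i j : ι) :
    α * α * u * u * B (x i) (x j) = diagonal ε i j := by
  have h1 : ∀ v, r * B dr v = -k * ∑ l, ε l * (u * X l) * B (W l) v := fun v => by
    have := congrArg (fun w => B w v) hdr
    simpa using this
  -- Differentiating the quadric equation determines only r dr, so each inner product with dr is
  -- computed after multiplication by r and then r is cancelled.
  have h2 : ∀ j, α * α * B dr (W j) = -k * (u * X j) * r := by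
    intro j
    refine mul_left_cancel₀ hr ?_
    have e : ∑ l, ε l * (u * X l) * (α * α * B (W l) (W j)) = u * X j * (r * r) := by
      have e1 : ∀ l, ε l * (u * X l) * (α * α * B (W l) (W j))
          = ε l * (u * X l) * diagonal ε l j - k * (u * X j) * (ε l * (u * X l) ^ 2) := fun l => by
        linear_combination ε l * (u * X l) * hWW l j
      rw [Finset.sum_congr rfl fun l _ => e1 l, Finset.sum_sub_distrib, ← Finset.mul_sum, hr2]
      simp only [diagonal_apply, mul_ite, mul_zero, Finset.sum_ite_eq', Finset.mem_univ, if_true]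
      linear_combination (u * X j) * hε j
    have e2 : ∑ l, ε l * (u * X l) * (α * α * B (W l) (W j))
        = α * α * ∑ l, ε l * (u * X l) * B (W l) (W j) := by
      rw [Finset.mul_sum]; exact Finset.sum_congr rfl fun l _ => by ring
    rw [e2] at e
    linear_combination α * α * h1 (W j) - k * e
  have h3 : α * α * B dr dr = k * (1 - r * r) := by
    refine mul_left_cancel₀ hr ?_
    have e : α * α * ∑ l, ε l * (u * X l) * B (W l) dr
        = -k * r * ∑ l, ε l * (u * X l) ^ 2 := by
      rw [Finset.mul_sum, Finset.mul_sum]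
      exact Finset.sum_congr rfl fun l _ => by
        rw [hB]; linear_combination ε l * (u * X l) * h2 l
    linear_combination α * α * h1 dr - k * e + k * r * hr2
  have h4 : ∀ i, u • x i = W i - (X i / 2) • dr := fun i => by rw [hW, add_sub_cancel_right]
  have h5 : u * (u * B (x i) (x j)) = B (u • x i) (u • x j) := by simp
  have h6 : u * (u * B (x i) (x j)) = B (W i) (W j) - X j / 2 * B dr (W i) - X i / 2 * B dr (W j)
      + X i / 2 * (X j / 2) * B dr dr := by
    rw [h5, h4, h4, hB dr (W i)]
    simp only [map_sub, map_smul, LinearMap.sub_apply, LinearMap.smul_apply, smul_eq_mul]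
    ring
  have h7 : α * α * u * u * B (x i) (x j) = α * α * (u * (u * B (x i) (x j))) := by ring
  rw [h7, h6]
  subst hu
  linear_combination hWW i j - X j / 2 * h2 i - X i / 2 * h2 j + X i / 2 * (X j / 2) * h3

variable {G : E4 → Matrix (Fin 4) (Fin 4) ℝ} {U : Opens E4}

theorem SmoothFn.exists_sqrt {f : SmoothFn U} (hf : ∀ y, 0 < eval y f) :
    ∃ r : SmoothFn U, (∀ y, 0 < eval y r) ∧ r * r = f := by
  have h0 : ∀ y ∈ U, 0 < f.toFun y := fun y hy => by rw [toFun_of_mem f hy]; exact hf _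
  refine ⟨SmoothFn.mk (fun y => √(f.toFun y)) (f.contDiffOn.sqrt fun y hy => (h0 y hy).ne'),
    fun y => ?_, ?_⟩
  · rw [eval_mk]; exact Real.sqrt_pos.mpr (h0 y y.2)
  · ext y
    rw [map_mul, eval_mk, Real.mul_self_sqrt (h0 y y.2).le, toFun_apply]

theorem IsMetricOn.inner_comm (h : IsMetricOn G U) (y : U) (v w : Fin 4 → ℝ) :
    v ⬝ᵥ (G y)⁻¹ *ᵥ w = w ⬝ᵥ (G y)⁻¹ *ᵥ v := by
  rw [Matrix.dotProduct_mulVec, ← Matrix.mulVec_transpose, Matrix.transpose_nonsing_inv,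
    h.symm y y.2, dotProduct_comm]

theorem eta_castSucc (i j : Fin 3) : eta i.castSucc j.castSucc
    = diagonal (fun i : Fin 3 => eta i.castSucc i.castSucc) i j := by
  fin_cases i <;> fin_cases j <;> simp [eta]

/-- With r = √(1 - k Σ ε f²), u = (1 + r)/2 and X = f/u, squaring r = 2u - 1 and dividing by u gives
u (1 + (k/4) Σ ε X²) = 1. There is no division by k, so all signs of k are treated together; for k =
0 one has X = f. -/
theorem LeafCoordinates.exists_stereographic {h : IsMetricOn G U} {k : ℝ} {A H z : SmoothFn U}
    {f : Fin 3 → SmoothFn U} (hl : LeafCoordinates h k A H z f) :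
    ∃ (u : SmoothFn U) (X : Fin 3 → SmoothFn U), (∀ y, 0 < eval y u) ∧
      (∀ y, eval y u * (1 + k / 4 * ∑ i, eta i.castSucc i.castSucc * eval y (X i) ^ 2) = 1) ∧
      (∀ i, grad (X i) ⬝ᵥ h.inv *ᵥ grad z = 0) ∧
      ∀ i j, A * A * u * u * (grad (X i) ⬝ᵥ h.inv *ᵥ grad (X j))
        = algebraMap ℝ _ (eta i.castSucc j.castSucc) := by
  set ε : Fin 3 → ℝ := fun i => eta i.castSucc i.castSucc with hε
  have hε1 : ∀ i, ε i * ε i = 1 := fun i => by fin_cases i <;> simp [hε, eta]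
  obtain ⟨r, hr, hrr⟩ := SmoothFn.exists_sqrt (f := 1 - k • ∑ i, ε i • (f i * f i)) fun y => by
    have := hl.small y
    simpa [sq] using this
  have hr2 : ∀ y, eval y r * eval y r = 1 - k * ∑ i, ε i * eval y (f i) ^ 2 := fun y => by
    rw [← map_mul, hrr]; simp [sq]
  set u : SmoothFn U := (1 / 2 : ℝ) • (1 + r) with hu
  have eu : ∀ y, eval y u = (1 + eval y r) / 2 := fun y => by
    rw [hu]; simp; ring
  have hu0 : ∀ y, 0 < eval y u := fun y => by rw [eu]; have := hr y; positivity
  obtain ⟨v, hv⟩ := (isUnit_of_forall_ne_zero fun y => (hu0 y).ne').exists_right_inv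
  set X : Fin 3 → SmoothFn U := fun i => v * f i with hX
  have hf : ∀ i, f i = u * X i := fun i => by rw [hX]; dsimp only; rw [← mul_assoc, hv, one_mul]
  have ef : ∀ y i, eval y (f i) = eval y u * eval y (X i) := fun y i => by rw [hf i, map_mul]
  have hWg : ∀ y i, (fun a => eval y (grad (f i) a)) = eval y u • (fun a => eval y (grad (X i) a))
      + (eval y (X i) / 2) • fun a => eval y (grad r a) := by
    intro y i
    ext a
    have : grad (f i) a = u * grad (X i) a + X i * ((1 / 2 : ℝ) • grad r a) := by
      simp only [grad]
      rw [hf i, Derivation.leibniz, hu, Derivation.map_smul, map_add, Derivation.map_one_eq_zero, zero_add]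
      rfl
    rw [this]
    simp only [map_add, map_mul, map_smul, Pi.add_apply, Pi.smul_apply, smul_eq_mul]
    ring
  have hdr : ∀ y, eval y r • (fun a => eval y (grad r a))
      = (-k) • ∑ l, (ε l * eval y (f l)) • fun a => eval y (grad (f l) a) := by
    intro y
    ext a
    have := congrArg (fun q => eval y (partialD a q)) hrr
    simp only [Derivation.leibniz, map_sub, Derivation.map_smul, map_smul, map_sum, Derivation.map_one_eq_zero,
      map_add, map_zero, smul_eq_mul, map_mul] at this
    simp only [Pi.smul_apply, Finset.sum_apply, smul_eq_mul, grad]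
    have e : ∑ l, ε l * (eval y (f l) * eval y (partialD a (f l))
        + eval y (f l) * eval y (partialD a (f l)))
        = 2 * ∑ l, ε l * eval y (f l) * eval y (partialD a (f l)) := by
      rw [Finset.mul_sum]; exact Finset.sum_congr rfl fun l _ => by ring
    rw [e] at this
    linear_combination this / 2
  have hfz : ∀ y i, (fun a => eval y (grad (f i) a)) ⬝ᵥ (G y)⁻¹ *ᵥ (fun a => eval y (grad z a))
      = 0 := fun y i => by rw [← h.eval_inner, hl.inner_fz, map_zero]
  have hrz : ∀ y, (fun a => eval y (grad r a)) ⬝ᵥ (G y)⁻¹ *ᵥ (fun a => eval y (grad z a)) = 0 := by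
    intro y
    have := congrArg (· ⬝ᵥ (G y)⁻¹ *ᵥ (fun a => eval y (grad z a))) (hdr y)
    simp only [smul_dotProduct, sum_dotProduct, hfz, smul_zero, Finset.sum_const_zero] at this
    exact (smul_eq_zero.mp this).resolve_left (hr y).ne'
  refine ⟨u, X, hu0, fun y => ?_, fun i => ?_, fun i j => ?_⟩
  · have e : ∑ i, ε i * eval y (f i) ^ 2 = eval y u ^ 2 * ∑ i, ε i * eval y (X i) ^ 2 := by
      rw [Finset.mul_sum]; exact Finset.sum_congr rfl fun l _ => by rw [ef]; ring
    have e2 := hr2 y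
    rw [e] at e2
    have e3 : eval y r = 2 * eval y u - 1 := by rw [eu]; ring
    rw [e3] at e2
    refine mul_left_cancel₀ (hu0 y).ne' ?_
    linear_combination e2 / 4
  · ext y
    rw [h.eval_inner, map_zero]
    have := hfz y i
    rw [hWg, add_dotProduct, smul_dotProduct, smul_dotProduct, hrz, smul_zero, add_zero] at this
    exact (smul_eq_zero.mp this).resolve_left (hu0 y).ne'
  · ext y
    have := stereographic_gram (B := Matrix.toBilin' (G y)⁻¹) (ε := ε) (α := eval y A) (k := k)
      (X := fun i => eval y (X i)) (u := eval y u)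
      (fun v w => by rw [toBilin'_apply', toBilin'_apply', h.inner_comm]) hε1 (hr y).ne'
      (by rw [eu]; ring) (hWg y) (by simpa only [ef] using hdr y) (by simpa only [ef] using hr2 y)
      (fun i j => by
        have := congrArg (eval y) (hl.inner_ff i j)
        rw [map_add, map_mul, map_mul, h.eval_inner, map_mul, map_mul, AlgHom.commutes,
          AlgHom.commutes, eta_castSucc, ef, ef] at this
        rw [toBilin'_apply']
        exact this) i j
    rw [toBilin'_apply'] at this
    rw [AlgHom.commutes, map_mul, h.eval_inner, map_mul, map_mul, map_mul, this, eta_castSucc]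
    rfl

end Stereographic


/-! ### Charts from functions with invertible Jacobian. -/

section NewCharts

open TopologicalSpace Matrix Finset SmoothFn Topology Filter Metric Set

variable {M : Type*} [TopologicalSpace M] [ChartedSpace E4 M] [IsManifold (𝓡 4) ∞ M]
  {U V W : Opens E4}

theorem exists_fderiv_equiv {φ : E4 → E4} (hφ : ContDiffOn ℝ ∞ φ U) {y : E4} (hy : y ∈ U)
    (hJ : IsUnit ((jacobian φ hφ).map (eval ⟨y, hy⟩))) :
    ∃ f' : E4 ≃L[ℝ] E4, HasFDerivAt φ (f' : E4 →L[ℝ] E4) y := by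
  have hd : DifferentiableAt ℝ φ y :=
    (hφ.contDiffAt (U.isOpen.mem_nhds hy)).differentiableAt (by simp)
  have hdet : (fderiv ℝ φ y).det ≠ 0 := by
    have hm : LinearMap.toMatrix (EuclideanSpace.basisFun (Fin 4) ℝ).toBasis
        (EuclideanSpace.basisFun (Fin 4) ℝ).toBasis (fderiv ℝ φ y : E4 →ₗ[ℝ] E4)
        = (jacobian φ hφ).map (eval ⟨y, hy⟩) := by
      ext i j
      rw [LinearMap.toMatrix_apply, Matrix.map_apply, eval_jacobian]
      simp
    rw [ContinuousLinearMap.det, ← LinearMap.det_toMatrix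
      (EuclideanSpace.basisFun (Fin 4) ℝ).toBasis, hm]
    exact ((Matrix.isUnit_iff_isUnit_det _).mp hJ).ne_zero
  refine ⟨(fderiv ℝ φ y).toContinuousLinearEquivOfDetNeZero hdet, ?_⟩
  rw [ContinuousLinearMap.coe_toContinuousLinearEquivOfDetNeZero]
  exact hd.hasFDerivAt

/-- A map with invertible Jacobian matrix gives new local coordinates, with values in a ball. -/
theorem exists_chart_of_jacobian {e : OpenPartialHomeomorph M E4}
    (he : e ∈ IsManifold.maximalAtlas (𝓡 4) ∞ M) {p : M} (hp : p ∈ e.source) {φ : E4 → E4}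
    (hφ : ContDiffOn ℝ ∞ φ U) (hU : U ≤ chartOpens e) (hpU : e p ∈ U)
    (hJ : ∀ y : U, IsUnit ((jacobian φ hφ).map (eval y))) :
    ∃ e' ∈ IsManifold.maximalAtlas (𝓡 4) ∞ M, p ∈ e'.source ∧ (∃ c r, e'.target = ball c r) ∧
      ∃ ψ : E4 → E4, ContDiffOn ℝ ∞ ψ (chartOpens e') ∧
        (∀ q ∈ e'.target, ψ q ∈ U ∧ φ (ψ q) = q ∧ e.symm (ψ q) = e'.symm q) := by
  obtain ⟨f', hf'⟩ := exists_fderiv_equiv hφ hpU (hJ ⟨_, hpU⟩)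
  have hφU : ∀ y ∈ U, ContDiffAt ℝ ∞ φ y := fun y hy => hφ.contDiffAt (U.isOpen.mem_nhds hy)
  set θ := (hφU _ hpU).toOpenPartialHomeomorph φ hf' (by simp) with hθ
  have hpθ : e p ∈ θ.source := (hφU _ hpU).mem_toOpenPartialHomeomorph_source hf' (by simp)
  have hopen : IsOpen (θ.target ∩ θ.symm ⁻¹' (U : Set E4)) :=
    θ.isOpen_inter_preimage_symm U.isOpen
  obtain ⟨r, hr, hb⟩ := Metric.isOpen_iff.mp hopen (φ (e p))
    ⟨θ.map_source hpθ, by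
      change θ.symm (θ (e p)) ∈ U
      rw [θ.left_inv hpθ]; exact hpU⟩
  set B := ball (φ (e p)) r with hB
  -- The chart is cut down so that its target is a ball: convexity is needed to recognize functions
  -- of z alone.
  set θ' := (θ.symm.restrOpen B isOpen_ball).symm with hθ'
  have hθt : θ'.target = B := by
    rw [hθ', OpenPartialHomeomorph.symm_target, OpenPartialHomeomorph.restrOpen_source]
    exact Set.inter_eq_right.mpr fun x hx => (hb hx).1
  have hθs : ∀ y, θ'.symm y = θ.symm y := fun y => rfl
  have hsrc : ∀ y ∈ θ'.source, y ∈ U := by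
    intro y hy
    have h1 := θ'.map_source hy
    rw [hθt] at h1
    have h2 := (hb h1).2
    rwa [Set.mem_preimage, ← hθs, θ'.left_inv hy] at h2
  have hψ : ContDiffOn ℝ ∞ θ.symm B := fun q hq => by
    obtain ⟨f₁, hf₁⟩ := exists_fderiv_equiv hφ (hb hq).2 (hJ ⟨_, (hb hq).2⟩)
    exact (θ.contDiffAt_symm (hb hq).1 hf₁ (hφU _ (hb hq).2)).contDiffWithinAt
  have ht : (e.trans θ').target = B := by
    rw [OpenPartialHomeomorph.trans_target, hθt]
    exact Set.inter_eq_left.mpr fun x hx => hU (hb hx).2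
  refine ⟨e.trans θ', ?_, ?_, ⟨_, _, ht⟩, θ.symm, ?_, fun q hq => ?_⟩
  · refine OpenPartialHomeomorph.mem_maximalAtlas_of_contMDiffOn _ ?_ ?_
    · have h1 : ContMDiffOn (𝓡 4) (𝓡 4) ∞ φ U := contMDiffOn_iff_contDiffOn.mpr hφ
      refine h1.comp ((contMDiffOn_of_mem_maximalAtlas he).mono fun x hx => hx.1) fun x hx => ?_
      exact hsrc _ hx.2
    · have h1 : ContMDiffOn (𝓡 4) (𝓡 4) ∞ θ.symm B := contMDiffOn_iff_contDiffOn.mpr hψ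
      rw [ht]
      exact (contMDiffOn_symm_of_mem_maximalAtlas he).comp h1 fun x hx => hU (hb hx).2
  · refine ⟨hp, ?_⟩
    have h1 : φ (e p) ∈ θ'.target := hθt ▸ mem_ball_self hr
    have h2 := θ'.map_target h1
    have h3 : θ'.symm (φ (e p)) = e p := θ.left_inv hpθ
    rwa [h3] at h2
  · change ContDiffOn ℝ ∞ θ.symm (e.trans θ').target
    rw [ht]; exact hψ
  · rw [ht] at hq
    exact ⟨(hb hq).2, θ.right_inv (hb hq).1, rfl⟩

/-- On a ball, a function whose differential is proportional to that of a coordinate is a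
function of that coordinate. -/
theorem SmoothFn.exists_eq_comp_coord {c : E4} {r : ℝ} (hV : (V : Set E4) = ball c r) {l : Fin 4}
    {f : SmoothFn V} (hf : ∀ i ≠ l, partialD i f = 0) :
    ∃ A : ℝ → ℝ, ContDiffOn ℝ ∞ A ((fun q : E4 => q l) '' V) ∧ ∀ q : V, eval q f = A ((q : E4) l) := by
  -- The line through the centre in direction l. A coordinate difference is at most the norm, so
  -- this line meets every slice of the ball at fixed l-th coordinate.
  set P : ℝ → E4 := fun s => c + (s - c l) • EuclideanSpace.single l 1 with hP
  have hPl : ∀ s, P s l = s := fun s => by simp [hP]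
  have hPV : ∀ q ∈ V, P (q l) ∈ V := fun q hq => by
    change q ∈ (V : Set E4) at hq
    change P (q l) ∈ (V : Set E4)
    rw [hV, mem_ball, dist_eq_norm] at hq ⊢
    refine lt_of_le_of_lt ?_ hq
    rw [hP, add_sub_cancel_left, norm_smul, PiLp.norm_single, norm_one, mul_one]
    exact PiLp.norm_apply_le (q - c) l
  refine ⟨fun s => f.toFun (P s), f.contDiffOn.comp ?_ ?_, fun q => ?_⟩
  · exact ContDiff.contDiffOn (by fun_prop)
  · rintro _ ⟨q, hq, rfl⟩
    exact hPV q hq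
  · have hconv : Convex ℝ (V : Set E4) := hV ▸ convex_ball c r
    -- The segment from q to the central line stays in the ball and in the slice, where f has zero
    -- derivative.
    set v : E4 := P ((q : E4) l) - q with hv
    have hvl : v l = 0 := by rw [hv, PiLp.sub_apply, hPl, sub_self]
    have hmem : ∀ t ∈ Icc (0 : ℝ) 1, (q : E4) + t • v ∈ V := fun t ht =>
      hconv.add_smul_sub_mem q.2 (hPV q q.2) ht
    have hder : ∀ t ∈ Icc (0 : ℝ) 1, HasDerivAt (fun t : ℝ => f.toFun ((q : E4) + t • v)) 0 t := by
      intro t ht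
      have h1 : HasDerivAt (fun t : ℝ => (q : E4) + t • v) v t := by
        simpa using ((hasDerivAt_id t).smul_const v).const_add (q : E4)
      have h2 := (f.differentiableAt ⟨_, hmem t ht⟩).hasFDerivAt.comp_hasDerivAt t h1
      have h3 : fderiv ℝ f.toFun ((q : E4) + t • v) v = 0 := by
        have h4 : ∀ i ≠ l, fderiv ℝ f.toFun ((q : E4) + t • v) (EuclideanSpace.single i 1) = 0 :=
          fun i hi => by
            have := congrArg (eval ⟨_, hmem t ht⟩) (hf i hi)
            rwa [eval_partialD, pd, map_zero] at this
        generalize fderiv ℝ f.toFun ((q : E4) + t • v) = L at h4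
        rw [← (EuclideanSpace.basisFun (Fin 4) ℝ).sum_repr v, map_sum]
        refine Finset.sum_eq_zero fun i _ => ?_
        rw [map_smul, EuclideanSpace.basisFun_apply, EuclideanSpace.basisFun_repr]
        by_cases hi : i = l
        · rw [hi, hvl, zero_smul]
        · rw [h4 i hi, smul_zero]
      exact h3 ▸ h2
    have h5 := constant_of_has_deriv_right_zero
      (fun t ht => (hder t ht).continuousAt.continuousWithinAt)
      (fun t ht => (hder t ⟨ht.1, ht.2.le⟩).hasDerivWithinAt) 1 ⟨zero_le_one, le_rfl⟩
    simp only [one_smul, zero_smul, add_zero] at h5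
    rw [hv, add_sub_cancel] at h5
    rw [← toFun_apply, ← h5]

end NewCharts


/-! ### Assembly of the adapted coordinates. -/

section NormalForm

open TopologicalSpace Matrix Finset SmoothFn Topology

variable {G : E4 → Matrix (Fin 4) (Fin 4) ℝ} {U : Opens E4}

/-- Coordinates in which the inverse of the metric is diagonal, and equal to the inverse of the
line element. -/
theorem LeafCoordinates.exists_coordinates {h : IsMetricOn G U} {k : ℝ} {A H z : SmoothFn U}
    {f : Fin 3 → SmoothFn U} (hl : LeafCoordinates h k A H z f) :
    ∃ (u : SmoothFn U) (c : Fin 4 → SmoothFn U), c 3 = z ∧ (∀ y, 0 < eval y u) ∧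
      (∀ y, eval y u
        * (1 + k / 4 * (eval y (c 1) ^ 2 + eval y (c 2) ^ 2 - eval y (c 0) ^ 2)) = 1) ∧
      ∀ y, (of fun a i => eval y (partialD i (c a))) * (G y)⁻¹
          * (of fun a i => eval y (partialD i (c a)))ᵀ
        * diagonal ![-(eval y A * eval y u) ^ 2, (eval y A * eval y u) ^ 2,
          (eval y A * eval y u) ^ 2, 1] = 1 := by
  obtain ⟨u, X, hu, huX, hXz, hXX⟩ := hl.exists_stereographic
  refine ⟨u, ![X 0, X 1, X 2, z], rfl, hu, fun y => ?_, fun y => ?_⟩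
  · have := huX y
    simp only [Fin.sum_univ_three, eta] at this
    simp at this ⊢
    linear_combination this
  · have e : ∀ a b, ((of fun a i => eval y (partialD i ((![X 0, X 1, X 2, z] : Fin 4 → _) a)))
          * (G y)⁻¹ * (of fun a i => eval y (partialD i ((![X 0, X 1, X 2, z] : Fin 4 → _) a)))ᵀ)
          a b = eval y (grad ((![X 0, X 1, X 2, z] : Fin 4 → _) a)
            ⬝ᵥ h.inv *ᵥ grad ((![X 0, X 1, X 2, z] : Fin 4 → _) b)) := fun a b => by
      rw [h.eval_inner, Matrix.mul_assoc]
      rfl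
    have hzX : ∀ i, eval y (grad z ⬝ᵥ h.inv *ᵥ grad (X i)) = 0 := fun i => by
      rw [h.eval_inner, h.inner_comm, ← h.eval_inner, hXz, map_zero]
    have hXX' : ∀ i j, eval y (grad (X i) ⬝ᵥ h.inv *ᵥ grad (X j)) * (eval y A * eval y u) ^ 2
        = eta i.castSucc j.castSucc := fun i j => by
      have := congrArg (eval y) (hXX i j)
      simp only [map_mul, AlgHom.commutes] at this
      rw [mul_comm, mul_pow, sq, sq, ← mul_assoc]
      exact this
    ext a b
    rw [Matrix.mul_diagonal, e]
    have h00 := hXX' 0 0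
    have h01 := hXX' 0 1
    have h02 := hXX' 0 2
    have h10 := hXX' 1 0
    have h11 := hXX' 1 1
    have h12 := hXX' 1 2
    have h20 := hXX' 2 0
    have h21 := hXX' 2 1
    have h22 := hXX' 2 2
    simp [eta, -mul_eq_zero] at h00 h01 h02 h10 h11 h12 h20 h21 h22
    fin_cases a <;> fin_cases b <;>
      simp [h00, h01, h02, h10, h11, h12, h20, h21, h22, hzX, hXz, hl.inner_zz, -mul_eq_zero]

variable {M : Type*} [TopologicalSpace M] [ChartedSpace E4 M] [IsManifold (𝓡 4) ∞ M]

/-- The known Gram matrix of the coordinate differentials is the inverse metric in the new chart. It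
is inverted by the line element matrix, using A² u² = A²/(1 + (k/4)(x² + y² - t²))². -/
theorem LeafCoordinates.exists_lineElement (g : LorentzMetric M) {e : OpenPartialHomeomorph M E4}
    (he : e ∈ IsManifold.maximalAtlas (𝓡 4) ∞ M) {p : M} (hp : p ∈ e.source) (hU : U ≤ chartOpens e)
    (hpU : e p ∈ U) {h : IsMetricOn (components g.val e) U} {k : ℝ} {A H z : SmoothFn U}
    {f : Fin 3 → SmoothFn U} (hl : LeafCoordinates h k A H z f) :
    ∃ e' ∈ IsManifold.maximalAtlas (𝓡 4) ∞ M, p ∈ e'.source ∧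
      ∃ A : ℝ → ℝ, ContDiffOn ℝ ∞ A ((fun q : E4 => q 3) '' e'.target) ∧
        ∀ q ∈ e'.target, 0 < A (q 3) ∧ 1 + k / 4 * (q 1 ^ 2 + q 2 ^ 2 - q 0 ^ 2) ≠ 0 ∧
          components g.val e' q = lineElement k A q := by
  obtain ⟨u, c, hc3, hu, huc, hJ⟩ := hl.exists_coordinates
  set φ : E4 → E4 := fun y => WithLp.toLp 2 fun a => (c a).toFun y with hφd
  have hφ : ContDiffOn ℝ ∞ φ U := contDiffOn_euclidean.mpr fun a => (c a).contDiffOn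
  have hjac : ∀ y : U, (jacobian φ hφ).map (eval y) = of fun a i => eval y (partialD i (c a)) := by
    intro y
    ext a i
    rw [Matrix.map_apply, jacobian, of_apply, of_apply]
    congr 2
    ext y
    rw [eval_mk]
    exact toFun_apply _ y
  obtain ⟨e', he', hpe', ⟨x₀, r, hball⟩, ψ, hψ, hψt⟩ := exists_chart_of_jacobian he hp hφ hU hpU
    fun y => by
      rw [hjac]
      refine IsUnit.of_mul_eq_one _ ((mul_assoc _ _ _).symm.trans ((mul_assoc _ _ _).symm.trans
        (hJ y)))
  have hm : Set.MapsTo ψ (chartOpens e') U := fun q hq => (hψt q hq).1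
  have hiso := g.isIsometryOn (e := e') (e' := e) he hψ (fun q hq => hU (hm hq))
    fun q hq => (hψt q hq).2.2
  set P := pullback ψ hψ hm with hP
  have hPc : ∀ a, P (c a) = coord a := by
    intro a
    ext q
    rw [eval_pullback, coord, eval_mk, ← toFun_apply]
    exact congrArg (fun x : E4 => x a) (hψt q q.2).2.1
  have hJK : ∀ i a, ∑ b, jacobian ψ hψ b i * P (partialD b (c a)) = if i = a then 1 else 0 := by
    intro i a
    rw [← partialD_pullback, ← hP, hPc, partialD_coord]
  -- dA = H A dz and z is the last new coordinate, so A has no derivative in the other directions.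
  have hPA : ∀ i ≠ 3, partialD i (P A) = 0 := by
    intro i hi
    have h1 := hJK i 3
    rw [if_neg hi, hc3] at h1
    rw [hP, partialD_pullback, ← hP]
    have h2 : ∀ b, jacobian ψ hψ b i * P (partialD b A)
        = P (H * A) * (jacobian ψ hψ b i * P (partialD b z)) := fun b => by
      rw [hl.deriv_A, map_mul]; ring
    rw [Finset.sum_congr rfl fun b _ => h2 b, ← Finset.mul_sum, h1, mul_zero]
  obtain ⟨A', hA', hAA'⟩ := SmoothFn.exists_eq_comp_coord (V := chartOpens e') hball hPA
  refine ⟨e', he', hpe', A', hA', fun q hq => ?_⟩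
  set y : U := ⟨ψ q, hm hq⟩ with hy
  have hA1 : A' (q 3) = eval y A := by
    rw [← hAA' ⟨q, hq⟩]; exact eval_pullback _ _ _ _
  have hcq : ∀ a, eval y (c a) = q a := fun a => by
    have := congrArg (eval ⟨q, hq⟩) (hPc a)
    rwa [eval_pullback] at this
  have huq := huc y
  simp only [hcq] at huq
  set w := 1 + k / 4 * (q 1 ^ 2 + q 2 ^ 2 - q 0 ^ 2) with hw
  have hw0 : w ≠ 0 := right_ne_zero_of_mul_eq_one huq
  refine ⟨hA1 ▸ hl.pos y, hw0, ?_⟩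
  set J : Matrix (Fin 4) (Fin 4) ℝ := of fun a i => eval y (partialD i (c a))
  set K := (jacobian ψ hψ).map (eval ⟨q, hq⟩) with hK
  set D : Matrix (Fin 4) (Fin 4) ℝ := diagonal ![-(eval y A * eval y u) ^ 2,
    (eval y A * eval y u) ^ 2, (eval y A * eval y u) ^ 2, 1] with hD
  have hJK1 : J * K = 1 := by
    ext a i
    have := congrArg (eval ⟨q, hq⟩) (hJK i a)
    rw [Matrix.mul_apply, Matrix.one_apply]
    simp only [map_sum, map_mul, hP, eval_pullback] at this
    refine (Finset.sum_congr rfl fun b _ => mul_comm _ _).trans (this.trans ?_)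
    by_cases hia : i = a
    · simp [hia]
    · simp [hia, Ne.symm hia]
  have hKJ : K * J = 1 := mul_eq_one_comm.mp hJK1
  have hG : components g.val e (ψ q) * (components g.val e (ψ q))⁻¹ = 1 :=
    Matrix.mul_nonsing_inv _ (h.det _ (hm hq)).isUnit
  have hpull := hiso.pull q hq
  have hl1 : lineElement k A' q = D := by
    have e : A' (q 3) ^ 2 / w ^ 2 = (eval y A * eval y u) ^ 2 := by
      rw [hA1, eq_comm, eq_div_iff (pow_ne_zero _ hw0)]
      linear_combination (eval y A) ^ 2 * (eval y u * w + 1) * huq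
    rw [lineElement, ← hw, e]
  rw [hl1]
  -- Pulling back by ψ, the Jacobian K of ψ cancels against J, so the metric times the Gram matrix
  -- is the identity; uniqueness of inverses finishes.
  have h1 : components g.val e' q * (J * (components g.val e (ψ q))⁻¹ * Jᵀ) = 1 := by
    rw [hpull]
    calc _ = Kᵀ * (components g.val e (ψ q) * (K * J) * (components g.val e (ψ q))⁻¹) * Jᵀ := by
          simp only [Matrix.mul_assoc]; rfl
      _ = 1 := by
          rw [hKJ, Matrix.mul_one, hG, Matrix.mul_one, ← Matrix.transpose_mul, hJK1,
            Matrix.transpose_one]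
  exact left_inv_eq_right_inv h1 (hJ y)

/-- A Yang pure space of Segré type `{(1,11)1}` is locally a warped product of a line and a
three-dimensional space of constant curvature, with the same curvature constant everywhere. -/
theorem LorentzMetric.hasLineElement [ConnectedSpace M] (g : LorentzMetric M)
    (hS : g.HasSegreType) (hY : g.IsYangPureSpace) : g.HasLineElement := by
  obtain ⟨k, hk⟩ := g.exists_leafCurvature_eq hS hY
  refine ⟨k, fun p => ?_⟩
  set e := chartAt E4 p
  have he : e ∈ IsManifold.maximalAtlas (𝓡 4) ∞ M := IsManifold.chart_mem_maximalAtlas p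
  have hp : p ∈ e.source := mem_chart_source E4 p
  obtain ⟨V, hV, hpV, n, hn⟩ := (g.isMetricOn he).exists_isNormal (hS e he) (e.map_source hp)
  obtain ⟨A, H, H', ψ, hw⟩ := IsMetricOn.exists_isWarpedNormal _ _ (fun y hy => hY e he y (hV hy)) hn
  obtain ⟨W, hW, hpW, A', H', z, f, hl⟩ := hw.exists_leafCoordinates hn
    (fun y hy => hk e he y (hV hy)) hpV
  exact hl.exists_lineElement g he hp (hW.trans hV) hpW

end NormalForm

end Yang

end

theorem theoremt {M : Type*} [TopologicalSpace M] [T2Space M] [SecondCountableTopology M]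
    [ConnectedSpace M] [ChartedSpace Yang.E4 M] [IsManifold (𝓡 4) ∞ M]
    (g : Yang.LorentzMetric M) (hSegre : g.HasSegreType) :
    g.IsYangPureSpace ↔ g.HasConstantRicciScalar ∧ g.HasLineElement := by
  exact ⟨fun h => ⟨g.hasConstantRicciScalar h, g.hasLineElement hSegre h⟩,
    fun h => g.isYangPureSpace_of_lineElement h.1 h.2⟩
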